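/- Let $M$ be a complex manifold, $E\to M$ a holomorphic vector bundle of rank $6$ or $7$, and $\mathcal O_{\Lambda E}$ the sheaf of holomorphic sections of $\Lambda E$. Let $End(\Lambda E)$ be the sheaf of $\mathbb C$-linear endomorphisms of $\mathcal O_{\Lambda E}$ and $Der_{2k}(\Lambda E)$ the subsheaf of derivations mapping $\mathcal O_{\Lambda^jE}$ to $\mathcal O_{\Lambda^{j+2k}E}$ for all $j$; put $Der^{(2)}(\Lambda E)=\bigoplus_{k\ge1}Der_{2k}(\Lambda E)$. Let $pr_{2k}$ denote the projection of an endomorphism onto its component of degree $2k$, and $pr_{(2k)}=\sum_{l=1}^{k}pr_{2l}$. Let $G_E$ be the sheaf of automorphisms $\varphi$ of the sheaf of algebras $\mathcal O_{\Lambda E}$ with $(\varphi-Id)(\mathcal O_{\Lambda^jE})\subset\bigoplus_{k\ge1}\mathcal O_{\Lambda^{j+2k}E}$ for all $j$. Čech cochains $C^p(M,\cdot)$, cocycles $Z^p$, coboundaries $B^p$ and cohomology $H^p$ are taken with respect to a directed system of open coverings of $M$ with a common index set (cochains being elements of the direct limit over the system). Examples are a single open covering, such as a Leray covering, and the system of all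 coverings $(U_x)_{x\in M}$ with $x\in U_x$, which gives the Čech cohomology of $M$. Write $(dv)_{ij}=v_i-v_j$, $(du)_{ijk}=u_{jk}-u_{ik}+u_{ij}$, $(dw)_{ijkl}=w_{jkl}-w_{ikl}+w_{ijl}-w_{ijk}$ for the abelian coboundary maps and $(\mathbf dg)_{ijk}=g_{ij}g_{jk}g_{ki}$ (composition of maps). Put $Z^1(M,G_E)=\{g\in C^1(M,G_E)\mid \mathbf dg=Id\}$, and let $H^1(M,G_E)$ be the set of orbits of $C^0(M,G_E)$ on $Z^1(M,G_E)$ for the action $(h.g)_{ij}=h_ig_{ij}h_j^{-1}$. Put $$\tilde C^1=\{u\in C^1(M,Der^{(2)}(\Lambda E))\mid \exp(u)\in Z^1(M,G_E)\},\qquad R_{2q}(u)=pr_{2q}\big(\mathbf d\exp(pr_{(2q-2)}(u))\big)\quad(q\ge2),$$ $$\tilde Z^1=\{u_2\in Z^1(M,Der_2(\Lambda E))\mid R_4(u_2)\in C^2(M,Der_4(\Lambda E)),\ R_6(u_2)\in C^2(M,Der_6(\Lambda E))\}.$$ Assume that $H^2(M,Der_4(\Lambda E))=H^2(M,Der_6(\Lambda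 E))=0$. Then: (1) For $u_2\in C^1(M,Der_2(\Lambda E))$ there is a $u\in\tilde C^1$ with $pr_2(u)=u_2$ if and only if $u_2\in\tilde Z^1$. (2) If in addition $H^0(M,Der^{(2)}(\Lambda E))=0$, then there are maps $D_{2q}:\tilde C^1\to C^1(M,Der_{2q}(\Lambda E))$, $q\ge2$, such that $D_{2q}(u)$ depends only on $pr_{(2q-2)}(u)$ and $dD_{2q}(u)=R_{2q}(u)$ for all $u\in\tilde C^1$, and such that, with $D=\sum_{q\ge2}D_{2q}$, the assignment $$\sigma_D([\exp(u)])=\big([pr_2(D(u)+u)],[pr_4(D(u)+u)],[pr_6(D(u)+u)]\big),\qquad u\in\tilde C^1,$$ is a well-defined bijection $$\sigma_D:H^1(M,G_E)\to \tilde Z^1/B^1(M,Der_2(\Lambda E))\ \oplus\ H^1(M,Der_4(\Lambda E))\ \oplus\ H^1(M,Der_6(\Lambda E)).$$ -/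

import Mathlib

open scoped Manifold ContDiff Topology
open TopologicalSpace Bundle

noncomputable section

namespace SuperCech

/-! ## Exterior algebra: the degree projections -/

section Exterior

variable {V W : Type*} [AddCommGroup V] [Module ℂ V] [AddCommGroup W] [Module ℂ W]

/-- The projection of the exterior algebra of `V` onto its component `⋀^j V`. -/
def extProj (V : Type*) [AddCommGroup V] [Module ℂ V] (j : ℕ) :
    ExteriorAlgebra ℂ V →ₗ[ℂ] ExteriorAlgebra ℂ V :=
  GradedAlgebra.proj (fun i : ℕ => ⋀[ℂ]^i V) j

theorem map_mem_exteriorPower (f : V →ₗ[ℂ] W) {i : ℕ} {a : ExteriorAlgebra ℂ V}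
    (ha : a ∈ ⋀[ℂ]^i V) : ExteriorAlgebra.map f a ∈ ⋀[ℂ]^i W := by
  have h : Submodule.map (ExteriorAlgebra.map f).toLinearMap (⋀[ℂ]^i V) ≤ ⋀[ℂ]^i W := by
    rw [ExteriorAlgebra.exteriorPower, ExteriorAlgebra.exteriorPower, Submodule.map_pow]
    gcongr
    rintro _ ⟨_, ⟨v, rfl⟩, rfl⟩
    exact ⟨f v, by simp⟩
  exact h ⟨a, ha, rfl⟩

theorem extProj_map (f : V →ₗ[ℂ] W) (j : ℕ) (a : ExteriorAlgebra ℂ V) :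
    extProj W j (ExteriorAlgebra.map f a) = ExteriorAlgebra.map f (extProj V j a) := by
  induction a using DirectSum.Decomposition.inductionOn (fun i : ℕ => ⋀[ℂ]^i V) with
  | zero => simp
  | add a b ha hb => simp only [map_add, ha, hb]
  | @homogeneous i m =>
    have hm : ExteriorAlgebra.map f (m : ExteriorAlgebra ℂ V) ∈ ⋀[ℂ]^i W :=
      map_mem_exteriorPower f m.2
    simp only [extProj, GradedAlgebra.proj_apply]
    by_cases hij : i = j
    · subst hij
      rw [DirectSum.decompose_of_mem_same (fun i : ℕ => ⋀[ℂ]^i W) hm,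
        DirectSum.decompose_of_mem_same (fun i : ℕ => ⋀[ℂ]^i V) m.2]
    · rw [DirectSum.decompose_of_mem_ne (fun i : ℕ => ⋀[ℂ]^i W) hm hij,
        DirectSum.decompose_of_mem_ne (fun i : ℕ => ⋀[ℂ]^i V) m.2 hij, map_zero]

end Exterior

/-! ## The sheaf of holomorphic sections of `ΛE` -/

section Sheaf

variable (n : ℕ) {M : Type*} [TopologicalSpace M] [ChartedSpace (EuclideanSpace ℂ (Fin n)) M]
  (F : Type*) [NormedAddCommGroup F] [NormedSpace ℂ F] [FiniteDimensional ℂ F]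
  (E : M → Type*) [∀ x, AddCommGroup (E x)] [∀ x, Module ℂ (E x)]
  [∀ x, TopologicalSpace (E x)] [TopologicalSpace (TotalSpace F E)]
  [FiberBundle F E] [VectorBundle ℂ F E]

/-- A (set-theoretic) section `s` of `ΛE` over the open set `U` is holomorphic if, read in the
local trivialization of `E` around any point `x₀` of `U`, all its coordinates (values of linear
functionals) are holomorphic at `x₀`. -/
def IsHolomorphicSection (U : Opens M) (s : ∀ x : U, ExteriorAlgebra ℂ (E x)) : Prop :=
  ∀ (x₀ : U) (l : ExteriorAlgebra ℂ F →ₗ[ℂ] ℂ),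
    ContMDiffAt 𝓘(ℂ, EuclideanSpace ℂ (Fin n)) 𝓘(ℂ, ℂ) ω
      (fun x : U => l (ExteriorAlgebra.map
        ((trivializationAt F E (x₀ : M)).linearMapAt ℂ (x : M)) (s x))) x₀

instance : FiniteDimensional ℂ (ExteriorAlgebra ℂ F) :=
  Module.Finite.of_basis (Module.finBasis ℂ F).ExteriorAlgebra

/-- The algebra of holomorphic sections of `ΛE` over `U`. -/
def secSubalgebra (U : Opens M) : Subalgebra ℂ (∀ x : U, ExteriorAlgebra ℂ (E x)) where
  carrier := {s | IsHolomorphicSection n F E U s}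
  mul_mem' {s t} hs ht x₀ l := by
    let b := Module.finBasis ℂ (ExteriorAlgebra ℂ F)
    have key : ∀ a c : ExteriorAlgebra ℂ F,
        l (a * c) = ∑ i, ∑ j, (b.coord i a * b.coord j c) * l (b i * b j) := by
      intro a c
      conv_lhs => rw [← b.sum_repr a, ← b.sum_repr c]
      simp only [Finset.sum_mul_sum, map_sum, smul_mul_smul_comm, map_smul, smul_eq_mul,
        Module.Basis.coord_apply]
    have : (fun x : U => l (ExteriorAlgebra.map
        ((trivializationAt F E (x₀ : M)).linearMapAt ℂ (x : M)) ((s * t) x))) = fun x : U =>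
        ∑ i, ∑ j, (b.coord i (ExteriorAlgebra.map
          ((trivializationAt F E (x₀ : M)).linearMapAt ℂ (x : M)) (s x)) *
          b.coord j (ExteriorAlgebra.map
          ((trivializationAt F E (x₀ : M)).linearMapAt ℂ (x : M)) (t x))) * l (b i * b j) := by
      funext x
      rw [Pi.mul_apply, map_mul, key]
    rw [this]
    refine contMDiffAt_finsetSum fun i _ => contMDiffAt_finsetSum fun j _ => ?_
    exact ((hs x₀ (b.coord i)).mul (ht x₀ (b.coord j))).mul contMDiffAt_const
  add_mem' {s t} hs ht x₀ l := by
    simp only [Pi.add_apply, map_add]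
    exact (hs x₀ l).add (ht x₀ l)
  algebraMap_mem' r x₀ l := by
    simpa [AlgHom.commutes] using contMDiffAt_const

/-- `𝒪_{ΛE}(U)`: the algebra of holomorphic sections of `ΛE` over `U`. -/
def Sec (U : Opens M) : Type _ := secSubalgebra n F E U

instance (U : Opens M) : Ring (Sec n F E U) :=
  inferInstanceAs (Ring (secSubalgebra n F E U))

instance (U : Opens M) : Algebra ℂ (Sec n F E U) :=
  inferInstanceAs (Algebra ℂ (secSubalgebra n F E U))

variable {n F E} in
/-- Restriction of sections. -/
def Sec.res {U V : Opens M} (h : U ≤ V) : Sec n F E V →ₐ[ℂ] Sec n F E U where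
  toFun s := ⟨fun x => s.1 (Opens.inclusion h x), fun x₀ l =>
    (s.2 (Opens.inclusion h x₀) l).comp x₀ (contMDiff_inclusion h x₀)⟩
  map_one' := rfl
  map_mul' _ _ := rfl
  map_zero' := rfl
  map_add' _ _ := rfl
  commutes' _ := rfl

variable {n F E} in
/-- The degree `j` component of a section of `ΛE`. -/
def Sec.proj (j : ℕ) {U : Opens M} : Sec n F E U →ₗ[ℂ] Sec n F E U where
  toFun s := ⟨fun x => extProj (E x) j (s.1 x), fun x₀ l => by
    simpa only [LinearMap.comp_apply, extProj_map] using s.2 x₀ (l ∘ₗ extProj F j)⟩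
  map_add' s t := Subtype.ext (funext fun x => map_add (extProj (E x) j) (s.1 x) (t.1 x))
  map_smul' c s := Subtype.ext (funext fun x => map_smul (extProj (E x) j) c (s.1 x))

/-- `𝒪_{Λ^j E}(U)`, as a submodule of `𝒪_{ΛE}(U)`. -/
def Sec.hom (j : ℕ) (U : Opens M) : Submodule ℂ (Sec n F E U) where
  carrier := {s | ∀ x : U, s.1 x ∈ ⋀[ℂ]^j (E x)}
  add_mem' hs ht x := add_mem (hs x) (ht x)
  zero_mem' _ := zero_mem _
  smul_mem' c _ hs x := Submodule.smul_mem _ c (hs x)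

/-! ## Sheaf endomorphisms, derivations and automorphisms of `𝒪_{ΛE}` -/

/-- The families of `ℂ`-linear endomorphisms of `𝒪_{ΛE}(W)`, `W ⊆ U` open, that commute with
restrictions. -/
def endSubalgebra (U : Opens M) :
    Subalgebra ℂ (∀ W : {W : Opens M // W ≤ U}, Module.End ℂ (Sec n F E W.1)) where
  carrier := {f | ∀ (W W' : {W : Opens M // W ≤ U}) (h : W'.1 ≤ W.1) (s : Sec n F E W.1),
    Sec.res h (f W s) = f W' (Sec.res h s)}
  mul_mem' {f g} hf hg W W' h s := by
    simp only [Pi.mul_apply, Module.End.mul_apply, hf W W' h, hg W W' h]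
  add_mem' {f g} hf hg W W' h s := by
    simp only [Pi.add_apply, LinearMap.add_apply, map_add, hf W W' h, hg W W' h]
  algebraMap_mem' r W W' h s := by
    simp [Module.algebraMap_end_apply]

/-- The `ℂ`-linear endomorphisms of the sheaf `𝒪_{ΛE}|_U`: families of endomorphisms of
`𝒪_{ΛE}(W)`, `W ⊆ U` open, that commute with restrictions. The product is the composition. -/
def SheafEnd (U : Opens M) : Type _ := endSubalgebra n F E U

instance (U : Opens M) : Ring (SheafEnd n F E U) :=
  inferInstanceAs (Ring (endSubalgebra n F E U))

instance (U : Opens M) : Algebra ℂ (SheafEnd n F E U) :=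
  inferInstanceAs (Algebra ℂ (endSubalgebra n F E U))

variable {n F E} in
/-- Restriction of sheaf endomorphisms to a smaller open set. -/
def SheafEnd.res {U V : Opens M} (h : U ≤ V) : SheafEnd n F E V →ₐ[ℂ] SheafEnd n F E U where
  toFun f := ⟨fun W => f.1 ⟨W.1, W.2.trans h⟩, fun W W' hW s =>
    f.2 ⟨W.1, W.2.trans h⟩ ⟨W'.1, W'.2.trans h⟩ hW s⟩
  map_one' := rfl
  map_mul' _ _ := rfl
  map_zero' := rfl
  map_add' _ _ := rfl
  commutes' _ := rfl

/-- The sheaf endomorphism that projects `𝒪_{ΛE}` onto `𝒪_{Λ^j E}`. -/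
def SheafEnd.projDeg (j : ℕ) (U : Opens M) : SheafEnd n F E U :=
  ⟨fun _ => Sec.proj j, fun _ _ _ _ => rfl⟩

variable {n F E} in
/-- The component of degree `d` of an endomorphism of `𝒪_{ΛE}`: the projection
`pr_d : f ↦ ∑_j π_{j+d} ∘ f ∘ π_j`, where `π_j` is the projection onto `𝒪_{Λ^j E}`;
recall that `π_j = 0` for `j > rank E`. -/
def SheafEnd.pr (d : ℕ) {U : Opens M} : SheafEnd n F E U →ₗ[ℂ] SheafEnd n F E U where
  toFun f := ∑ j ∈ Finset.range (Module.finrank ℂ F + 1),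
    SheafEnd.projDeg n F E (j + d) U * f * SheafEnd.projDeg n F E j U
  map_add' f g := by simp only [mul_add, add_mul, Finset.sum_add_distrib]
  map_smul' c f := by
    simp only [mul_smul_comm, smul_mul_assoc, Finset.smul_sum, RingHom.id_apply]

theorem SheafEnd.res_pr (d : ℕ) {U V : Opens M} (h : U ≤ V) (f : SheafEnd n F E V) :
    SheafEnd.res h (SheafEnd.pr d f) = SheafEnd.pr d (SheafEnd.res h f) :=
  map_sum (SheafEnd.res h) _ _

/-- A subsheaf of `ℂ`-vector spaces of `End(ΛE)`, only the stability under restriction being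
recorded (all instances used below are sheaves). -/
structure Coeff where
  /-- the sections over `U` -/
  sections (U : Opens M) : Submodule ℂ (SheafEnd n F E U)
  res_mem {U V : Opens M} (h : U ≤ V) {f : SheafEnd n F E V} :
    f ∈ sections V → SheafEnd.res h f ∈ sections U

variable {n F E} in
/-- The action of `f ∈ End(ΛE)(U)` on the sections over `W ⊆ U`. -/
def app {U : Opens M} (f : SheafEnd n F E U) (W : {W : Opens M // W ≤ U}) :
    Module.End ℂ (Sec n F E W.1) :=
  f.1 W

/-- The even derivations of `𝒪_{ΛE}|_U`. -/
def derivations (U : Opens M) : Submodule ℂ (SheafEnd n F E U) where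
  carrier := {f | ∀ (W : {W : Opens M // W ≤ U}) (s t : Sec n F E W.1),
    app f W (s * t) = app f W s * t + s * app f W t}
  add_mem' {f g} hf hg W s t := by
    have h : ∀ r, app (f + g) W r = app f W r + app g W r := fun _ => rfl
    rw [h, h, h, hf, hg, add_mul, mul_add]
    abel
  zero_mem' W s t := by
    have h : ∀ r, app (0 : SheafEnd n F E U) W r = 0 := fun _ => rfl
    rw [h, h, h, zero_mul, mul_zero, add_zero]
  smul_mem' c f hf W s t := by
    have h : ∀ r, app (c • f) W r = c • app f W r := fun _ => rfl
    rw [h, h, h, hf, smul_add, smul_mul_assoc, mul_smul_comm]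

/-- The endomorphisms of `𝒪_{ΛE}|_U` that map `𝒪_{Λ^j E}` to `𝒪_{Λ^{j+d} E}` for all `j`. -/
def homogeneous (d : ℕ) (U : Opens M) : Submodule ℂ (SheafEnd n F E U) where
  carrier := {f | ∀ (W : {W : Opens M // W ≤ U}) (j : ℕ), ∀ s ∈ Sec.hom n F E j W.1,
    app f W s ∈ Sec.hom n F E (j + d) W.1}
  add_mem' hf hg W j s hs := add_mem (hf W j s hs) (hg W j s hs)
  zero_mem' _ _ _ _ := zero_mem _
  smul_mem' c _ hf W j s hs := Submodule.smul_mem _ c (hf W j s hs)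

/-- `Der_d(ΛE)`, `d` even: the sheaf of `ℂ`-linear (even) derivations of `𝒪_{ΛE}` mapping
`𝒪_{Λ^j E}` to `𝒪_{Λ^{j+d} E}` for all `j`. -/
def Der (d : ℕ) : Coeff n F E where
  sections U := derivations n F E U ⊓ homogeneous n F E d U
  res_mem h _ hf := ⟨fun W => hf.1 ⟨W.1, W.2.trans h⟩, fun W => hf.2 ⟨W.1, W.2.trans h⟩⟩

/-- `Der^{(2)}(ΛE) = ⨁_{l ≥ 1} Der_{2l}(ΛE)`. -/
def DerNil : Coeff n F E where
  sections U := ⨆ l : ℕ, (Der n F E (2 * (l + 1))).sections U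
  res_mem {U V} h f hf := by
    have : (⨆ l : ℕ, (Der n F E (2 * (l + 1))).sections V) ≤
        (⨆ l : ℕ, (Der n F E (2 * (l + 1))).sections U).comap (SheafEnd.res h).toLinearMap :=
      iSup_le fun l g hg => Submodule.mem_iSup_of_mem l ((Der n F E _).res_mem h hg)
    exact this hf

/-- `G_E(U)`: the automorphisms `φ` of the sheaf of algebras `𝒪_{ΛE}|_U` with
`(φ - Id)(𝒪_{Λ^j E}) ⊆ ⨁_{k ≥ 1} 𝒪_{Λ^{j+2k} E}` for all `j` (in particular they are even). -/
def GE (U : Opens M) : Set (SheafEnd n F E U) :=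
  {φ | IsUnit φ ∧
    (∀ (W : {W : Opens M // W ≤ U}) (s t : Sec n F E W.1),
      app φ W (s * t) = app φ W s * app φ W t) ∧
    (∀ (W : {W : Opens M // W ≤ U}) (j : ℕ), ∀ s ∈ Sec.hom n F E j W.1,
      app φ W s - s ∈ ⨆ k : ℕ, Sec.hom n F E (j + 2 * (k + 1)) W.1)}

end Sheaf

/-! ## Čech cochains -/

/-- A directed system of open coverings of `M` with a common index set `ι`: for `α ≤ β` the
covering number `β` is finer than the covering number `α`, the set `U β i` being contained in
`U α i`. Cochains of `M` are the elements of the direct limit of the groups of cochains of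
these coverings. -/
structure CoverSystem (A ι M : Type*) [Preorder A] [TopologicalSpace M] where
  /-- the `i`-th member of the covering number `α` -/
  U : A → ι → Opens M
  anti : ∀ ⦃α β : A⦄, α ≤ β → ∀ i, U β i ≤ U α i
  covers : ∀ α, ⨆ i, U α i = ⊤

/-- A single open covering. The associated cochains are the Čech cochains of that covering. -/
def CoverSystem.single {ι M : Type*} [TopologicalSpace M] (U : ι → Opens M)
    (hU : ⨆ i, U i = ⊤) : CoverSystem Unit ι M where
  U _ := U
  anti _ _ _ _ := le_rfl
  covers _ := hU

/-- The set of all open coverings `(U_x)_{x ∈ M}` of `M` with `x ∈ U_x`. -/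
abbrev PointedCover (M : Type*) [TopologicalSpace M] : Type _ :=
  {U : M → (Opens M)ᵒᵈ // ∀ x, x ∈ OrderDual.ofDual (U x)}

instance (M : Type*) [TopologicalSpace M] : Nonempty (PointedCover M) :=
  ⟨⟨fun _ => OrderDual.toDual ⊤, fun _ => trivial⟩⟩

instance (M : Type*) [TopologicalSpace M] : IsDirectedOrder (PointedCover M) where
  directed U V := ⟨⟨fun x => U.1 x ⊔ V.1 x, fun x => ⟨U.2 x, V.2 x⟩⟩,
    fun _ => le_sup_left, fun _ => le_sup_right⟩

/-- The system of all open coverings `(U_x)_{x ∈ M}`, `x ∈ U_x`, ordered by refinement. Every open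
covering of `M` is refined by one of these, so that the associated cohomology is the Čech
cohomology of `M`. -/
def CoverSystem.all (M : Type*) [TopologicalSpace M] : CoverSystem (PointedCover M) M M where
  U α x := OrderDual.ofDual (α.1 x)
  anti _ _ h x := h x
  covers α := by
    rw [eq_top_iff]
    exact fun x _ => Opens.mem_iSup.mpr ⟨x, α.2 x⟩

section Cech

variable (n : ℕ) {M : Type*} [TopologicalSpace M] [ChartedSpace (EuclideanSpace ℂ (Fin n)) M]
  (F : Type*) [NormedAddCommGroup F] [NormedSpace ℂ F] [FiniteDimensional ℂ F]
  (E : M → Type*) [∀ x, AddCommGroup (E x)] [∀ x, Module ℂ (E x)]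
  [∀ x, TopologicalSpace (E x)] [TopologicalSpace (TotalSpace F E)]
  [FiberBundle F E] [VectorBundle ℂ F E]
  {A ι : Type*} [Preorder A] [IsDirectedOrder A] [Nonempty A] (𝔘 : CoverSystem A ι M)

/-- `U_{i_0} ∩ ⋯ ∩ U_{i_p}` for the covering number `α`. -/
def CoverSystem.inter {A ι M : Type*} [Preorder A] [TopologicalSpace M] (𝔘 : CoverSystem A ι M)
    (α : A) {p : ℕ} (σ : Fin (p + 1) → ι) : Opens M :=
  ⨅ k, 𝔘.U α (σ k)

theorem CoverSystem.inter_anti {A ι M : Type*} [Preorder A] [TopologicalSpace M]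
    (𝔘 : CoverSystem A ι M) {α β : A} (h : α ≤ β) {p : ℕ} (σ : Fin (p + 1) → ι) :
    𝔘.inter β σ ≤ 𝔘.inter α σ :=
  iInf_mono fun k => 𝔘.anti h (σ k)

theorem CoverSystem.inter_comp {A ι M : Type*} [Preorder A] [TopologicalSpace M]
    (𝔘 : CoverSystem A ι M) (α : A) {p q : ℕ} (θ : Fin (p + 1) → Fin (q + 1))
    (σ : Fin (q + 1) → ι) : 𝔘.inter α σ ≤ 𝔘.inter α (σ ∘ θ) :=
  le_iInf fun k => iInf_le (fun k => 𝔘.U α (σ k)) (θ k)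

/-- `C^p(𝔘_α, End(ΛE))`: families `(c_{i_0 … i_p})` of endomorphisms of `𝒪_{ΛE}` over
`U_{i_0} ∩ ⋯ ∩ U_{i_p}`, for the covering number `α`. -/
def CoverCochain (p : ℕ) (α : A) : Type _ :=
  ∀ σ : Fin (p + 1) → ι, SheafEnd n F E (𝔘.inter α σ)

instance (p : ℕ) (α : A) : Ring (CoverCochain n F E 𝔘 p α) :=
  inferInstanceAs (Ring (∀ σ : Fin (p + 1) → ι, SheafEnd n F E (𝔘.inter α σ)))

instance (p : ℕ) (α : A) : Algebra ℂ (CoverCochain n F E 𝔘 p α) :=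
  inferInstanceAs (Algebra ℂ (∀ σ : Fin (p + 1) → ι, SheafEnd n F E (𝔘.inter α σ)))

/-- Restriction of cochains to a finer covering. -/
def refine (p : ℕ) (α β : A) (h : α ≤ β) :
    CoverCochain n F E 𝔘 p α →ₐ[ℂ] CoverCochain n F E 𝔘 p β where
  toFun c σ := SheafEnd.res (𝔘.inter_anti h σ) (c σ)
  map_one' := rfl
  map_mul' _ _ := rfl
  map_zero' := rfl
  map_add' _ _ := rfl
  commutes' _ := rfl

instance (p : ℕ) :
    DirectedSystem (CoverCochain n F E 𝔘 p) (refine n F E 𝔘 p · · ·) where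
  map_self _ _ := rfl
  map_map _ _ _ _ _ _ := rfl

/-- `C^p(M, End(ΛE))`, the algebra of `p`-cochains with values in the endomorphisms of `𝒪_{ΛE}`
(with componentwise composition): the direct limit over the coverings of the system. -/
def Cochain (p : ℕ) : Type _ :=
  DirectLimit (CoverCochain n F E 𝔘 p) (refine n F E 𝔘 p)

instance (p : ℕ) : Ring (Cochain n F E 𝔘 p) :=
  inferInstanceAs (Ring (DirectLimit (CoverCochain n F E 𝔘 p) (refine n F E 𝔘 p)))

instance (p : ℕ) : Algebra ℂ (Cochain n F E 𝔘 p) :=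
  inferInstanceAs (Algebra ℂ (DirectLimit (CoverCochain n F E 𝔘 p) (refine n F E 𝔘 p)))

instance (p : ℕ) : Module ℚ (Cochain n F E 𝔘 p) :=
  Module.compHom (Cochain n F E 𝔘 p) (algebraMap ℚ ℂ)

variable {n F E 𝔘} in
/-- The class in `C^p(M, End(ΛE))` of a cochain of the covering number `α`. -/
def Cochain.of {p : ℕ} (α : A) : CoverCochain n F E 𝔘 p α →ₐ[ℂ] Cochain n F E 𝔘 p where
  toFun c := (⟦⟨α, c⟩⟧ : DirectLimit (CoverCochain n F E 𝔘 p) (refine n F E 𝔘 p))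
  map_one' := (DirectLimit.one_def α).symm
  map_mul' _ _ := (DirectLimit.mul_def α _ _).symm
  map_zero' := (DirectLimit.zero_def α).symm
  map_add' _ _ := (DirectLimit.add_def α _ _).symm
  commutes' r := (DirectLimit.algebraMap_def α r).symm

theorem Cochain.exists_rep {p : ℕ} (c : Cochain n F E 𝔘 p) :
    ∃ (α : A) (r : CoverCochain n F E 𝔘 p α), Cochain.of α r = c := by
  obtain ⟨α, r, h⟩ := DirectLimit.exists_eq_mk (refine n F E 𝔘 p) c
  exact ⟨α, r, h.symm⟩

theorem Cochain.of_refine {p : ℕ} {α β : A} (h : α ≤ β) (r : CoverCochain n F E 𝔘 p α) :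
    Cochain.of β (refine n F E 𝔘 p α β h r) = Cochain.of α r :=
  DirectLimit.mk_apply α β r h

/-- The linear map of direct limits induced by maps of cochains compatible with refinement. -/
def Cochain.map {p q : ℕ} (g : ∀ α, CoverCochain n F E 𝔘 p α →ₗ[ℂ] CoverCochain n F E 𝔘 q α)
    (hg : ∀ (α β : A) (h : α ≤ β) (c : CoverCochain n F E 𝔘 p α),
      g β (refine n F E 𝔘 p α β h c) = refine n F E 𝔘 q α β h (g α c)) :
    Cochain n F E 𝔘 p →ₗ[ℂ] Cochain n F E 𝔘 q :=
  DirectLimit.Module.lift ℂ A (CoverCochain n F E 𝔘 p) (refine n F E 𝔘 p)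
    (fun α => (Cochain.of α).toLinearMap ∘ₗ g α)
    (fun α β h c => by
      simp only [LinearMap.comp_apply, hg]
      exact Cochain.of_refine n F E 𝔘 h _)

/-- For `θ : {0, …, p} → {0, …, q}`, the `q`-cochain whose component with index `(i_0, …, i_q)` is
the restriction of `c_{i_{θ 0} … i_{θ p}}`. -/
def pull {p q : ℕ} (θ : Fin (p + 1) → Fin (q + 1)) :
    Cochain n F E 𝔘 p →ₗ[ℂ] Cochain n F E 𝔘 q :=
  Cochain.map n F E 𝔘
    (fun α =>
      { toFun := fun c σ => SheafEnd.res (𝔘.inter_comp α θ σ) (c (σ ∘ θ))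
        map_add' := fun _ _ => rfl
        map_smul' := fun _ _ => rfl })
    (fun _ _ _ _ => rfl)

/-- The degree `d` component `pr_d` of a cochain with values in `End(ΛE)`. -/
def pr (d : ℕ) {p : ℕ} : Cochain n F E 𝔘 p →ₗ[ℂ] Cochain n F E 𝔘 p :=
  Cochain.map n F E 𝔘
    (fun α =>
      { toFun := fun c σ => SheafEnd.pr d (c σ)
        map_add' := fun _ _ => funext fun _ => map_add _ _ _
        map_smul' := fun a c => funext fun σ => (SheafEnd.pr d).map_smul a (c σ) })
    (fun _ _ h c => funext fun σ => (SheafEnd.res_pr n F E d (𝔘.inter_anti h σ) (c σ)).symm)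

/-- `pr_{(2q)}`, the projection onto the components of degree `2, 4, …, 2q`. -/
def prLE (q : ℕ) {p : ℕ} : Cochain n F E 𝔘 p →ₗ[ℂ] Cochain n F E 𝔘 p :=
  ∑ l ∈ Finset.Icc 1 q, pr n F E 𝔘 (2 * l)

/-- `C^p(M, 𝓕)` for a subsheaf `𝓕` of `End(ΛE)`. -/
def cochains (𝓕 : Coeff n F E) (p : ℕ) : Submodule ℂ (Cochain n F E 𝔘 p) where
  carrier := {c | ∃ (α : A) (r : CoverCochain n F E 𝔘 p α),
    (∀ σ, r σ ∈ 𝓕.sections (𝔘.inter α σ)) ∧ Cochain.of α r = c}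
  add_mem' := by
    rintro _ _ ⟨α, r, hr, rfl⟩ ⟨β, s, hs, rfl⟩
    obtain ⟨γ, hα, hβ⟩ := exists_ge_ge α β
    refine ⟨γ, _ + _, fun σ => add_mem (𝓕.res_mem (𝔘.inter_anti hα σ) (hr σ))
      (𝓕.res_mem (𝔘.inter_anti hβ σ) (hs σ)), ?_⟩
    rw [← Cochain.of_refine n F E 𝔘 hα r, ← Cochain.of_refine n F E 𝔘 hβ s, ← map_add]
    rfl
  zero_mem' := ⟨Classical.arbitrary A, 0, fun _ => zero_mem _, map_zero _⟩
  smul_mem' c _ := by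
    rintro ⟨α, r, hr, rfl⟩
    exact ⟨α, c • r, fun σ => Submodule.smul_mem _ c (hr σ), map_smul _ _ _⟩

/-- `C^p(M, G_E)`. -/
def cochainsG (p : ℕ) : Set (Cochain n F E 𝔘 p) :=
  {c | ∃ (α : A) (r : CoverCochain n F E 𝔘 p α),
    (∀ σ, r σ ∈ GE n F E (𝔘.inter α σ)) ∧ Cochain.of α r = c}

/-! ## The abelian Čech complex -/

/-- `(dv)_{ij} = v_i - v_j`. -/
def d0 : Cochain n F E 𝔘 0 →ₗ[ℂ] Cochain n F E 𝔘 1 :=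
  pull n F E 𝔘 ![0] - pull n F E 𝔘 ![1]

/-- `(du)_{ijk} = u_{jk} - u_{ik} + u_{ij}`. -/
def d1 : Cochain n F E 𝔘 1 →ₗ[ℂ] Cochain n F E 𝔘 2 :=
  pull n F E 𝔘 ![1, 2] - pull n F E 𝔘 ![0, 2] + pull n F E 𝔘 ![0, 1]

/-- `(dw)_{ijkl} = w_{jkl} - w_{ikl} + w_{ijl} - w_{ijk}`. -/
def d2 : Cochain n F E 𝔘 2 →ₗ[ℂ] Cochain n F E 𝔘 3 :=
  pull n F E 𝔘 ![1, 2, 3] - pull n F E 𝔘 ![0, 2, 3] + pull n F E 𝔘 ![0, 1, 3]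
    - pull n F E 𝔘 ![0, 1, 2]

/-- `H^0(M, 𝓕) = Z^0(M, 𝓕)`. -/
def H0 (𝓕 : Coeff n F E) : Submodule ℂ (Cochain n F E 𝔘 0) :=
  cochains n F E 𝔘 𝓕 0 ⊓ LinearMap.ker (d0 n F E 𝔘)

/-- `Z^1(M, 𝓕)`. -/
def Z1 (𝓕 : Coeff n F E) : Submodule ℂ (Cochain n F E 𝔘 1) :=
  cochains n F E 𝔘 𝓕 1 ⊓ LinearMap.ker (d1 n F E 𝔘)

/-- `B^1(M, 𝓕)`. -/
def B1 (𝓕 : Coeff n F E) : Submodule ℂ (Cochain n F E 𝔘 1) :=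
  (cochains n F E 𝔘 𝓕 0).map (d0 n F E 𝔘)

/-- `H^1(M, 𝓕)`. -/
abbrev H1 (𝓕 : Coeff n F E) : Type _ :=
  Z1 n F E 𝔘 𝓕 ⧸ (B1 n F E 𝔘 𝓕).submoduleOf (Z1 n F E 𝔘 𝓕)

/-- `Z^2(M, 𝓕)`. -/
def Z2 (𝓕 : Coeff n F E) : Submodule ℂ (Cochain n F E 𝔘 2) :=
  cochains n F E 𝔘 𝓕 2 ⊓ LinearMap.ker (d2 n F E 𝔘)

/-- `B^2(M, 𝓕)`. -/
def B2 (𝓕 : Coeff n F E) : Submodule ℂ (Cochain n F E 𝔘 2) :=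
  (cochains n F E 𝔘 𝓕 1).map (d1 n F E 𝔘)

/-- `H^2(M, 𝓕)`. -/
abbrev H2 (𝓕 : Coeff n F E) : Type _ :=
  Z2 n F E 𝔘 𝓕 ⧸ (B2 n F E 𝔘 𝓕).submoduleOf (Z2 n F E 𝔘 𝓕)

/-! ## The non-abelian cohomology -/

variable {n F E 𝔘} in
/-- `(𝐝g)_{ijk} = g_{ij} g_{jk} g_{ki}`. -/
def bd (g : Cochain n F E 𝔘 1) : Cochain n F E 𝔘 2 :=
  pull n F E 𝔘 ![0, 1] g * pull n F E 𝔘 ![1, 2] g * pull n F E 𝔘 ![2, 0] g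

/-- `Z^1(M, G_E) = {g ∈ C^1(M, G_E) | 𝐝g = Id}`. -/
def Z1G : Set (Cochain n F E 𝔘 1) :=
  {g | g ∈ cochainsG n F E 𝔘 1 ∧ bd g = 1}

/-- `H^1(M, G_E)`: the set of orbits in `Z^1(M, G_E)` of the action
`(h.g)_{ij} = h_i g_{ij} h_j⁻¹` of `C^0(M, G_E)`. The relation below says that `g' = h.g` for some
`h`; it is an equivalence relation because `C^0(M, G_E)` is a group. -/
def H1G : Type _ :=
  Quot fun g g' : Z1G n F E 𝔘 => ∃ h ∈ cochainsG n F E 𝔘 0,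
    (g' : Cochain n F E 𝔘 1) * pull n F E 𝔘 ![1] h = pull n F E 𝔘 ![0] h * (g : Cochain n F E 𝔘 1)

variable {n F E 𝔘} in
/-- The class of a cocycle in `H^1(M, G_E)`. -/
def H1G.mk (g : Cochain n F E 𝔘 1) (hg : g ∈ Z1G n F E 𝔘) : H1G n F E 𝔘 :=
  Quot.mk _ ⟨g, hg⟩

variable {n F E 𝔘} in
/-- The exponential of a cochain of nilpotent endomorphisms. -/
def exp {p : ℕ} (u : Cochain n F E 𝔘 p) : Cochain n F E 𝔘 p :=
  IsNilpotent.exp u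

/-- `{u ∈ C^1(M, Der^{(2)}(ΛE)) | exp(u) ∈ Z^1(M, G_E)}`. -/
def Ctilde : Set (Cochain n F E 𝔘 1) :=
  {u | u ∈ cochains n F E 𝔘 (DerNil n F E) 1 ∧ exp u ∈ Z1G n F E 𝔘}

variable {n F E 𝔘} in
/-- `R_{2q}(u) = pr_{2q}(𝐝 exp(pr_{(2q-2)}(u)))`, for `q ≥ 2`. -/
def R (q : ℕ) (u : Cochain n F E 𝔘 1) : Cochain n F E 𝔘 2 :=
  pr n F E 𝔘 (2 * q) (bd (exp (prLE n F E 𝔘 (q - 1) u)))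

/-- `{u₂ ∈ Z^1(M, Der_2(ΛE)) | R_4(u₂) ∈ C^2(M, Der_4(ΛE)) and R_6(u₂) ∈ C^2(M, Der_6(ΛE))}`. -/
def Ztilde : Set (Cochain n F E 𝔘 1) :=
  {u | u ∈ Z1 n F E 𝔘 (Der n F E 2) ∧ R 2 u ∈ cochains n F E 𝔘 (Der n F E 4) 2 ∧
    R 3 u ∈ cochains n F E 𝔘 (Der n F E 6) 2}

/-- Two elements of `Ztilde` are equivalent if they differ by an element of
`B^1(M, Der_2(ΛE))`. -/
def ZtildeSetoid : Setoid (Ztilde n F E 𝔘) :=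
  (Submodule.quotientRel (B1 n F E 𝔘 (Der n F E 2))).comap Subtype.val

/-- The quotient of `Ztilde` by `B^1(M, Der_2(ΛE))`. -/
def ZtildeModB : Type _ := Quotient (ZtildeSetoid n F E 𝔘)

variable {n F E 𝔘} in
/-- The class of an element of `Ztilde` modulo `B^1(M, Der_2(ΛE))`. -/
def ZtildeModB.mk (u : Cochain n F E 𝔘 1) (hu : u ∈ Ztilde n F E 𝔘) : ZtildeModB n F E 𝔘 :=
  Quotient.mk (ZtildeSetoid n F E 𝔘) ⟨u, hu⟩

variable {n F E 𝔘} in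
/-- The class of a cocycle in `H^1(M, 𝓕)`. -/
def H1.mk {𝓕 : Coeff n F E} (u : Cochain n F E 𝔘 1) (hu : u ∈ Z1 n F E 𝔘 𝓕) : H1 n F E 𝔘 𝓕 :=
  Submodule.Quotient.mk ⟨u, hu⟩

variable {n F E 𝔘} in
/-- The family of maps `D_{2q}(Id, 0, ·)`, `q ≥ 2`, defined where `exp(u) ∈ Z^1(M, G_E)`: its member
with number `q` takes values in `C^1(M, Der_{2q}(ΛE))`, depends on `pr_{(2q-2)}(u)` only and
satisfies `d D_{2q}(u) = R_{2q}(u)`. -/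
structure IsChoice (D : ℕ → Ctilde n F E 𝔘 → Cochain n F E 𝔘 1) : Prop where
  mem : ∀ q, 2 ≤ q → ∀ u, D q u ∈ cochains n F E 𝔘 (Der n F E (2 * q)) 1
  factors : ∀ q, 2 ≤ q → ∀ u u' : Ctilde n F E 𝔘,
    prLE n F E 𝔘 (q - 1) (u : Cochain n F E 𝔘 1) = prLE n F E 𝔘 (q - 1) (u' : Cochain n F E 𝔘 1) →
      D q u = D q u'
  d_eq : ∀ q, 2 ≤ q → ∀ u : Ctilde n F E 𝔘, d1 n F E 𝔘 (D q u) = R q (u : Cochain n F E 𝔘 1)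

variable {n F E 𝔘} in
/-- `D(u) + u`, where `D = ∑_{q ≥ 2} D_{2q}`; the terms with `2q > rank E` vanish because
`Der_{2q}(ΛE) = 0`. -/
def sigmaCochain (D : ℕ → Ctilde n F E 𝔘 → Cochain n F E 𝔘 1) (u : Ctilde n F E 𝔘) :
    Cochain n F E 𝔘 1 :=
  (∑ q ∈ Finset.Icc 2 (Module.finrank ℂ F), D q u) + u

end Cech

end SuperCech

end

open SuperCech

noncomputable section

namespace SuperCech

/-! ### Degree components in the exterior algebra -/

section ExteriorDegrees

variable {V : Type*} [AddCommGroup V] [Module ℂ V]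

/-! Filter the endomorphisms of `𝒪_{ΛE}` by `Filt q`, whose elements have only components of even
degree at least `2q`. The filtration is multiplicative, and `Filt 4 = 0` because the rank is below
`8`. So `exp` is a polynomial, and every question is settled in degrees 2, 4, 6 in turn. Modulo the
next filtration step each nonlinear operation becomes linear: `exp u - exp v` becomes `u - v`
(`exp_sub_exp`), `𝐝` becomes the additive coboundary (`bd_sub_bd`), and the action of `h` on `g`
adds `d(h - 1)` (`act_sub_sub_d0_mem_cFilt`). The leading term of a difference of two automorphisms
is a derivation (`pr_sub_mem_cDer`), so all comparisons take place in the Čech complexes of the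
sheaves `Der_{2k}`. In particular `exp` identifies cochains of derivations with cochains of
automorphisms (`exists_exp_eq`, `exp_injOn`).

Part (1). If `exp u` fails to be a cocycle only from degree `2k` on, the leading term of the defect
is an abelian 2-cocycle, by a Bianchi identity on fourfold intersections (`d2_bd_sub_one`). As `H^2
= 0` in degrees 4 and 6, a primitive can be subtracted, so every `u₂` in `Z^1(M, Der_2)` extends.
The conditions on `R_4` and `R_6` are automatic (`Ztilde_eq`): `𝐝 exp(u₂) = exp x` with `x` in `Filt
2`, hence `x * x = 0` and `exp x = 1 + x`.

Part (2). For `exp u` a cocycle, `R_{2k}(u) = -d pr_{2k}(u)`, so `D_{2k}(u) + pr_{2k}(u)` is closed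
for every choice of `D`. The choice is to make its class detect orbits. For each `k` fix a
representative in every orbit modulo `Filt k` and move the cocycle onto it; `D_{2k}(u) + pr_{2k}(u)`
is then the leading term of the remaining difference (`exists_normalForm`). Without global
derivations, a transformation that fixes a cocycle modulo `Filt k` is itself trivial modulo `Filt
k`. Hence two cocycles equivalent modulo `Filt k` are equivalent modulo `Filt (k + 1)` exactly when
these terms are cohomologous (`NormalForm.orbitRel_succ_iff`). The steps `k = 1, 2, 3` give
well-definedness and injectivity; surjectivity follows because a closed term may be added in degree
`2k` and the result completed to a cocycle (`exists_mem_Ctilde_add`). -/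

theorem extProj_mem (j : ℕ) (a : ExteriorAlgebra ℂ V) : extProj V j a ∈ ⋀[ℂ]^j V :=
  SetLike.coe_mem (DirectSum.decompose (fun i : ℕ => ⋀[ℂ]^i V) a j)

theorem extProj_of_mem {j : ℕ} {a : ExteriorAlgebra ℂ V} (ha : a ∈ ⋀[ℂ]^j V) :
    extProj V j a = a :=
  DirectSum.decompose_of_mem_same (fun i : ℕ => ⋀[ℂ]^i V) ha

theorem extProj_of_mem_ne {i j : ℕ} {a : ExteriorAlgebra ℂ V} (ha : a ∈ ⋀[ℂ]^i V)
    (h : i ≠ j) : extProj V j a = 0 :=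
  DirectSum.decompose_of_mem_ne (fun i : ℕ => ⋀[ℂ]^i V) ha h

theorem extProj_eq_zero_of_finrank_lt [FiniteDimensional ℂ V] {j : ℕ}
    (hj : Module.finrank ℂ V < j) (a : ExteriorAlgebra ℂ V) : extProj V j a = 0 := by
  have h : Module.finrank ℂ (⋀[ℂ]^j V) = 0 := by
    rw [exteriorPower.finrank_eq, Nat.choose_eq_zero_of_lt hj]
  have : Subsingleton (⋀[ℂ]^j V) := Module.finrank_zero_iff.mp h
  exact congrArg Subtype.val (Subsingleton.elim (⟨_, extProj_mem j a⟩ : ⋀[ℂ]^j V) 0)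

theorem sum_extProj [FiniteDimensional ℂ V] (a : ExteriorAlgebra ℂ V) :
    ∑ j ∈ Finset.range (Module.finrank ℂ V + 1), extProj V j a = a := by
  classical
  conv_rhs => rw [← DirectSum.sum_support_decompose (fun i : ℕ => ⋀[ℂ]^i V) a]
  symm
  refine Finset.sum_subset (fun j hj => ?_) fun j _ hj => ?_
  · rw [Finset.mem_range]
    by_contra h
    rw [DFinsupp.mem_support_iff] at hj
    exact hj (Subtype.ext (extProj_eq_zero_of_finrank_lt (by omega) a))
  · rw [DFinsupp.notMem_support_iff] at hj
    exact congrArg Subtype.val hj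

theorem extProj_mul (k : ℕ) (a b : ExteriorAlgebra ℂ V) :
    extProj V k (a * b) =
      ∑ x ∈ Finset.HasAntidiagonal.antidiagonal k, extProj V x.1 a * extProj V x.2 b := by
  simp only [extProj, GradedAlgebra.proj_apply, DirectSum.decompose_mul]
  exact DirectSum.coe_mul_apply_eq_sum_antidiagonal (fun i : ℕ => ⋀[ℂ]^i V) _ _ k

/-- Every other pair of degrees with sum `m + k` has an entry below its bound. This is how the
Leibniz rule will pass to leading terms. -/
theorem extProj_add_mul {m k : ℕ} {a b : ExteriorAlgebra ℂ V}
    (ha : ∀ i < m, extProj V i a = 0) (hb : ∀ i < k, extProj V i b = 0) :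
    extProj V (m + k) (a * b) = extProj V m a * extProj V k b := by
  rw [extProj_mul]
  refine Finset.sum_eq_single_of_mem (m, k) (by simp) fun x hx hne => ?_
  rw [Finset.HasAntidiagonal.mem_antidiagonal] at hx
  rcases lt_or_ge x.1 m with h | h
  · rw [ha _ h, zero_mul]
  · rw [hb _ (by
      by_contra h'
      exact hne (Prod.ext (by omega : x.1 = m) (by omega : x.2 = k))), mul_zero]

end ExteriorDegrees

/-! ### Sheaf endomorphisms as block matrices, and the degree filtration -/

section SheafDegrees

variable {n : ℕ} {M : Type*} [TopologicalSpace M] [ChartedSpace (EuclideanSpace ℂ (Fin n)) M]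
  {F : Type*} [NormedAddCommGroup F] [NormedSpace ℂ F] [FiniteDimensional ℂ F]
  {E : M → Type*} [∀ x, AddCommGroup (E x)] [∀ x, Module ℂ (E x)]
  [∀ x, TopologicalSpace (E x)] [TopologicalSpace (TotalSpace F E)]
  [FiberBundle F E] [VectorBundle ℂ F E]

variable (F) in
/-- A linear identification of a fibre with the model fibre. -/
def fibreEquiv (x : M) : E x ≃ₗ[ℂ] F :=
  ((trivializationAt F E x).continuousLinearEquivAt ℂ x
    (FiberBundle.mem_baseSet_trivializationAt' x)).toLinearEquiv


variable (F) in
theorem finrank_fibre (x : M) :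
    FiniteDimensional ℂ (E x) ∧ Module.finrank ℂ (E x) = Module.finrank ℂ F :=
  ⟨(fibreEquiv (E := E) F x).symm.finiteDimensional, (fibreEquiv F x).finrank_eq⟩

namespace Sec

theorem ext {U : Opens M} {s t : Sec n F E U} (h : ∀ x, s.1 x = t.1 x) : s = t :=
  Subtype.ext (funext h)

theorem proj_mem (j : ℕ) {U : Opens M} (s : Sec n F E U) : proj j s ∈ hom n F E j U :=
  fun x => extProj_mem j (s.1 x)

theorem proj_of_mem {j : ℕ} {U : Opens M} {s : Sec n F E U} (hs : s ∈ hom n F E j U) :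
    proj j s = s :=
  ext fun x => extProj_of_mem (hs x)

theorem proj_of_mem_ne {i j : ℕ} {U : Opens M} {s : Sec n F E U} (hs : s ∈ hom n F E i U)
    (h : i ≠ j) : proj j s = 0 :=
  ext fun x => extProj_of_mem_ne (hs x) h

theorem proj_eq_zero_of_finrank_lt {j : ℕ} (hj : Module.finrank ℂ F < j) {U : Opens M}
    (s : Sec n F E U) : proj j s = 0 :=
  ext fun x => by
    obtain ⟨_, h⟩ := finrank_fibre (E := E) F (x : M)
    exact extProj_eq_zero_of_finrank_lt (by rwa [h]) (s.1 x)

theorem coe_sum {κ : Type*} (I : Finset κ) {U : Opens M} (f : κ → Sec n F E U) (x : U) :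
    (∑ i ∈ I, f i).1 x = ∑ i ∈ I, (f i).1 x :=
  map_sum ((Pi.evalAddMonoidHom _ x).comp (secSubalgebra n F E U).val.toAddMonoidHom) f I

theorem sum_proj {U : Opens M} (s : Sec n F E U) :
    ∑ j ∈ Finset.range (Module.finrank ℂ F + 1), proj j s = s :=
  ext fun x => by
    obtain ⟨_, h⟩ := finrank_fibre (E := E) F (x : M)
    rw [coe_sum]
    exact h ▸ sum_extProj (s.1 x)

theorem proj_add_mul {m k : ℕ} {U : Opens M} {s t : Sec n F E U}
    (hs : ∀ i < m, proj i s = 0) (ht : ∀ i < k, proj i t = 0) :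
    proj (m + k) (s * t) = proj m s * proj k t :=
  ext fun x => extProj_add_mul (fun i hi => congrFun (congrArg Subtype.val (hs i hi)) x)
    fun i hi => congrFun (congrArg Subtype.val (ht i hi)) x

theorem mul_mem_hom {m k : ℕ} {U : Opens M} {s t : Sec n F E U}
    (hs : s ∈ hom n F E m U) (ht : t ∈ hom n F E k U) : s * t ∈ hom n F E (m + k) U := by
  intro x
  exact SetLike.mul_mem_graded (A := fun i : ℕ => ⋀[ℂ]^i (E x)) (hs x) (ht x)

theorem hom_induction {U : Opens M} {p : Sec n F E U → Prop}
    (hom : ∀ j, ∀ s ∈ hom n F E j U, p s) (add : ∀ s t, p s → p t → p (s + t))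
    (s : Sec n F E U) : p s := by
  rw [← sum_proj s]
  exact Finset.sum_induction _ p add (hom 0 0 (zero_mem _)) fun j _ => hom j _ (proj_mem j s)

end Sec

namespace SheafEnd

variable {U : Opens M}

theorem ext {f g : SheafEnd n F E U} (h : ∀ W s, app f W s = app g W s) : f = g :=
  Subtype.ext (funext fun W => LinearMap.ext (h W))

theorem app_sub (f g : SheafEnd n F E U) (W : {W : Opens M // W ≤ U}) (s : Sec n F E W.1) :
    app (f - g) W s = app f W s - app g W s := rfl

theorem app_mul (f g : SheafEnd n F E U) (W : {W : Opens M // W ≤ U}) (s : Sec n F E W.1) :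
    app (f * g) W s = app f W (app g W s) := rfl

theorem app_one (W : {W : Opens M // W ≤ U}) (s : Sec n F E W.1) :
    app (1 : SheafEnd n F E U) W s = s := rfl

theorem app_projDeg (j : ℕ) (W : {W : Opens M // W ≤ U}) (s : Sec n F E W.1) :
    app (projDeg n F E j U) W s = Sec.proj j s := rfl

variable (n F E U) in
/-- The evaluation of sheaf endomorphisms on the sections over `W`, as a homomorphism of
algebras. -/
def appHom (W : {W : Opens M // W ≤ U}) :
    SheafEnd n F E U →ₐ[ℂ] Module.End ℂ (Sec n F E W.1) where
  toFun f := app f W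
  map_one' := rfl
  map_mul' _ _ := rfl
  map_zero' := rfl
  map_add' _ _ := rfl
  commutes' _ := rfl

theorem app_sum {κ : Type*} (I : Finset κ) (f : κ → SheafEnd n F E U)
    (W : {W : Opens M // W ≤ U}) (s : Sec n F E W.1) :
    app (∑ i ∈ I, f i) W s = ∑ i ∈ I, app (f i) W s := by
  have h := map_sum (appHom n F E U W) f I
  exact (LinearMap.congr_fun h s).trans (LinearMap.sum_apply _ _ _)

theorem projDeg_mul_self (j : ℕ) :
    projDeg n F E j U * projDeg n F E j U = projDeg n F E j U :=
  ext fun _ s => Sec.proj_of_mem (Sec.proj_mem j s)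

theorem projDeg_mul_of_ne {i j : ℕ} (h : i ≠ j) :
    projDeg n F E i U * projDeg n F E j U = 0 :=
  ext fun _ s => Sec.proj_of_mem_ne (Sec.proj_mem j s) h.symm

theorem projDeg_eq_zero {j : ℕ} (h : Module.finrank ℂ F < j) : projDeg n F E j U = 0 :=
  ext fun _ s => Sec.proj_eq_zero_of_finrank_lt h s

variable (n F E U) in
theorem sum_projDeg :
    ∑ j ∈ Finset.range (Module.finrank ℂ F + 1), projDeg n F E j U = 1 :=
  ext fun W s => by
    rw [app_sum]
    exact Sec.sum_proj s

/-- Inserting the identity as the sum of the degree projections turns composition into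
multiplication of block matrices indexed by degrees. -/
theorem mul_eq_sum (f g : SheafEnd n F E U) :
    f * g = ∑ j ∈ Finset.range (Module.finrank ℂ F + 1), f * projDeg n F E j U * g := by
  rw [← Finset.sum_mul, ← Finset.mul_sum, sum_projDeg, mul_one]

theorem eq_zero_of_forall {f : SheafEnd n F E U}
    (h : ∀ i j, projDeg n F E i U * f * projDeg n F E j U = 0) : f = 0 := by
  have h1 : ∀ i, projDeg n F E i U * f = 0 := fun i => by
    rw [← mul_one (_ * f), mul_eq_sum (_ * f) 1]
    exact Finset.sum_eq_zero fun j _ => by rw [h, zero_mul]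
  rw [← one_mul f, mul_eq_sum 1 f]
  exact Finset.sum_eq_zero fun j _ => by rw [mul_assoc, h1, mul_zero]

theorem projDeg_pr_projDeg (d i j : ℕ) (f : SheafEnd n F E U) :
    projDeg n F E i U * pr d f * projDeg n F E j U =
      if i = j + d then projDeg n F E i U * f * projDeg n F E j U else 0 := by
  have key : pr d f * projDeg n F E j U =
      projDeg n F E (j + d) U * f * projDeg n F E j U := by
    change (∑ k ∈ Finset.range (Module.finrank ℂ F + 1),
      projDeg n F E (k + d) U * f * projDeg n F E k U) * projDeg n F E j U = _
    rw [Finset.sum_mul]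
    -- The sum defining `pr` stops at the rank; beyond it both sides vanish.
    rcases lt_or_ge (Module.finrank ℂ F) j with h | h
    · rw [projDeg_eq_zero h, mul_zero]
      exact Finset.sum_eq_zero fun _ _ => mul_zero _
    · rw [Finset.sum_eq_single_of_mem j (by simpa using Nat.lt_succ_of_le h)]
      · rw [mul_assoc, projDeg_mul_self]
      · intro k _ hk
        rw [mul_assoc, projDeg_mul_of_ne hk, mul_zero]
  rw [mul_assoc, key]
  split_ifs with h
  · subst h
    rw [← mul_assoc, ← mul_assoc, projDeg_mul_self]
  · rw [← mul_assoc, ← mul_assoc, projDeg_mul_of_ne h, zero_mul, zero_mul]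

theorem app_pr {d j : ℕ} (f : SheafEnd n F E U) (W : {W : Opens M // W ≤ U})
    {s : Sec n F E W.1} (hs : s ∈ Sec.hom n F E j W.1) :
    app (pr d f) W s = Sec.proj (j + d) (app f W s) := by
  have h : pr d f * projDeg n F E j U = projDeg n F E (j + d) U * f * projDeg n F E j U := by
    rw [← one_mul (pr d f * _), mul_eq_sum]
    simp only [one_mul, mul_assoc]
    simp only [← mul_assoc, projDeg_pr_projDeg]
    rw [Finset.sum_ite_eq']
    split_ifs with h
    · rfl
    · rw [projDeg_eq_zero (by simpa using h), zero_mul, zero_mul]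
  have h1 := congrArg (fun g => app g W s) h
  simp only [app_mul, app_projDeg, Sec.proj_of_mem hs] at h1
  exact h1

theorem mem_homogeneous_iff {d : ℕ} {f : SheafEnd n F E U} :
    f ∈ homogeneous n F E d U ↔
      ∀ i j, i ≠ j + d → projDeg n F E i U * f * projDeg n F E j U = 0 := by
  constructor
  · intro hf i j hij
    exact ext fun W s => Sec.proj_of_mem_ne (hf W j _ (Sec.proj_mem j s)) hij.symm
  · intro hf W j s hs
    rw [← Sec.sum_proj (app f W s)]
    refine sum_mem fun i _ => ?_
    by_cases hij : i = j + d
    · subst hij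
      exact Sec.proj_mem _ _
    · have h := congrArg (fun g => app g W s) (hf i j hij)
      simp only [app_mul, app_projDeg, Sec.proj_of_mem hs] at h
      rw [h]
      exact zero_mem _

end SheafEnd

variable (n F E) in
/-- The sheaf of the endomorphisms of `𝒪_{ΛE}` all of whose components have one of the degrees
`2q, 2q + 2, 2q + 4, …`. -/
def Filt (q : ℕ) : Coeff n F E where
  sections U :=
    { carrier := {f | ∀ i j, (∀ k, q ≤ k → i ≠ j + 2 * k) →
        SheafEnd.projDeg n F E i U * f * SheafEnd.projDeg n F E j U = 0}
      add_mem' := fun {f g} hf hg i j h => by rw [mul_add, add_mul, hf i j h, hg i j h, add_zero]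
      zero_mem' := fun i j _ => by rw [mul_zero, zero_mul]
      smul_mem' := fun c f hf i j h => by
        rw [mul_smul_comm, smul_mul_assoc, hf i j h, smul_zero] }
  res_mem {U V} h f hf i j hij := by
    have := congrArg (SheafEnd.res h) (hf i j hij)
    rw [map_mul, map_mul, map_zero] at this
    exact this

namespace SheafEnd

variable {U : Opens M}

theorem filt_anti {q q' : ℕ} (h : q ≤ q') :
    (Filt n F E q').sections U ≤ (Filt n F E q).sections U :=
  fun _ hf i j hij => hf i j fun k hk => hij k (h.trans hk)

theorem mul_mem_filt {q q' : ℕ} {f g : SheafEnd n F E U} (hf : f ∈ (Filt n F E q).sections U)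
    (hg : g ∈ (Filt n F E q').sections U) : f * g ∈ (Filt n F E (q + q')).sections U := by
  intro i j h
  rw [← mul_assoc, mul_assoc, mul_eq_sum]
  refine Finset.sum_eq_zero fun l _ => ?_
  by_cases h1 : ∃ k, q ≤ k ∧ i = l + 2 * k
  · obtain ⟨k, hk, rfl⟩ := h1
    by_cases h2 : ∃ k', q' ≤ k' ∧ l = j + 2 * k'
    · obtain ⟨k', hk', rfl⟩ := h2
      exact absurd (by ring) (h (k + k') (by omega))
    · rw [mul_assoc, ← mul_assoc _ g, hg l j fun k' hk' hl => h2 ⟨k', hk', hl⟩, mul_zero]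
  · rw [hf i l fun k hk hi => h1 ⟨k, hk, hi⟩, zero_mul]

/-- The degree would be raised past the rank. In rank below 8 this applies to `q = 4` and ends every
induction over the filtration. -/
theorem filt_eq_bot {q : ℕ} (hq : Module.finrank ℂ F < 2 * q) :
    (Filt n F E q).sections U = ⊥ := by
  rw [eq_bot_iff]
  intro f hf
  refine eq_zero_of_forall fun i j => ?_
  by_cases h : ∃ k, q ≤ k ∧ i = j + 2 * k
  · obtain ⟨k, hk, rfl⟩ := h
    rw [projDeg_eq_zero (by omega), zero_mul, zero_mul]
  · exact hf i j fun k hk hi => h ⟨k, hk, hi⟩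

theorem sub_pr_mem_filt {q : ℕ} {f : SheafEnd n F E U} (hf : f ∈ (Filt n F E q).sections U) :
    f - pr (2 * q) f ∈ (Filt n F E (q + 1)).sections U := by
  intro i j h
  rw [mul_sub, sub_mul, projDeg_pr_projDeg]
  split_ifs with hi
  · rw [sub_self]
  · rw [sub_zero]
    refine hf i j fun k hk => ?_
    rcases Nat.eq_or_lt_of_le hk with rfl | hk
    · exact hi
    · exact h k hk

theorem pr_mem_homogeneous (d : ℕ) (f : SheafEnd n F E U) :
    pr d f ∈ homogeneous n F E d U :=
  mem_homogeneous_iff.mpr fun i j hij => by rw [projDeg_pr_projDeg, if_neg hij]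

theorem pr_eq_zero_of_mem_filt {q l : ℕ} {f : SheafEnd n F E U}
    (hf : f ∈ (Filt n F E q).sections U) (hl : l < q) : pr (2 * l) f = 0 := by
  refine eq_zero_of_forall fun i j => ?_
  rw [projDeg_pr_projDeg]
  split_ifs with h
  · exact hf i j fun k hk => by omega
  · rfl

theorem pr_of_mem_homogeneous {d : ℕ} {f : SheafEnd n F E U}
    (hf : f ∈ homogeneous n F E d U) : pr d f = f := by
  rw [← sub_eq_zero]
  refine eq_zero_of_forall fun i j => ?_
  rw [mul_sub, sub_mul, projDeg_pr_projDeg]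
  split_ifs with h
  · rw [sub_self]
  · rw [zero_sub, neg_eq_zero, mem_homogeneous_iff.mp hf i j h]

theorem pr_of_mem_homogeneous_ne {d e : ℕ} {f : SheafEnd n F E U}
    (hf : f ∈ homogeneous n F E d U) (h : d ≠ e) : pr e f = 0 := by
  refine eq_zero_of_forall fun i j => ?_
  rw [projDeg_pr_projDeg]
  split_ifs with hij
  · exact mem_homogeneous_iff.mp hf i j (by omega)
  · rfl

theorem homogeneous_le_filt (q : ℕ) :
    homogeneous n F E (2 * q) U ≤ (Filt n F E q).sections U :=
  fun _ hf i j h => mem_homogeneous_iff.mp hf i j (h q le_rfl)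

/-- The even components of positive degree. -/
theorem mem_filt_one_iff {f : SheafEnd n F E U} :
    f ∈ (Filt n F E 1).sections U ↔
      ∀ (W : {W : Opens M // W ≤ U}) (j : ℕ), ∀ s ∈ Sec.hom n F E j W.1,
        app f W s ∈ ⨆ k : ℕ, Sec.hom n F E (j + 2 * (k + 1)) W.1 := by
  constructor
  · intro hf W j s hs
    rw [← Sec.sum_proj (app f W s)]
    refine sum_mem fun i _ => ?_
    by_cases h : ∃ k, i = j + 2 * (k + 1)
    · obtain ⟨k, rfl⟩ := h
      exact Submodule.mem_iSup_of_mem k (Sec.proj_mem _ _)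
    · have h1 := congrArg (fun g => app g W s) (hf i j fun k hk hi =>
        h ⟨k - 1, by omega⟩)
      simp only [app_mul, app_projDeg, Sec.proj_of_mem hs] at h1
      rw [h1]
      exact zero_mem _
  · intro hf i j h
    refine ext fun W s => ?_
    have h1 : ⨆ k : ℕ, Sec.hom n F E (j + 2 * (k + 1)) W.1 ≤ LinearMap.ker (Sec.proj i) :=
      iSup_le fun k t ht => Sec.proj_of_mem_ne ht (h (k + 1) (by omega)).symm
    exact h1 (hf W j _ (Sec.proj_mem j s))

end SheafEnd

end SheafDegrees

/-! ### Automorphisms, their leading terms, and exponentials of derivations -/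

section Automorphisms

variable {n : ℕ} {M : Type*} [TopologicalSpace M] [ChartedSpace (EuclideanSpace ℂ (Fin n)) M]
  {F : Type*} [NormedAddCommGroup F] [NormedSpace ℂ F] [FiniteDimensional ℂ F]
  {E : M → Type*} [∀ x, AddCommGroup (E x)] [∀ x, Module ℂ (E x)]
  [∀ x, TopologicalSpace (E x)] [TopologicalSpace (TotalSpace F E)]
  [FiberBundle F E] [VectorBundle ℂ F E]

namespace SheafEnd

variable {U : Opens M}

theorem mem_GE_iff {φ : SheafEnd n F E U} :
    φ ∈ GE n F E U ↔ IsUnit φ ∧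
      (∀ (W : {W : Opens M // W ≤ U}) (s t : Sec n F E W.1),
        app φ W (s * t) = app φ W s * app φ W t) ∧
      φ - 1 ∈ (Filt n F E 1).sections U := by
  rw [mem_filt_one_iff]
  rfl

theorem pow_four_eq_zero (hr : Module.finrank ℂ F < 8) {f : SheafEnd n F E U}
    (hf : f ∈ (Filt n F E 1).sections U) : f ^ 4 = 0 := by
  have h := mul_mem_filt (mul_mem_filt (mul_mem_filt hf hf) hf) hf
  rw [filt_eq_bot (by simpa using hr), Submodule.mem_bot] at h
  rw [← h]
  noncomm_ring

theorem one_mem_GE : (1 : SheafEnd n F E U) ∈ GE n F E U :=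
  mem_GE_iff.mpr ⟨isUnit_one, fun _ _ _ => rfl, by rw [sub_self]; exact zero_mem _⟩

theorem mul_mem_GE {φ ψ : SheafEnd n F E U} (hφ : φ ∈ GE n F E U) (hψ : ψ ∈ GE n F E U) :
    φ * ψ ∈ GE n F E U := by
  rw [mem_GE_iff] at *
  refine ⟨hφ.1.mul hψ.1, fun W s t => ?_, ?_⟩
  · rw [app_mul, hψ.2.1, hφ.2.1]
    rfl
  · have h : φ * ψ - 1 = (φ - 1) * (ψ - 1) + (φ - 1) + (ψ - 1) := by noncomm_ring
    rw [h]
    exact add_mem (add_mem (filt_anti (by norm_num) (mul_mem_filt hφ.2.2 hψ.2.2)) hφ.2.2) hψ.2.2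

theorem inv_mem_GE (hr : Module.finrank ℂ F < 8) {φ ψ : SheafEnd n F E U}
    (hφ : φ ∈ GE n F E U) (h : φ * ψ = 1) (h' : ψ * φ = 1) : ψ ∈ GE n F E U := by
  rw [mem_GE_iff] at *
  refine ⟨⟨⟨ψ, φ, h', h⟩, rfl⟩, fun W s t => ?_, ?_⟩
  · have h1 : ∀ s, app φ W (app ψ W s) = s := fun s => by rw [← app_mul, h, app_one]
    have h2 : ∀ s, app ψ W (app φ W s) = s := fun s => by rw [← app_mul, h', app_one]
    rw [← h2 (app ψ W s * app ψ W t), hφ.2.1, h1, h1]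
  · have h0 := pow_four_eq_zero hr hφ.2.2
    -- The geometric series for the inverse, cut off by `(φ - 1) ^ 4 = 0`.
    have h1 : ψ - 1 =
        (-(φ - 1) + (φ - 1) * (φ - 1)) + -((φ - 1) * (φ - 1) * (φ - 1)) := by
      have h2 : φ * (1 + (-(φ - 1) + (φ - 1) * (φ - 1)) +
          -((φ - 1) * (φ - 1) * (φ - 1))) = 1 - (φ - 1) ^ 4 := by noncomm_ring
      rw [h0, sub_zero] at h2
      have h3 := congrArg (ψ * ·) h2
      simp only [← mul_assoc, h', one_mul, mul_one] at h3
      rw [← h3]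
      noncomm_ring
    rw [h1]
    have h2 := mul_mem_filt hφ.2.2 hφ.2.2
    exact add_mem (add_mem (neg_mem hφ.2.2) (filt_anti (by norm_num) h2))
      (neg_mem (filt_anti (by norm_num) (mul_mem_filt h2 hφ.2.2)))

theorem res_mem_GE {U V : Opens M} (h : U ≤ V) {φ : SheafEnd n F E V} (hφ : φ ∈ GE n F E V) :
    res h φ ∈ GE n F E U :=
  ⟨hφ.1.map (res h), fun W => hφ.2.1 ⟨W.1, W.2.trans h⟩, fun W => hφ.2.2 ⟨W.1, W.2.trans h⟩⟩

theorem proj_app_of_mem_filt {q i j : ℕ} {f : SheafEnd n F E U}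
    (hf : f ∈ (Filt n F E q).sections U) (hij : i < j + 2 * q) (W : {W : Opens M // W ≤ U})
    {s : Sec n F E W.1} (hs : s ∈ Sec.hom n F E j W.1) : Sec.proj i (app f W s) = 0 := by
  have h := congrArg (fun g => app g W s) (hf i j fun k hk => by omega)
  simp only [app_mul, app_projDeg, Sec.proj_of_mem hs] at h
  exact h

theorem proj_app_of_mem_GE {i j : ℕ} {φ : SheafEnd n F E U} (hφ : φ ∈ GE n F E U)
    (hij : i < j + 2) (W : {W : Opens M // W ≤ U}) {s : Sec n F E W.1}
    (hs : s ∈ Sec.hom n F E j W.1) : Sec.proj i (app φ W s) = Sec.proj i s := by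
  have h := proj_app_of_mem_filt (mem_GE_iff.mp hφ).2.2 hij W hs
  rwa [app_sub, app_one, map_sub, sub_eq_zero] at h

/-- The leading term of the difference of two automorphisms is a derivation. -/
theorem pr_sub_mem_Der {q : ℕ} {φ ψ : SheafEnd n F E U} (hφ : φ ∈ GE n F E U)
    (hψ : ψ ∈ GE n F E U) (h : φ - ψ ∈ (Filt n F E q).sections U) :
    pr (2 * q) (φ - ψ) ∈ (Der n F E (2 * q)).sections U := by
  refine ⟨fun W s t => ?_, pr_mem_homogeneous _ _⟩
  induction s using Sec.hom_induction with
  | add s s' hs hs' => simp only [add_mul, map_add, hs, hs']; abel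
  | hom a s hs =>
    induction t using Sec.hom_induction with
    | add t t' ht ht' => simp only [mul_add, map_add, ht, ht']; abel
    | hom b t ht =>
      rw [app_pr _ W (Sec.mul_mem_hom hs ht), app_pr _ W hs, app_pr _ W ht]
      -- A difference of two multiplicative maps obeys a Leibniz rule twisted by `φ` and `ψ`. In the
      -- lowest degree `a + b + 2q` only the leading terms `t` of `φ t` and `s` of `ψ s` survive, so
      -- the twist disappears.
      have h1 : app (φ - ψ) W (s * t) =
          app (φ - ψ) W s * app φ W t + app ψ W s * app (φ - ψ) W t := by
        simp only [app_sub, hφ.2.1, hψ.2.1, sub_mul, mul_sub]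
        abel
      rw [h1, map_add, show a + b + 2 * q = (a + 2 * q) + b by ring, Sec.proj_add_mul,
        show (a + 2 * q) + b = a + (b + 2 * q) by ring, Sec.proj_add_mul,
        proj_app_of_mem_GE hφ (by omega) W ht, Sec.proj_of_mem ht,
        proj_app_of_mem_GE hψ (by omega) W hs, Sec.proj_of_mem hs]
      · exact fun i hi => by
          rw [proj_app_of_mem_GE hψ (by omega) W hs, Sec.proj_of_mem_ne hs (by omega)]
      · exact fun i hi => proj_app_of_mem_filt h hi W ht
      · exact fun i hi => proj_app_of_mem_filt h hi W hs
      · exact fun i hi => by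
          rw [proj_app_of_mem_GE hφ (by omega) W ht, Sec.proj_of_mem_ne ht (by omega)]

theorem DerNil_le_derivations : (DerNil n F E).sections U ≤ derivations n F E U :=
  iSup_le fun _ _ hf => hf.1

theorem DerNil_le_filt : (DerNil n F E).sections U ≤ (Filt n F E 1).sections U :=
  iSup_le fun l _ hf => filt_anti (by omega) (homogeneous_le_filt (l + 1) hf.2)

theorem Der_le_DerNil {q : ℕ} (hq : 1 ≤ q) :
    (Der n F E (2 * q)).sections U ≤ (DerNil n F E).sections U := by
  obtain ⟨l, rfl⟩ := Nat.exists_eq_add_of_le' hq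
  exact le_iSup (fun l : ℕ => (Der n F E (2 * (l + 1))).sections U) l

theorem pr_mem_Der (d : ℕ) {f : SheafEnd n F E U} (hf : f ∈ (DerNil n F E).sections U) :
    pr d f ∈ (Der n F E d).sections U := by
  have h : (DerNil n F E).sections U ≤ ((Der n F E d).sections U).comap (pr d) := by
    refine iSup_le fun l g hg => ?_
    rw [Submodule.mem_comap]
    by_cases hd : 2 * (l + 1) = d
    · subst hd
      rwa [pr_of_mem_homogeneous hg.2]
    · rw [pr_of_mem_homogeneous_ne hg.2 hd]
      exact zero_mem _
  exact h hf

open scoped Nat in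
/-- The exponential of an even derivation of positive degree is an automorphism. -/
theorem sum_pow_mem_GE (hr : Module.finrank ℂ F < 8) {f : SheafEnd n F E U}
    (hf : f ∈ (DerNil n F E).sections U) :
    ∑ i ∈ Finset.range 4, ((i ! : ℂ)⁻¹) • f ^ i ∈ GE n F E U := by
  have h1 := DerNil_le_filt hf
  have h4 := pow_four_eq_zero hr h1
  -- `IsNilpotent.exp` has rational coefficients; the rational structure is the one induced from
  -- `ℂ`.
  let _ : Module ℚ (SheafEnd n F E U) := Module.compHom _ (algebraMap ℚ ℂ)
  have hexp : ∑ i ∈ Finset.range 4, ((i ! : ℂ)⁻¹) • f ^ i = IsNilpotent.exp f := by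
    rw [IsNilpotent.exp_eq_sum h4]
    refine Finset.sum_congr rfl fun i _ => ?_
    change _ = (algebraMap ℚ ℂ (i ! : ℚ)⁻¹) • f ^ i
    simp
  refine mem_GE_iff.mpr ⟨hexp ▸ IsNilpotent.isUnit_exp ⟨4, h4⟩, fun W s t => ?_, ?_⟩
  · let _ : Module ℚ (Sec n F E W.1) := Module.compHom _ (algebraMap ℚ ℂ)
    have h2 : ∀ s, app (∑ i ∈ Finset.range 4, ((i ! : ℂ)⁻¹) • f ^ i) W s =
        IsNilpotent.exp (app f W) s := by
      intro s
      rw [hexp]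
      exact LinearMap.congr_fun (IsNilpotent.map_exp ⟨4, h4⟩ (appHom n F E U W)) s
    rw [h2, h2, h2]
    refine Module.End.exp_mul_of_derivation ℂ _ _ (fun x y => ?_) ⟨4, ?_⟩ s t
    · rw [DerNil_le_derivations hf W x y, add_comm]
    · exact ((appHom n F E U W).map_pow f 4).symm.trans (by rw [h4, map_zero])
  · have h2 := mul_mem_filt h1 h1
    have h3 : ∑ i ∈ Finset.range 4, ((i ! : ℂ)⁻¹) • f ^ i - 1 =
        f + (2 : ℂ)⁻¹ • (f * f) + (6 : ℂ)⁻¹ • (f * f * f) := by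
      simp only [Finset.sum_range_succ, Finset.sum_range_zero, Nat.factorial, pow_succ, pow_zero]
      norm_num
      abel
    rw [h3]
    exact add_mem (add_mem h1 (Submodule.smul_mem _ _ (filt_anti (by norm_num) h2)))
      (Submodule.smul_mem _ _ (filt_anti (by norm_num) (mul_mem_filt h2 h1)))

end SheafEnd

end Automorphisms

/-! ### Cochains in the direct limit: filtration, automorphisms, exponential -/

section Cochains

variable {n : ℕ} {M : Type*} [TopologicalSpace M] [ChartedSpace (EuclideanSpace ℂ (Fin n)) M]
  {F : Type*} [NormedAddCommGroup F] [NormedSpace ℂ F] [FiniteDimensional ℂ F]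
  {E : M → Type*} [∀ x, AddCommGroup (E x)] [∀ x, Module ℂ (E x)]
  [∀ x, TopologicalSpace (E x)] [TopologicalSpace (TotalSpace F E)]
  [FiberBundle F E] [VectorBundle ℂ F E]
  {A ι : Type*} [Preorder A] [IsDirectedOrder A] [Nonempty A] {𝔘 : CoverSystem A ι M}
  {p q : ℕ}

/-- The restrictions of the components `c_{i_{θ 0} … i_{θ p}}` of a cochain of a covering. -/
def CoverCochain.pull {α : A} (θ : Fin (p + 1) → Fin (q + 1)) (c : CoverCochain n F E 𝔘 p α) :
    CoverCochain n F E 𝔘 q α :=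
  fun σ => SheafEnd.res (𝔘.inter_comp α θ σ) (c (σ ∘ θ))

/-- The degree `d` component of a cochain of a covering. -/
def CoverCochain.pr {α : A} (d : ℕ) (c : CoverCochain n F E 𝔘 p α) : CoverCochain n F E 𝔘 p α :=
  fun σ => SheafEnd.pr d (c σ)

namespace Cochain

theorem of_eq_of_iff {α : A} {r s : CoverCochain n F E 𝔘 p α} :
    of α r = of α s ↔ ∃ (β : A) (h : α ≤ β),
      refine n F E 𝔘 p α β h r = refine n F E 𝔘 p α β h s := by
  constructor
  · intro h
    obtain ⟨β, h1, _, h2⟩ := Quotient.exact h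
    exact ⟨β, h1, h2⟩
  · rintro ⟨β, h, h1⟩
    rw [← of_refine n F E 𝔘 h r, h1, of_refine]

theorem exists_rep₂ (c d : Cochain n F E 𝔘 p) :
    ∃ (α : A) (r s : CoverCochain n F E 𝔘 p α), of α r = c ∧ of α s = d := by
  obtain ⟨α, r, rfl⟩ := exists_rep n F E 𝔘 c
  obtain ⟨β, s, rfl⟩ := exists_rep n F E 𝔘 d
  obtain ⟨γ, hα, hβ⟩ := exists_ge_ge α β
  exact ⟨γ, _, _, of_refine n F E 𝔘 hα r, of_refine n F E 𝔘 hβ s⟩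

theorem pull_of (θ : Fin (p + 1) → Fin (q + 1)) (α : A) (r : CoverCochain n F E 𝔘 p α) :
    pull n F E 𝔘 θ (of α r) = of α (r.pull θ) := rfl

theorem pr_of (d : ℕ) (α : A) (r : CoverCochain n F E 𝔘 p α) :
    pr n F E 𝔘 d (of α r) = of α (r.pr d) := rfl

end Cochain

variable (n F E 𝔘) in
/-- `pull` as a homomorphism of algebras. -/
def pullHom (θ : Fin (p + 1) → Fin (q + 1)) : Cochain n F E 𝔘 p →ₐ[ℂ] Cochain n F E 𝔘 q :=
  AlgHom.ofLinearMap (pull n F E 𝔘 θ)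
    (by
      obtain ⟨α⟩ := ‹Nonempty A›
      rw [← map_one (Cochain.of α), Cochain.pull_of, ← map_one (Cochain.of α)]
      exact congrArg (Cochain.of α) (funext fun σ => map_one (SheafEnd.res _)))
    (fun c d => by
      obtain ⟨α, r, s, rfl, rfl⟩ := Cochain.exists_rep₂ c d
      rw [← map_mul, Cochain.pull_of, Cochain.pull_of, Cochain.pull_of, ← map_mul]
      exact congrArg (Cochain.of α) (funext fun σ => map_mul (SheafEnd.res _) _ _))

theorem pull_mul (θ : Fin (p + 1) → Fin (q + 1)) (c d : Cochain n F E 𝔘 p) :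
    pull n F E 𝔘 θ (c * d) = pull n F E 𝔘 θ c * pull n F E 𝔘 θ d :=
  map_mul (pullHom n F E 𝔘 θ) c d

theorem pull_one (θ : Fin (p + 1) → Fin (q + 1)) :
    pull n F E 𝔘 θ (1 : Cochain n F E 𝔘 p) = 1 :=
  map_one (pullHom n F E 𝔘 θ)

theorem pull_pull {l : ℕ} (θ : Fin (p + 1) → Fin (q + 1)) (θ' : Fin (q + 1) → Fin (l + 1))
    (c : Cochain n F E 𝔘 p) :
    pull n F E 𝔘 θ' (pull n F E 𝔘 θ c) = pull n F E 𝔘 (θ' ∘ θ) c := by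
  obtain ⟨α, r, rfl⟩ := Cochain.exists_rep n F E 𝔘 c
  rfl

theorem pull_id (c : Cochain n F E 𝔘 p) : pull n F E 𝔘 id c = c := by
  obtain ⟨α, r, rfl⟩ := Cochain.exists_rep n F E 𝔘 c
  rfl

theorem pull_pr (θ : Fin (p + 1) → Fin (q + 1)) (d : ℕ) (c : Cochain n F E 𝔘 p) :
    pull n F E 𝔘 θ (pr n F E 𝔘 d c) = pr n F E 𝔘 d (pull n F E 𝔘 θ c) := by
  obtain ⟨α, r, rfl⟩ := Cochain.exists_rep n F E 𝔘 c
  rw [Cochain.pr_of, Cochain.pull_of, Cochain.pull_of, Cochain.pr_of]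
  exact congrArg (Cochain.of α) (funext fun σ => SheafEnd.res_pr n F E d _ _)

section Coefficients

variable {𝓕 𝓖 ℋ : Coeff n F E}

theorem mem_cochains {α : A} {r : CoverCochain n F E 𝔘 p α}
    (hr : ∀ σ, r σ ∈ 𝓕.sections (𝔘.inter α σ)) : Cochain.of α r ∈ cochains n F E 𝔘 𝓕 p :=
  ⟨α, r, hr, rfl⟩

theorem cochains_mono (h : ∀ U, 𝓕.sections U ≤ 𝓖.sections U) :
    cochains n F E 𝔘 𝓕 p ≤ cochains n F E 𝔘 𝓖 p := by
  rintro _ ⟨α, r, hr, rfl⟩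
  exact mem_cochains fun σ => h _ (hr σ)

theorem mul_mem_cochains
    (h : ∀ U, ∀ f ∈ 𝓕.sections U, ∀ g ∈ 𝓖.sections U, f * g ∈ ℋ.sections U)
    {c d : Cochain n F E 𝔘 p} (hc : c ∈ cochains n F E 𝔘 𝓕 p)
    (hd : d ∈ cochains n F E 𝔘 𝓖 p) : c * d ∈ cochains n F E 𝔘 ℋ p := by
  obtain ⟨α, r, hr, rfl⟩ := hc
  obtain ⟨β, s, hs, rfl⟩ := hd
  obtain ⟨γ, hα, hβ⟩ := exists_ge_ge α β
  rw [← Cochain.of_refine n F E 𝔘 hα r, ← Cochain.of_refine n F E 𝔘 hβ s, ← map_mul]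
  exact mem_cochains fun σ => h _ _ (𝓕.res_mem (𝔘.inter_anti hα σ) (hr σ)) _
    (𝓖.res_mem (𝔘.inter_anti hβ σ) (hs σ))

theorem pull_mem_cochains (θ : Fin (p + 1) → Fin (q + 1)) {c : Cochain n F E 𝔘 p}
    (hc : c ∈ cochains n F E 𝔘 𝓕 p) : pull n F E 𝔘 θ c ∈ cochains n F E 𝔘 𝓕 q := by
  obtain ⟨α, r, hr, rfl⟩ := hc
  rw [Cochain.pull_of]
  exact mem_cochains fun σ => 𝓕.res_mem (𝔘.inter_comp α θ σ) (hr (σ ∘ θ))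

theorem pr_mem_cochains {d : ℕ} (h : ∀ U, ∀ f ∈ 𝓕.sections U, SheafEnd.pr d f ∈ 𝓖.sections U)
    {c : Cochain n F E 𝔘 p} (hc : c ∈ cochains n F E 𝔘 𝓕 p) :
    pr n F E 𝔘 d c ∈ cochains n F E 𝔘 𝓖 p := by
  obtain ⟨α, r, hr, rfl⟩ := hc
  rw [Cochain.pr_of]
  exact mem_cochains fun σ => h _ _ (hr σ)

theorem pr_eq_self {d : ℕ} (h : ∀ U, ∀ f ∈ 𝓕.sections U, SheafEnd.pr d f = f)
    {c : Cochain n F E 𝔘 p} (hc : c ∈ cochains n F E 𝔘 𝓕 p) : pr n F E 𝔘 d c = c := by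
  obtain ⟨α, r, hr, rfl⟩ := hc
  rw [Cochain.pr_of]
  exact congrArg (Cochain.of α) (funext fun σ => h _ _ (hr σ))

theorem pr_eq_zero {d : ℕ} (h : ∀ U, ∀ f ∈ 𝓕.sections U, SheafEnd.pr d f = 0)
    {c : Cochain n F E 𝔘 p} (hc : c ∈ cochains n F E 𝔘 𝓕 p) : pr n F E 𝔘 d c = 0 := by
  obtain ⟨α, r, hr, rfl⟩ := hc
  rw [Cochain.pr_of, ← map_zero (Cochain.of α)]
  exact congrArg (Cochain.of α) (funext fun σ => h _ _ (hr σ))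

end Coefficients

/-! ### The filtration of the algebra of cochains -/

variable (n F E 𝔘) in
/-- `C^p(M, ·)` for the sheaf `Filt q`. -/
abbrev cFilt (q p : ℕ) : Submodule ℂ (Cochain n F E 𝔘 p) := cochains n F E 𝔘 (Filt n F E q) p

variable (n F E 𝔘) in
/-- `C^p(M, Der_{2q}(ΛE))`. -/
abbrev cDer (q p : ℕ) : Submodule ℂ (Cochain n F E 𝔘 p) :=
  cochains n F E 𝔘 (Der n F E (2 * q)) p

theorem cFilt_anti {k l : ℕ} (h : k ≤ l) : cFilt n F E 𝔘 l p ≤ cFilt n F E 𝔘 k p :=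
  cochains_mono fun _ => SheafEnd.filt_anti h

theorem mul_mem_cFilt {k l m : ℕ} (h : m ≤ k + l) {c d : Cochain n F E 𝔘 p}
    (hc : c ∈ cFilt n F E 𝔘 k p) (hd : d ∈ cFilt n F E 𝔘 l p) : c * d ∈ cFilt n F E 𝔘 m p :=
  mul_mem_cochains (fun _ _ hf _ hg => SheafEnd.filt_anti h (SheafEnd.mul_mem_filt hf hg)) hc hd

theorem eq_zero_of_mem_cFilt {k : ℕ} (hk : Module.finrank ℂ F < 2 * k) {c : Cochain n F E 𝔘 p}
    (hc : c ∈ cFilt n F E 𝔘 k p) : c = 0 := by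
  obtain ⟨α, r, hr, rfl⟩ := hc
  rw [← map_zero (Cochain.of α)]
  refine congrArg (Cochain.of α) (funext fun σ => ?_)
  have h := hr σ
  rwa [SheafEnd.filt_eq_bot hk] at h

theorem sub_pr_mem_cFilt {k : ℕ} {c : Cochain n F E 𝔘 p} (hc : c ∈ cFilt n F E 𝔘 k p) :
    c - pr n F E 𝔘 (2 * k) c ∈ cFilt n F E 𝔘 (k + 1) p := by
  obtain ⟨α, r, hr, rfl⟩ := hc
  rw [Cochain.pr_of, ← map_sub]
  exact mem_cochains fun σ => SheafEnd.sub_pr_mem_filt (hr σ)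

theorem pr_eq_zero_of_mem_cFilt {k l : ℕ} (h : l < k) {c : Cochain n F E 𝔘 p}
    (hc : c ∈ cFilt n F E 𝔘 k p) : pr n F E 𝔘 (2 * l) c = 0 :=
  pr_eq_zero (fun _ _ hf => SheafEnd.pr_eq_zero_of_mem_filt hf h) hc

theorem mem_cFilt_succ_iff {k : ℕ} {c : Cochain n F E 𝔘 p} (hc : c ∈ cFilt n F E 𝔘 k p) :
    c ∈ cFilt n F E 𝔘 (k + 1) p ↔ pr n F E 𝔘 (2 * k) c = 0 := by
  refine ⟨pr_eq_zero_of_mem_cFilt k.lt_succ_self, fun h => ?_⟩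
  have h1 := sub_pr_mem_cFilt hc
  rwa [h, sub_zero] at h1

theorem cDer_le_cFilt (k : ℕ) : cDer n F E 𝔘 k p ≤ cFilt n F E 𝔘 k p :=
  cochains_mono fun _ _ hf => SheafEnd.homogeneous_le_filt k hf.2

theorem cDer_le_DerNil {k : ℕ} (hk : 1 ≤ k) :
    cDer n F E 𝔘 k p ≤ cochains n F E 𝔘 (DerNil n F E) p :=
  cochains_mono fun _ => SheafEnd.Der_le_DerNil hk

theorem DerNil_le_cFilt : cochains n F E 𝔘 (DerNil n F E) p ≤ cFilt n F E 𝔘 1 p :=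
  cochains_mono fun _ => SheafEnd.DerNil_le_filt

theorem pr_of_mem_cDer {k : ℕ} {c : Cochain n F E 𝔘 p} (hc : c ∈ cDer n F E 𝔘 k p) :
    pr n F E 𝔘 (2 * k) c = c :=
  pr_eq_self (𝓕 := Der n F E (2 * k)) (fun _ _ hf => SheafEnd.pr_of_mem_homogeneous hf.2) hc

theorem pr_of_mem_cDer_ne {k l : ℕ} (h : k ≠ l) {c : Cochain n F E 𝔘 p}
    (hc : c ∈ cDer n F E 𝔘 k p) : pr n F E 𝔘 (2 * l) c = 0 :=
  pr_eq_zero (𝓕 := Der n F E (2 * k))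
    (fun _ _ hf => SheafEnd.pr_of_mem_homogeneous_ne hf.2 (by omega)) hc

theorem pr_mem_cDer (k : ℕ) {c : Cochain n F E 𝔘 p}
    (hc : c ∈ cochains n F E 𝔘 (DerNil n F E) p) :
    pr n F E 𝔘 (2 * k) c ∈ cDer n F E 𝔘 k p :=
  pr_mem_cochains (fun _ _ hf => SheafEnd.pr_mem_Der _ hf) hc

/-! ### Cochains of automorphisms -/

theorem mem_cochainsG {α : A} {r : CoverCochain n F E 𝔘 p α}
    (hr : ∀ σ, r σ ∈ GE n F E (𝔘.inter α σ)) : Cochain.of α r ∈ cochainsG n F E 𝔘 p :=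
  ⟨α, r, hr, rfl⟩

theorem exists_rep₂_cochainsG {c d : Cochain n F E 𝔘 p} (hc : c ∈ cochainsG n F E 𝔘 p)
    (hd : d ∈ cochainsG n F E 𝔘 p) :
    ∃ (α : A) (r s : CoverCochain n F E 𝔘 p α), (∀ σ, r σ ∈ GE n F E (𝔘.inter α σ)) ∧
      (∀ σ, s σ ∈ GE n F E (𝔘.inter α σ)) ∧ Cochain.of α r = c ∧ Cochain.of α s = d := by
  obtain ⟨α, r, hr, rfl⟩ := hc
  obtain ⟨β, s, hs, rfl⟩ := hd
  obtain ⟨γ, hα, hβ⟩ := exists_ge_ge α β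
  exact ⟨γ, _, _, fun σ => SheafEnd.res_mem_GE (𝔘.inter_anti hα σ) (hr σ),
    fun σ => SheafEnd.res_mem_GE (𝔘.inter_anti hβ σ) (hs σ), Cochain.of_refine n F E 𝔘 hα r,
    Cochain.of_refine n F E 𝔘 hβ s⟩

theorem one_mem_cochainsG : (1 : Cochain n F E 𝔘 p) ∈ cochainsG n F E 𝔘 p := by
  obtain ⟨α⟩ := ‹Nonempty A›
  rw [← map_one (Cochain.of α)]
  exact mem_cochainsG fun σ => SheafEnd.one_mem_GE

theorem mul_mem_cochainsG {c d : Cochain n F E 𝔘 p} (hc : c ∈ cochainsG n F E 𝔘 p)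
    (hd : d ∈ cochainsG n F E 𝔘 p) : c * d ∈ cochainsG n F E 𝔘 p := by
  obtain ⟨α, r, s, hr, hs, rfl, rfl⟩ := exists_rep₂_cochainsG hc hd
  rw [← map_mul]
  exact mem_cochainsG fun σ => SheafEnd.mul_mem_GE (hr σ) (hs σ)

theorem pull_mem_cochainsG (θ : Fin (p + 1) → Fin (q + 1)) {c : Cochain n F E 𝔘 p}
    (hc : c ∈ cochainsG n F E 𝔘 p) : pull n F E 𝔘 θ c ∈ cochainsG n F E 𝔘 q := by
  obtain ⟨α, r, hr, rfl⟩ := hc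
  rw [Cochain.pull_of]
  exact mem_cochainsG fun σ => SheafEnd.res_mem_GE (𝔘.inter_comp α θ σ) (hr (σ ∘ θ))

theorem sub_one_mem_cFilt {c : Cochain n F E 𝔘 p} (hc : c ∈ cochainsG n F E 𝔘 p) :
    c - 1 ∈ cFilt n F E 𝔘 1 p := by
  obtain ⟨α, r, hr, rfl⟩ := hc
  rw [← map_one (Cochain.of α), ← map_sub]
  exact mem_cochains fun σ => (SheafEnd.mem_GE_iff.mp (hr σ)).2.2

theorem exists_inv_mem_cochainsG (hr : Module.finrank ℂ F < 8) {c : Cochain n F E 𝔘 p}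
    (hc : c ∈ cochainsG n F E 𝔘 p) : ∃ d ∈ cochainsG n F E 𝔘 p, c * d = 1 ∧ d * c = 1 := by
  obtain ⟨α, r, h, rfl⟩ := hc
  have h1 := fun σ => (h σ).1
  choose u hu using h1
  let s : CoverCochain n F E 𝔘 p α := fun σ => ↑(u σ)⁻¹
  have h2 : r * s = 1 := funext fun σ => by
    change r σ * ↑(u σ)⁻¹ = 1
    rw [← hu, Units.mul_inv]
  have h3 : s * r = 1 := funext fun σ => by
    change ↑(u σ)⁻¹ * r σ = 1
    rw [← hu, Units.inv_mul]
  refine ⟨Cochain.of α s, mem_cochainsG fun σ => ?_, ?_, ?_⟩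
  · exact SheafEnd.inv_mem_GE hr (h σ) (congrFun h2 σ) (congrFun h3 σ)
  · rw [← map_mul, h2, map_one]
  · rw [← map_mul, h3, map_one]

theorem pr_sub_mem_cDer {k : ℕ} {c d : Cochain n F E 𝔘 p} (hc : c ∈ cochainsG n F E 𝔘 p)
    (hd : d ∈ cochainsG n F E 𝔘 p) (h : c - d ∈ cFilt n F E 𝔘 k p) :
    pr n F E 𝔘 (2 * k) (c - d) ∈ cDer n F E 𝔘 k p := by
  obtain ⟨α, r, s, hr, hs, rfl, rfl⟩ := exists_rep₂_cochainsG hc hd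
  obtain ⟨β, t, ht, h⟩ := h
  obtain ⟨γ, hα, hβ⟩ := exists_ge_ge α β
  have h' : Cochain.of γ (refine n F E 𝔘 p β γ hβ t) =
      Cochain.of γ (refine n F E 𝔘 p α γ hα (r - s)) := by
    rw [Cochain.of_refine, Cochain.of_refine, h, map_sub]
  -- The filtration hypothesis is witnessed by a cochain `t` which agrees with `r - s` only in the
  -- limit; on a fine enough covering it becomes a statement about the components, where
  -- `SheafEnd.pr_sub_mem_Der` applies.
  obtain ⟨δ, hδ, h1⟩ := Cochain.of_eq_of_iff.mp h'
  have hαδ := hα.trans hδ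
  rw [← map_sub, ← Cochain.of_refine n F E 𝔘 hαδ (r - s), Cochain.pr_of]
  refine mem_cochains fun σ => ?_
  have h2 : SheafEnd.res (𝔘.inter_anti (hβ.trans hδ) σ) (t σ) =
      SheafEnd.res (𝔘.inter_anti hαδ σ) (r σ) - SheafEnd.res (𝔘.inter_anti hαδ σ) (s σ) :=
    (congrFun h1 σ).trans (map_sub (SheafEnd.res (𝔘.inter_anti hαδ σ)) (r σ) (s σ))
  have h3 := SheafEnd.pr_sub_mem_Der (SheafEnd.res_mem_GE (𝔘.inter_anti hαδ σ) (hr σ))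
    (SheafEnd.res_mem_GE (𝔘.inter_anti hαδ σ) (hs σ))
    (h2 ▸ (Filt n F E k).res_mem (𝔘.inter_anti (hβ.trans hδ) σ) (ht σ))
  rw [← map_sub] at h3
  exact h3

/-! ### The exponential -/

theorem pow_four_eq_zero (hr : Module.finrank ℂ F < 8) {u : Cochain n F E 𝔘 p}
    (hu : u ∈ cFilt n F E 𝔘 1 p) : u ^ 4 = 0 := by
  have h : u * u * u * u ∈ cFilt n F E 𝔘 4 p :=
    mul_mem_cFilt (le_refl (3 + 1)) (mul_mem_cFilt (le_refl (2 + 1))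
      (mul_mem_cFilt (le_refl (1 + 1)) hu hu) hu) hu
  rw [← eq_zero_of_mem_cFilt (by simpa using hr) h]
  noncomm_ring

open scoped Nat in
theorem exp_eq_sum (hr : Module.finrank ℂ F < 8) {u : Cochain n F E 𝔘 p}
    (hu : u ∈ cFilt n F E 𝔘 1 p) :
    exp u = ∑ i ∈ Finset.range 4, ((i ! : ℂ)⁻¹) • u ^ i := by
  rw [exp, IsNilpotent.exp_eq_sum (pow_four_eq_zero hr hu)]
  refine Finset.sum_congr rfl fun i _ => ?_
  change (algebraMap ℚ ℂ (i ! : ℚ)⁻¹) • u ^ i = _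
  simp

theorem exp_eq (hr : Module.finrank ℂ F < 8) {u : Cochain n F E 𝔘 p}
    (hu : u ∈ cFilt n F E 𝔘 1 p) :
    exp u = 1 + u + (2 : ℂ)⁻¹ • (u * u) + (6 : ℂ)⁻¹ • (u * u * u) := by
  rw [exp_eq_sum hr hu]
  simp only [Finset.sum_range_succ, Finset.sum_range_zero, Nat.factorial, pow_succ, pow_zero]
  norm_num

open scoped Nat in
theorem exp_mem_cochainsG (hr : Module.finrank ℂ F < 8) {u : Cochain n F E 𝔘 p}
    (hu : u ∈ cochains n F E 𝔘 (DerNil n F E) p) : exp u ∈ cochainsG n F E 𝔘 p := by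
  rw [exp_eq_sum hr (DerNil_le_cFilt hu)]
  obtain ⟨α, r, h, rfl⟩ := hu
  simp only [← map_pow, ← map_smul, ← map_sum]
  refine mem_cochainsG fun σ => ?_
  have h1 : (∑ i ∈ Finset.range 4, ((i ! : ℂ)⁻¹) • r ^ i) σ =
      ∑ i ∈ Finset.range 4, ((i ! : ℂ)⁻¹) • r σ ^ i :=
    Finset.sum_apply σ (Finset.range 4)
      (fun i σ => ((i ! : ℂ)⁻¹ • r σ ^ i : SheafEnd n F E (𝔘.inter α σ)))
  rw [h1]
  exact SheafEnd.sum_pow_mem_GE hr (h σ)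

theorem pull_exp (hr : Module.finrank ℂ F < 8) (θ : Fin (p + 1) → Fin (q + 1))
    {u : Cochain n F E 𝔘 p} (hu : u ∈ cFilt n F E 𝔘 1 p) :
    pull n F E 𝔘 θ (exp u) = exp (pull n F E 𝔘 θ u) := by
  rw [exp_eq hr hu, exp_eq hr (pull_mem_cochains θ hu)]
  simp only [map_add, map_smul, pull_mul, pull_one]

theorem exp_mul_exp_neg (hr : Module.finrank ℂ F < 8) {u : Cochain n F E 𝔘 p}
    (hu : u ∈ cFilt n F E 𝔘 1 p) : exp u * exp (-u) = 1 :=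
  IsNilpotent.exp_mul_exp_neg_self ⟨4, pow_four_eq_zero hr hu⟩

theorem exp_zero : exp (0 : Cochain n F E 𝔘 p) = 1 := IsNilpotent.exp_zero

/-- In the differences of squares and cubes, each telescoped term contains `u - v` and at least one
further factor of positive degree, so only the linear term of the series counts modulo the next
step. -/
theorem exp_sub_exp (hr : Module.finrank ℂ F < 8) {k : ℕ} {u v : Cochain n F E 𝔘 p}
    (hu : u ∈ cFilt n F E 𝔘 1 p) (hv : v ∈ cFilt n F E 𝔘 1 p)
    (h : u - v ∈ cFilt n F E 𝔘 k p) :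
    exp u - exp v - (u - v) ∈ cFilt n F E 𝔘 (k + 1) p := by
  have h2 : u * u - v * v ∈ cFilt n F E 𝔘 (k + 1) p := by
    rw [show u * u - v * v = u * (u - v) + (u - v) * v by noncomm_ring]
    exact add_mem (mul_mem_cFilt (by omega) hu h) (mul_mem_cFilt (by omega) h hv)
  have h3 : u * u * u - v * v * v ∈ cFilt n F E 𝔘 (k + 1) p := by
    rw [show u * u * u - v * v * v = u * (u * u - v * v) + (u - v) * (v * v) by noncomm_ring]
    exact add_mem (mul_mem_cFilt (by omega) hu h2)
      (mul_mem_cFilt (by omega) h (mul_mem_cFilt (le_refl (1 + 1)) hv hv))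
  rw [exp_eq hr hu, exp_eq hr hv, show
    1 + u + (2 : ℂ)⁻¹ • (u * u) + (6 : ℂ)⁻¹ • (u * u * u) -
      (1 + v + (2 : ℂ)⁻¹ • (v * v) + (6 : ℂ)⁻¹ • (v * v * v)) - (u - v) =
      (2 : ℂ)⁻¹ • (u * u - v * v) + (6 : ℂ)⁻¹ • (u * u * u - v * v * v) by
    rw [smul_sub, smul_sub]; abel]
  exact add_mem (Submodule.smul_mem _ _ h2) (Submodule.smul_mem _ _ h3)

theorem exp_sub_exp_mem_iff (hr : Module.finrank ℂ F < 8) {k : ℕ} {u v : Cochain n F E 𝔘 p}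
    (hu : u ∈ cFilt n F E 𝔘 1 p) (hv : v ∈ cFilt n F E 𝔘 1 p) :
    exp u - exp v ∈ cFilt n F E 𝔘 k p ↔ u - v ∈ cFilt n F E 𝔘 k p := by
  refine ⟨fun h => ?_, fun h => ?_⟩
  · have key : ∀ l, l + 1 ≤ k → u - v ∈ cFilt n F E 𝔘 (l + 1) p := by
      intro l
      induction l with
      | zero => exact fun _ => sub_mem hu hv
      | succ l ih =>
        intro hl
        -- The two differences agree one step deeper than `u - v` is known to lie, so each round
        -- gains one step.
        have h1 := exp_sub_exp hr hu hv (ih (by omega))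
        have h2 := sub_mem (cFilt_anti hl h) h1
        rwa [sub_sub_cancel] at h2
    cases k with
    | zero => exact cFilt_anti (by omega) (sub_mem hu hv)
    | succ k => exact key k le_rfl
  · have h1 := add_mem (cFilt_anti k.le_succ (exp_sub_exp hr hu hv h)) h
    rwa [sub_add_cancel] at h1

theorem exp_injOn (hr : Module.finrank ℂ F < 8) {u v : Cochain n F E 𝔘 p}
    (hu : u ∈ cFilt n F E 𝔘 1 p) (hv : v ∈ cFilt n F E 𝔘 1 p) (h : exp u = exp v) : u = v := by
  rw [← sub_eq_zero]
  refine eq_zero_of_mem_cFilt (k := 4) (by simpa using hr) ?_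
  rw [← exp_sub_exp_mem_iff hr hu hv, h, sub_self]
  exact zero_mem _

/-- Every cochain of automorphisms is the exponential of a cochain of derivations. -/
theorem exists_exp_eq (hr : Module.finrank ℂ F < 8) {g : Cochain n F E 𝔘 p}
    (hg : g ∈ cochainsG n F E 𝔘 p) :
    ∃ u ∈ cochains n F E 𝔘 (DerNil n F E) p, exp u = g := by
  have key : ∀ k, ∃ u ∈ cochains n F E 𝔘 (DerNil n F E) p,
      g - exp u ∈ cFilt n F E 𝔘 (k + 1) p := by
    intro k
    induction k with
    | zero => exact ⟨0, zero_mem _, by rw [exp_zero]; exact sub_one_mem_cFilt hg⟩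
    | succ k ih =>
      obtain ⟨u, hu, h⟩ := ih
      -- The logarithm is built degree by degree: the leading term of the error is a derivation, and
      -- adding it to `u` cancels it.
      have h1 := pr_sub_mem_cDer hg (exp_mem_cochainsG hr hu) h
      have h2 := cDer_le_DerNil (by omega) h1
      refine ⟨u + pr n F E 𝔘 (2 * (k + 1)) (g - exp u), add_mem hu h2, ?_⟩
      have h3 := exp_sub_exp hr (DerNil_le_cFilt (add_mem hu h2)) (DerNil_le_cFilt hu)
        (by rw [add_sub_cancel_left]; exact cDer_le_cFilt _ h1)
      have h4 := sub_mem (sub_pr_mem_cFilt h) h3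
      rw [add_sub_cancel_left] at h4
      convert h4 using 1
      abel
  obtain ⟨u, hu, h⟩ := key 3
  exact ⟨u, hu, (sub_eq_zero.mp (eq_zero_of_mem_cFilt (by simpa using hr) h)).symm⟩

end Cochains

/-! ### Linearization of the cocycle condition and the Bianchi identity -/

section Cocycles

variable {n : ℕ} {M : Type*} [TopologicalSpace M] [ChartedSpace (EuclideanSpace ℂ (Fin n)) M]
  {F : Type*} [NormedAddCommGroup F] [NormedSpace ℂ F] [FiniteDimensional ℂ F]
  {E : M → Type*} [∀ x, AddCommGroup (E x)] [∀ x, Module ℂ (E x)]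
  [∀ x, TopologicalSpace (E x)] [TopologicalSpace (TotalSpace F E)]
  [FiberBundle F E] [VectorBundle ℂ F E]
  {A ι : Type*} [Preorder A] [IsDirectedOrder A] [Nonempty A] {𝔘 : CoverSystem A ι M}
  {p q : ℕ}

/-! ### Unipotent cochains -/

theorem pr_one {d : ℕ} (hd : d ≠ 0) : pr n F E 𝔘 d (1 : Cochain n F E 𝔘 p) = 0 := by
  obtain ⟨α⟩ := ‹Nonempty A›
  rw [← map_one (Cochain.of α), Cochain.pr_of, ← map_zero (Cochain.of α)]
  exact congrArg (Cochain.of α) (funext fun σ =>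
    SheafEnd.pr_of_mem_homogeneous_ne (d := 0) (fun _ _ _ hs => hs) hd.symm)

theorem mul_sub_mem_cFilt {k : ℕ} {g x : Cochain n F E 𝔘 p} (hg : g - 1 ∈ cFilt n F E 𝔘 1 p)
    (hx : x ∈ cFilt n F E 𝔘 k p) : g * x - x ∈ cFilt n F E 𝔘 (k + 1) p := by
  rw [show g * x - x = (g - 1) * x by noncomm_ring]
  exact mul_mem_cFilt (by omega) hg hx

theorem sub_mul_mem_cFilt {k : ℕ} {g x : Cochain n F E 𝔘 p} (hg : g - 1 ∈ cFilt n F E 𝔘 1 p)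
    (hx : x ∈ cFilt n F E 𝔘 k p) : x * g - x ∈ cFilt n F E 𝔘 (k + 1) p := by
  rw [show x * g - x = x * (g - 1) by noncomm_ring]
  exact mul_mem_cFilt (by omega) hx hg

theorem mul_sub_one_mem_cFilt {g h : Cochain n F E 𝔘 p} (hg : g - 1 ∈ cFilt n F E 𝔘 1 p)
    (hh : h - 1 ∈ cFilt n F E 𝔘 1 p) : g * h - 1 ∈ cFilt n F E 𝔘 1 p := by
  have h1 := add_mem (cFilt_anti (by omega) (mul_sub_mem_cFilt hg hh)) (add_mem hg hh)
  convert h1 using 1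
  noncomm_ring

theorem pull_sub_one_mem_cFilt (θ : Fin (p + 1) → Fin (q + 1)) {g : Cochain n F E 𝔘 p}
    (hg : g - 1 ∈ cFilt n F E 𝔘 1 p) : pull n F E 𝔘 θ g - 1 ∈ cFilt n F E 𝔘 1 q := by
  rw [← pull_one θ, ← map_sub]
  exact pull_mem_cochains θ hg

/-- Modulo the next filtration step `g³ - 1` is `3(g - 1)`, so `g - 1` lies ever deeper. The
application is to the diagonal components of a cocycle, about which `𝐝g = Id` on `(i,i,i)` only says
that their cube is the identity. -/
theorem eq_one_of_mul_mul_eq_one (hr : Module.finrank ℂ F < 8) {g : Cochain n F E 𝔘 p}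
    (hg : g - 1 ∈ cFilt n F E 𝔘 1 p) (h : g * g * g = 1) : g = 1 := by
  have key : ∀ k, g - 1 ∈ cFilt n F E 𝔘 (k + 1) p := by
    intro k
    induction k with
    | zero => exact hg
    | succ k ih =>
      have h1 : g - 1 = (3 : ℂ)⁻¹ •
          -((g * g * (g - 1) - (g - 1)) + (g * (g - 1) - (g - 1))) := by
        have h2 : -((g * g * (g - 1) - (g - 1)) + (g * (g - 1) - (g - 1))) =
            (3 : ℂ) • (g - 1) - (g * g * g - 1) := by
          rw [show (3 : ℂ) = 1 + 1 + 1 by norm_num, add_smul, add_smul, one_smul]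
          noncomm_ring
        rw [h2, h, sub_self, sub_zero, smul_smul]
        norm_num
      rw [h1]
      exact Submodule.smul_mem _ _ (neg_mem (add_mem
        (mul_sub_mem_cFilt (mul_sub_one_mem_cFilt hg hg) ih) (mul_sub_mem_cFilt hg ih)))
  exact sub_eq_zero.mp (eq_zero_of_mem_cFilt (k := 4) (by simpa using hr) (key 3))

theorem exp_sub_one_mem_cFilt (hr : Module.finrank ℂ F < 8) {k : ℕ} {u : Cochain n F E 𝔘 p}
    (hu : u ∈ cFilt n F E 𝔘 1 p) : exp u - 1 ∈ cFilt n F E 𝔘 k p ↔ u ∈ cFilt n F E 𝔘 k p := by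
  rw [← exp_zero, exp_sub_exp_mem_iff hr hu (zero_mem _), sub_zero]

/-! ### Truncations -/

theorem prLE_succ (k : ℕ) (u : Cochain n F E 𝔘 p) :
    prLE n F E 𝔘 (k + 1) u = prLE n F E 𝔘 k u + pr n F E 𝔘 (2 * (k + 1)) u := by
  rw [prLE, Finset.sum_Icc_succ_top (by omega), LinearMap.add_apply, prLE]

theorem prLE_zero (u : Cochain n F E 𝔘 p) : prLE n F E 𝔘 0 u = 0 := by
  simp [prLE]

theorem prLE_mem_DerNil (k : ℕ) {u : Cochain n F E 𝔘 p}
    (hu : u ∈ cochains n F E 𝔘 (DerNil n F E) p) :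
    prLE n F E 𝔘 k u ∈ cochains n F E 𝔘 (DerNil n F E) p := by
  rw [prLE, LinearMap.sum_apply]
  exact sum_mem fun l hl =>
    cDer_le_DerNil (Finset.mem_Icc.mp hl).1 (pr_mem_cDer l hu)

theorem pr_prLE {k l : ℕ} (h : k < l) {u : Cochain n F E 𝔘 p}
    (hu : u ∈ cochains n F E 𝔘 (DerNil n F E) p) :
    pr n F E 𝔘 (2 * l) (prLE n F E 𝔘 k u) = 0 := by
  rw [prLE, LinearMap.sum_apply, map_sum]
  refine Finset.sum_eq_zero fun m hm => pr_of_mem_cDer_ne ?_ (pr_mem_cDer m hu)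
  have := Finset.mem_Icc.mp hm
  omega

theorem sub_prLE_mem_cFilt (k : ℕ) {u : Cochain n F E 𝔘 p}
    (hu : u ∈ cochains n F E 𝔘 (DerNil n F E) p) :
    u - prLE n F E 𝔘 k u ∈ cFilt n F E 𝔘 (k + 1) p := by
  induction k with
  | zero => rw [prLE_zero, sub_zero]; exact DerNil_le_cFilt hu
  | succ k ih =>
    have h := sub_pr_mem_cFilt ih
    rwa [map_sub, pr_prLE k.lt_succ_self hu, sub_zero, sub_sub, ← prLE_succ] at h

theorem prLE_eq_iff (k : ℕ) {u v : Cochain n F E 𝔘 p}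
    (hu : u ∈ cochains n F E 𝔘 (DerNil n F E) p) (hv : v ∈ cochains n F E 𝔘 (DerNil n F E) p) :
    prLE n F E 𝔘 k u = prLE n F E 𝔘 k v ↔ u - v ∈ cFilt n F E 𝔘 (k + 1) p := by
  constructor
  · intro h
    have h1 := sub_mem (sub_prLE_mem_cFilt k hu) (sub_prLE_mem_cFilt k hv)
    rwa [h, sub_sub_sub_cancel_right] at h1
  · intro h
    rw [← sub_eq_zero, ← map_sub, prLE, LinearMap.sum_apply]
    refine Finset.sum_eq_zero fun l hl => pr_eq_zero_of_mem_cFilt ?_ h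
    have := Finset.mem_Icc.mp hl
    omega

theorem prLE_of_mem_cDer_one {k : ℕ} (hk : 1 ≤ k) {u : Cochain n F E 𝔘 p}
    (hu : u ∈ cDer n F E 𝔘 1 p) : prLE n F E 𝔘 k u = u := by
  rw [prLE, LinearMap.sum_apply, Finset.sum_eq_single_of_mem 1 (Finset.mem_Icc.mpr ⟨le_rfl, hk⟩)]
  · exact pr_of_mem_cDer hu
  · exact fun l _ hl => pr_of_mem_cDer_ne hl.symm hu

/-! ### Cocycles -/

theorem pull_pull_of_eq {l : ℕ} {θ : Fin (p + 1) → Fin (q + 1)} {θ' : Fin (q + 1) → Fin (l + 1)}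
    {θ'' : Fin (p + 1) → Fin (l + 1)} (h : θ' ∘ θ = θ'') (c : Cochain n F E 𝔘 p) :
    pull n F E 𝔘 θ' (pull n F E 𝔘 θ c) = pull n F E 𝔘 θ'' c :=
  h ▸ pull_pull θ θ' c

theorem pull_zero_one (c : Cochain n F E 𝔘 1) : pull n F E 𝔘 ![0, 1] c = c := by
  rw [show (![0, 1] : Fin 2 → Fin 2) = id by decide]
  exact pull_id c

theorem d1_apply (u : Cochain n F E 𝔘 1) : d1 n F E 𝔘 u =
    pull n F E 𝔘 ![1, 2] u - pull n F E 𝔘 ![0, 2] u + pull n F E 𝔘 ![0, 1] u := rfl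

variable (n F E 𝔘) in
/-- The additive analogue `u_{ij} + u_{jk} + u_{ki}` of `bd`. -/
def cyc : Cochain n F E 𝔘 1 →ₗ[ℂ] Cochain n F E 𝔘 2 :=
  pull n F E 𝔘 ![0, 1] + pull n F E 𝔘 ![1, 2] + pull n F E 𝔘 ![2, 0]

theorem cyc_apply (u : Cochain n F E 𝔘 1) : cyc n F E 𝔘 u =
    pull n F E 𝔘 ![0, 1] u + pull n F E 𝔘 ![1, 2] u + pull n F E 𝔘 ![2, 0] u := rfl

theorem cyc_mem_cochains {𝓕 : Coeff n F E} {u : Cochain n F E 𝔘 1}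
    (hu : u ∈ cochains n F E 𝔘 𝓕 1) : cyc n F E 𝔘 u ∈ cochains n F E 𝔘 𝓕 2 := by
  rw [cyc_apply]
  exact add_mem (add_mem (pull_mem_cochains _ hu) (pull_mem_cochains _ hu))
    (pull_mem_cochains _ hu)

theorem pr_cyc (d : ℕ) (u : Cochain n F E 𝔘 1) :
    pr n F E 𝔘 d (cyc n F E 𝔘 u) = cyc n F E 𝔘 (pr n F E 𝔘 d u) := by
  simp only [cyc_apply, map_add, pull_pr]

/-- Linearizing `g_{ij} g_{jk} g_{ki}` gives `u_{ki}` where the Čech differential has `-u_{ik}`.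
Cochains are not assumed alternating, so antisymmetry has to be carried along in what follows. -/
theorem d1_eq_cyc {u : Cochain n F E 𝔘 1} (hu : pull n F E 𝔘 ![1, 0] u = -u) :
    d1 n F E 𝔘 u = cyc n F E 𝔘 u := by
  have h : pull n F E 𝔘 ![2, 0] u = -pull n F E 𝔘 (![0, 2] : Fin 2 → Fin 3) u := by
    rw [← map_neg, ← hu]
    exact (pull_pull_of_eq (by decide) u).symm
  rw [d1_apply, cyc_apply, h]
  abel

/-- The value on `(i,i,i)` gives `u_{ii} = 0`, and then the value on `(i,j,i)` gives `u_{ji} +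
u_{ij} = 0`. Vanishing on these degenerate indices suffices, which matters for primitives of nonzero
2-cochains. -/
theorem pull_swap_of_d1 {u : Cochain n F E 𝔘 1}
    (h0 : pull n F E 𝔘 (![0, 0, 0] : Fin 3 → Fin 2) (d1 n F E 𝔘 u) = 0)
    (h1 : pull n F E 𝔘 (![0, 1, 0] : Fin 3 → Fin 2) (d1 n F E 𝔘 u) = 0) :
    pull n F E 𝔘 ![1, 0] u = -u := by
  rw [d1_apply, map_add, map_sub, pull_pull_of_eq (θ'' := ![0, 0]) (by decide),
    pull_pull_of_eq (θ'' := ![0, 0]) (by decide),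
    pull_pull_of_eq (θ'' := ![0, 0]) (by decide), sub_self, zero_add] at h0
  rw [d1_apply, map_add, map_sub, pull_pull_of_eq (θ'' := ![1, 0]) (by decide),
    pull_pull_of_eq (θ'' := ![0, 0]) (by decide),
    pull_pull_of_eq (θ'' := ![0, 1]) (by decide), h0, sub_zero, pull_zero_one] at h1
  exact eq_neg_of_add_eq_zero_left h1

theorem pull_swap_of_cyc {u : Cochain n F E 𝔘 1} (h : cyc n F E 𝔘 u = 0) :
    pull n F E 𝔘 ![1, 0] u = -u := by
  have h0 := congrArg (pull n F E 𝔘 (![0, 0, 0] : Fin 3 → Fin 2)) h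
  have h1 := congrArg (pull n F E 𝔘 (![0, 1, 0] : Fin 3 → Fin 2)) h
  rw [cyc_apply, map_add, map_add, pull_pull_of_eq (θ'' := ![0, 0]) (by decide),
    pull_pull_of_eq (θ'' := ![0, 0]) (by decide),
    pull_pull_of_eq (θ'' := ![0, 0]) (by decide), map_zero] at h0
  rw [cyc_apply, map_add, map_add, pull_pull_of_eq (θ'' := ![0, 1]) (by decide),
    pull_pull_of_eq (θ'' := ![1, 0]) (by decide),
    pull_pull_of_eq (θ'' := ![0, 0]) (by decide), pull_zero_one, map_zero] at h1
  have h2 : (3 : ℂ) • pull n F E 𝔘 (![0, 0] : Fin 2 → Fin 2) u = 0 := by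
    rw [← h0, show (3 : ℂ) = 1 + 1 + 1 by norm_num, add_smul, add_smul, one_smul]
  rw [(smul_eq_zero.mp h2).resolve_left (by norm_num), add_zero] at h1
  exact eq_neg_of_add_eq_zero_right h1

theorem pull_swap_pr (d : ℕ) {u : Cochain n F E 𝔘 1} (h : pull n F E 𝔘 ![1, 0] u = -u) :
    pull n F E 𝔘 ![1, 0] (pr n F E 𝔘 d u) = -pr n F E 𝔘 d u := by
  rw [pull_pr, h, map_neg]

/-- The factors are exchanged one at a time. Each summand on the right is the change of a difference
under multiplication by further factors, which are unipotent in the application, hence of higher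
order. -/
theorem mul_mul_sub_mul_mul_sub_add {S : Type*} [Ring S] (a b c a' b' c' : S) :
    a * b * c - a' * b' * c' - ((a - a') + (b - b') + (c - c')) =
      ((a - a') * (b * c) - (a - a')) +
        ((a' * (b - b') - (b - b')) +
          ((a' * (b - b') - (b - b') + (b - b')) * c -
            (a' * (b - b') - (b - b') + (b - b')))) +
        (a' * b' * (c - c') - (c - c')) := by
  noncomm_ring

theorem bd_sub_bd {k : ℕ} {g h : Cochain n F E 𝔘 1} (hg : g - 1 ∈ cFilt n F E 𝔘 1 1)
    (hh : h - 1 ∈ cFilt n F E 𝔘 1 1) (hgh : g - h ∈ cFilt n F E 𝔘 k 1) :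
    bd g - bd h - cyc n F E 𝔘 (g - h) ∈ cFilt n F E 𝔘 (k + 1) 2 := by
  have hg' (θ : Fin 2 → Fin 3) : pull n F E 𝔘 θ g - 1 ∈ cFilt n F E 𝔘 1 2 :=
    pull_sub_one_mem_cFilt θ hg
  have hh' (θ : Fin 2 → Fin 3) : pull n F E 𝔘 θ h - 1 ∈ cFilt n F E 𝔘 1 2 :=
    pull_sub_one_mem_cFilt θ hh
  have hgh' (θ : Fin 2 → Fin 3) :
      pull n F E 𝔘 θ g - pull n F E 𝔘 θ h ∈ cFilt n F E 𝔘 k 2 := by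
    rw [← map_sub]
    exact pull_mem_cochains θ hgh
  have key {a b c a' b' c' : Cochain n F E 𝔘 2} (hb : b - 1 ∈ cFilt n F E 𝔘 1 2)
      (hc : c - 1 ∈ cFilt n F E 𝔘 1 2) (ha' : a' - 1 ∈ cFilt n F E 𝔘 1 2)
      (hb' : b' - 1 ∈ cFilt n F E 𝔘 1 2) (haa : a - a' ∈ cFilt n F E 𝔘 k 2)
      (hbb : b - b' ∈ cFilt n F E 𝔘 k 2) (hcc : c - c' ∈ cFilt n F E 𝔘 k 2) :
      a * b * c - a' * b' * c' - ((a - a') + (b - b') + (c - c')) ∈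
        cFilt n F E 𝔘 (k + 1) 2 := by
    have h2 := mul_sub_mem_cFilt ha' hbb
    rw [mul_mul_sub_mul_mul_sub_add]
    exact add_mem (add_mem (sub_mul_mem_cFilt (mul_sub_one_mem_cFilt hb hc) haa)
      (add_mem h2 (sub_mul_mem_cFilt hc (add_mem (cFilt_anti k.le_succ h2) hbb))))
      (mul_sub_mem_cFilt (mul_sub_one_mem_cFilt ha' hb') hcc)
  have h3 := key (hg' ![1, 2]) (hg' ![2, 0]) (hh' ![0, 1]) (hh' ![1, 2]) (hgh' ![0, 1])
    (hgh' ![1, 2]) (hgh' ![2, 0])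
  simp only [← map_sub] at h3
  exact h3

theorem bd_exp_sub_bd_exp (hr : Module.finrank ℂ F < 8) {k : ℕ} {u v : Cochain n F E 𝔘 1}
    (hu : u ∈ cFilt n F E 𝔘 1 1) (hv : v ∈ cFilt n F E 𝔘 1 1) (h : u - v ∈ cFilt n F E 𝔘 k 1) :
    bd (exp u) - bd (exp v) - cyc n F E 𝔘 (u - v) ∈ cFilt n F E 𝔘 (k + 1) 2 := by
  have h1 := bd_sub_bd ((exp_sub_one_mem_cFilt hr hu).mpr hu)
    ((exp_sub_one_mem_cFilt hr hv).mpr hv) ((exp_sub_exp_mem_iff hr hu hv).mpr h)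
  have h2 := exp_sub_exp hr hu hv h
  rw [← sub_add_sub_cancel _ (cyc n F E 𝔘 (exp u - exp v)), ← map_sub]
  exact add_mem h1 (cyc_mem_cochains h2)

theorem bd_mem_cochainsG {g : Cochain n F E 𝔘 1} (hg : g ∈ cochainsG n F E 𝔘 1) :
    bd g ∈ cochainsG n F E 𝔘 2 :=
  mul_mem_cochainsG (mul_mem_cochainsG (pull_mem_cochainsG _ hg) (pull_mem_cochainsG _ hg))
    (pull_mem_cochainsG _ hg)

/-- The multiplicative counterpart of the antisymmetry argument: `g_{ii} = 1` from `(i,i,i)`, then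
`g_{ij} g_{ji} = 1` from `(i,j,i)`. -/
theorem mul_pull_swap_of_bd_eq_one (hr : Module.finrank ℂ F < 8) {g : Cochain n F E 𝔘 1}
    (hg : g - 1 ∈ cFilt n F E 𝔘 1 1) (h : bd g = 1) : g * pull n F E 𝔘 ![1, 0] g = 1 := by
  have h0 := congrArg (pull n F E 𝔘 (![0, 0, 0] : Fin 3 → Fin 2)) h
  have h1 := congrArg (pull n F E 𝔘 (![0, 1, 0] : Fin 3 → Fin 2)) h
  rw [bd, pull_mul, pull_mul, pull_pull_of_eq (θ'' := ![0, 0]) (by decide),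
    pull_pull_of_eq (θ'' := ![0, 0]) (by decide),
    pull_pull_of_eq (θ'' := ![0, 0]) (by decide), pull_one] at h0
  rw [bd, pull_mul, pull_mul, pull_pull_of_eq (θ'' := ![0, 1]) (by decide),
    pull_pull_of_eq (θ'' := ![1, 0]) (by decide),
    pull_pull_of_eq (θ'' := ![0, 0]) (by decide), pull_zero_one, pull_one,
    eq_one_of_mul_mul_eq_one hr (pull_sub_one_mem_cFilt _ hg) h0, mul_one] at h1
  exact h1

theorem exp_mul_pull_swap (hr : Module.finrank ℂ F < 8) {u : Cochain n F E 𝔘 1}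
    (hu : u ∈ cFilt n F E 𝔘 1 1) :
    exp u * pull n F E 𝔘 ![1, 0] (exp u) = 1 ↔ pull n F E 𝔘 ![1, 0] u = -u := by
  rw [pull_exp hr _ hu]
  refine ⟨fun h => exp_injOn hr (pull_mem_cochains _ hu) (neg_mem hu) ?_, fun h => ?_⟩
  · have h1 := exp_mul_exp_neg hr (neg_mem hu)
    rw [neg_neg] at h1
    exact left_inv_eq_right_inv h1 h |>.symm
  · rw [h, exp_mul_exp_neg hr hu]

/-- Isolates the linear part of the relation between the four faces of a 3-simplex: the right side
collects products of small terms and the effect of conjugating `w`. -/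
theorem sub_eq_of_mul_eq {S : Type*} [Ring S] {a a' x y z w : S} (h : a * a' = 1)
    (h' : (1 + x) * (1 + y) = a * (1 + w) * a' * (1 + z)) :
    w - y + z - x = x * y - ((a * w - w) + ((a * w - w + w) * a' - (a * w - w + w))) -
      a * w * a' * z := by
  have h1 : a * (1 + w) * a' * (1 + z) =
      a * a' + a * w * a' + a * a' * z + a * w * a' * z := by noncomm_ring
  have h2 : (1 + x) * (1 + y) = 1 + x + y + x * y := by noncomm_ring
  rw [h1, h2, h, one_mul] at h'
  rw [← sub_eq_zero] at h' ⊢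
  rw [← neg_eq_zero, ← h']
  noncomm_ring

/-- A Bianchi identity: the defects of `g` on the four faces satisfy an exact multiplicative
relation, whose linear part is the abelian cocycle condition. The bound `1 ≤ k` puts products of two
defects in `Filt (k + 1)`. -/
theorem d2_bd_sub_one {k : ℕ} (hk : 1 ≤ k) {g : Cochain n F E 𝔘 1}
    (hg : g - 1 ∈ cFilt n F E 𝔘 1 1) (h : g * pull n F E 𝔘 ![1, 0] g = 1)
    (hb : bd g - 1 ∈ cFilt n F E 𝔘 k 2) :
    d2 n F E 𝔘 (bd g - 1) ∈ cFilt n F E 𝔘 (k + 1) 3 := by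
  set x := bd g - 1 with hx
  have hinv : ∀ (a b : Fin 4), pull n F E 𝔘 ![a, b] g * pull n F E 𝔘 ![b, a] g = 1 := by
    intro a b
    have h1 := congrArg (pull n F E 𝔘 (![a, b] : Fin 2 → Fin 4)) h
    rw [pull_mul, pull_one, pull_pull_of_eq (θ'' := ![b, a])] at h1
    · exact h1
    · funext i
      fin_cases i <;> rfl
  have hbd : ∀ (a b c : Fin 4), 1 + pull n F E 𝔘 ![a, b, c] x =
      pull n F E 𝔘 ![a, b] g * pull n F E 𝔘 ![b, c] g * pull n F E 𝔘 ![c, a] g := by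
    intro a b c
    have h1 : (![a, b, c] : Fin 3 → Fin 4) ∘ ![0, 1] = ![a, b] := by
      funext i
      fin_cases i <;> rfl
    have h2 : (![a, b, c] : Fin 3 → Fin 4) ∘ ![1, 2] = ![b, c] := by
      funext i
      fin_cases i <;> rfl
    have h3 : (![a, b, c] : Fin 3 → Fin 4) ∘ ![2, 0] = ![c, a] := by
      funext i
      fin_cases i <;> rfl
    rw [hx, map_sub, pull_one, add_sub_cancel, bd, pull_mul, pull_mul, pull_pull_of_eq h1,
      pull_pull_of_eq h2, pull_pull_of_eq h3]
  have hP := fun θ : Fin 3 → Fin 4 => pull_mem_cochains θ hb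
  set a := pull n F E 𝔘 (![0, 1] : Fin 2 → Fin 4) g
  set a' := pull n F E 𝔘 (![1, 0] : Fin 2 → Fin 4) g
  have ha : a - 1 ∈ cFilt n F E 𝔘 1 3 := pull_sub_one_mem_cFilt _ hg
  have ha' : a' - 1 ∈ cFilt n F E 𝔘 1 3 := pull_sub_one_mem_cFilt _ hg
  set x012 := pull n F E 𝔘 (![0, 1, 2] : Fin 3 → Fin 4) x
  set x023 := pull n F E 𝔘 (![0, 2, 3] : Fin 3 → Fin 4) x
  set x013 := pull n F E 𝔘 (![0, 1, 3] : Fin 3 → Fin 4) x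
  set x123 := pull n F E 𝔘 (![1, 2, 3] : Fin 3 → Fin 4) x
  have haa : a * a' = 1 := hinv 0 1
  have haa' : a' * a = 1 := hinv 1 0
  -- After cancelling inverse pairs both sides equal `g_{01} g_{12} g_{23} g_{30}`.
  have key : (1 + x012) * (1 + x023) = a * (1 + x123) * a' * (1 + x013) := by
    rw [hbd 0 1 2, hbd 0 2 3, hbd 1 2 3, hbd 0 1 3]
    simp only [mul_assoc]
    rw [← mul_assoc (pull n F E 𝔘 ![2, 0] g), hinv 2 0, one_mul, ← mul_assoc a' a, haa', one_mul,
      ← mul_assoc (pull n F E 𝔘 ![3, 1] g), hinv 3 1, one_mul]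
  have h1 := mul_sub_mem_cFilt ha (hP ![1, 2, 3])
  have h2 := sub_mul_mem_cFilt ha' (add_mem (cFilt_anti k.le_succ h1) (hP ![1, 2, 3]))
  have h3 : x012 * x023 ∈ cFilt n F E 𝔘 (k + 1) 3 := mul_mem_cFilt (by omega) (hP _) (hP _)
  have h4 : a * x123 * a' * x013 ∈ cFilt n F E 𝔘 (k + 1) 3 := by
    refine mul_mem_cFilt (k := k) (l := k) (by omega) ?_ (hP _)
    have h5 := add_mem (cFilt_anti k.le_succ h2)
      (add_mem (cFilt_anti k.le_succ h1) (hP ![1, 2, 3]))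
    rwa [sub_add_cancel, sub_add_cancel] at h5
  have h6 : d2 n F E 𝔘 x = x123 - x023 + x013 - x012 := rfl
  have h7 := sub_eq_of_mul_eq haa key
  rw [h6, h7]
  exact sub_mem (sub_mem h3 (add_mem h1 h2)) h4

end Cocycles

/-! ### Obstructions in `H^2` and completion to cocycles -/

section Completion

variable {n : ℕ} {M : Type*} [TopologicalSpace M] [ChartedSpace (EuclideanSpace ℂ (Fin n)) M]
  {F : Type*} [NormedAddCommGroup F] [NormedSpace ℂ F] [FiniteDimensional ℂ F]
  {E : M → Type*} [∀ x, AddCommGroup (E x)] [∀ x, Module ℂ (E x)]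
  [∀ x, TopologicalSpace (E x)] [TopologicalSpace (TotalSpace F E)]
  [FiberBundle F E] [VectorBundle ℂ F E]
  {A ι : Type*} [Preorder A] [IsDirectedOrder A] [Nonempty A] {𝔘 : CoverSystem A ι M}
  {p q : ℕ}

/-! ### Cocycles of automorphisms in terms of derivations -/

theorem mem_Ctilde_iff (hr : Module.finrank ℂ F < 8) {u : Cochain n F E 𝔘 1} :
    u ∈ Ctilde n F E 𝔘 ↔ u ∈ cochains n F E 𝔘 (DerNil n F E) 1 ∧ bd (exp u) = 1 :=
  ⟨fun h => ⟨h.1, h.2.2⟩, fun h => ⟨h.1, exp_mem_cochainsG hr h.1, h.2⟩⟩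

theorem pull_swap_of_mem_Ctilde (hr : Module.finrank ℂ F < 8) {u : Cochain n F E 𝔘 1}
    (hu : u ∈ Ctilde n F E 𝔘) : pull n F E 𝔘 ![1, 0] u = -u := by
  have h := DerNil_le_cFilt hu.1
  exact (exp_mul_pull_swap hr h).mp
    (mul_pull_swap_of_bd_eq_one hr ((exp_sub_one_mem_cFilt hr h).mpr h) hu.2.2)

theorem mem_B2_of_subsingleton {𝓕 : Coeff n F E} (h : Subsingleton (H2 n F E 𝔘 𝓕))
    {w : Cochain n F E 𝔘 2} (hw : w ∈ cochains n F E 𝔘 𝓕 2) (hd : d2 n F E 𝔘 w = 0) :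
    ∃ v ∈ cochains n F E 𝔘 𝓕 1, d1 n F E 𝔘 v = w := by
  have h1 : (Submodule.Quotient.mk ⟨w, hw, hd⟩ : H2 n F E 𝔘 𝓕) = 0 := Subsingleton.elim _ _
  exact (Submodule.Quotient.mk_eq_zero _).mp h1

theorem d2_pr (d : ℕ) (c : Cochain n F E 𝔘 2) :
    d2 n F E 𝔘 (pr n F E 𝔘 d c) = pr n F E 𝔘 d (d2 n F E 𝔘 c) := by
  simp only [d2, LinearMap.sub_apply, LinearMap.add_apply, pull_pr, map_add, map_sub]

/-- One step of the correction of a cochain of derivations towards a cocycle. -/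
theorem exists_bd_exp_sub_one_mem_succ (hr : Module.finrank ℂ F < 8) {k : ℕ} (hk : 1 ≤ k)
    (hH : Subsingleton (H2 n F E 𝔘 (Der n F E (2 * k)))) {w : Cochain n F E 𝔘 1}
    (hw : w ∈ cochains n F E 𝔘 (DerNil n F E) 1) (hs : pull n F E 𝔘 ![1, 0] w = -w)
    (hb : bd (exp w) - 1 ∈ cFilt n F E 𝔘 k 2) :
    ∃ w' ∈ cochains n F E 𝔘 (DerNil n F E) 1, pull n F E 𝔘 ![1, 0] w' = -w' ∧
      bd (exp w') - 1 ∈ cFilt n F E 𝔘 (k + 1) 2 ∧ w' - w ∈ cFilt n F E 𝔘 k 1 := by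
  have hw1 := DerNil_le_cFilt hw
  have hg := (exp_sub_one_mem_cFilt hr hw1).mpr hw1
  have hinv := (exp_mul_pull_swap hr hw1).mpr hs
  have h1 := d2_bd_sub_one hk hg hinv hb
  have h2 := pr_eq_zero_of_mem_cFilt k.lt_succ_self h1
  rw [← d2_pr] at h2
  obtain ⟨v, hv, hdv⟩ := mem_B2_of_subsingleton hH
    (pr_sub_mem_cDer (bd_mem_cochainsG (exp_mem_cochainsG hr hw)) one_mem_cochainsG hb) h2
  -- Antisymmetry gives `w_{ii} = 0`.
  have h00 : pull n F E 𝔘 (![0, 0] : Fin 2 → Fin 2) (exp w) = 1 := by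
    have h3 := congrArg (pull n F E 𝔘 (![0, 0] : Fin 2 → Fin 2)) hs
    rw [pull_pull_of_eq (θ'' := ![0, 0]) (by decide), map_neg, eq_neg_iff_add_eq_zero,
      ← two_smul ℂ, smul_eq_zero_iff_right two_ne_zero] at h3
    rw [pull_exp hr _ hw1, h3, exp_zero]
  -- The primitive `v` is arbitrary, but its coboundary vanishes on `(i,i,i)` and `(i,j,i)`, since
  -- `𝐝 exp(w)` is trivial there; this forces antisymmetry.
  have hv' : pull n F E 𝔘 ![1, 0] v = -v := by
    refine pull_swap_of_d1 ?_ ?_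
    · rw [hdv, pull_pr, map_sub, pull_one, bd, pull_mul, pull_mul,
        pull_pull_of_eq (θ'' := ![0, 0]) (by decide), pull_pull_of_eq (θ'' := ![0, 0]) (by decide),
        pull_pull_of_eq (θ'' := ![0, 0]) (by decide), h00, one_mul, one_mul, sub_self, map_zero]
    · rw [hdv, pull_pr, map_sub, pull_one, bd, pull_mul, pull_mul,
        pull_pull_of_eq (θ'' := ![0, 1]) (by decide), pull_pull_of_eq (θ'' := ![1, 0]) (by decide),
        pull_pull_of_eq (θ'' := ![0, 0]) (by decide), h00, pull_zero_one, hinv, one_mul, sub_self,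
        map_zero]
  have hwv := sub_mem hw (cDer_le_DerNil hk hv)
  have hsub : w - v - w = -v := by abel
  have hd : w - v - w ∈ cFilt n F E 𝔘 k 1 := hsub ▸ neg_mem (cDer_le_cFilt k hv)
  refine ⟨w - v, hwv, by rw [map_sub, hs, hv']; abel, ?_, hd⟩
  -- Passing from `w` to `w - v` changes the defect by `-d v` to leading order, which cancels its
  -- component of degree `2k`.
  have h3 := bd_exp_sub_bd_exp hr (DerNil_le_cFilt hwv) hw1 hd
  rw [hsub, map_neg, ← d1_eq_cyc hv', hdv] at h3
  have h4 := add_mem h3 (sub_pr_mem_cFilt hb)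
  rwa [sub_neg_eq_add, add_add_sub_cancel, sub_add_sub_cancel] at h4

/-- Only the obstructions in degrees 4 and 6 can occur. Each correction starts in the degree of the
defect, so the components below `2k` are untouched. -/
theorem exists_mem_Ctilde (hr : Module.finrank ℂ F < 8)
    (h4 : Subsingleton (H2 n F E 𝔘 (Der n F E 4)))
    (h6 : Subsingleton (H2 n F E 𝔘 (Der n F E 6))) {k : ℕ} (hk : 2 ≤ k) {w : Cochain n F E 𝔘 1}
    (hw : w ∈ cochains n F E 𝔘 (DerNil n F E) 1) (hs : pull n F E 𝔘 ![1, 0] w = -w)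
    (hb : bd (exp w) - 1 ∈ cFilt n F E 𝔘 k 2) :
    ∃ u ∈ Ctilde n F E 𝔘, u - w ∈ cFilt n F E 𝔘 k 1 := by
  have top {k : ℕ} (hk : 4 ≤ k) {w : Cochain n F E 𝔘 1}
      (hw : w ∈ cochains n F E 𝔘 (DerNil n F E) 1)
      (hb : bd (exp w) - 1 ∈ cFilt n F E 𝔘 k 2) : w ∈ Ctilde n F E 𝔘 :=
    (mem_Ctilde_iff hr).mpr ⟨hw, sub_eq_zero.mp (eq_zero_of_mem_cFilt (by omega) hb)⟩
  have three {w : Cochain n F E 𝔘 1} (hw : w ∈ cochains n F E 𝔘 (DerNil n F E) 1)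
      (hs : pull n F E 𝔘 ![1, 0] w = -w) (hb : bd (exp w) - 1 ∈ cFilt n F E 𝔘 3 2) :
      ∃ u ∈ Ctilde n F E 𝔘, u - w ∈ cFilt n F E 𝔘 3 1 := by
    obtain ⟨u, hu, -, hb', hd⟩ := exists_bd_exp_sub_one_mem_succ hr (k := 3) (by omega) h6 hw hs hb
    exact ⟨u, top (k := 4) le_rfl hu hb', hd⟩
  obtain rfl | rfl | hk : k = 2 ∨ k = 3 ∨ 4 ≤ k := by omega
  · obtain ⟨w', hw', hs', hb', hd⟩ := exists_bd_exp_sub_one_mem_succ hr (k := 2) (by omega) h4 hw hs hb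
    obtain ⟨u, hu, hd'⟩ := three hw' hs' hb'
    refine ⟨u, hu, ?_⟩
    rw [← sub_add_sub_cancel u w' w]
    exact add_mem (cFilt_anti (by omega) hd') hd
  · exact three hw hs hb
  · exact ⟨w, top hk hw hb, by rw [sub_self]; exact zero_mem _⟩

/-- A cocycle of derivations may be added to the component of degree `2k ≥ 4`. -/
theorem exists_mem_Ctilde_add (hr : Module.finrank ℂ F < 8)
    (h4 : Subsingleton (H2 n F E 𝔘 (Der n F E 4)))
    (h6 : Subsingleton (H2 n F E 𝔘 (Der n F E 6))) {k : ℕ} (hk : 2 ≤ k)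
    {u v : Cochain n F E 𝔘 1} (hu : u ∈ Ctilde n F E 𝔘) (hv : v ∈ Z1 n F E 𝔘 (Der n F E (2 * k))) :
    ∃ u' ∈ Ctilde n F E 𝔘, u' - (u + v) ∈ cFilt n F E 𝔘 (k + 1) 1 := by
  have hdv : d1 n F E 𝔘 v = 0 := hv.2
  have hs : pull n F E 𝔘 ![1, 0] v = -v :=
    pull_swap_of_d1 (by rw [hdv, map_zero]) (by rw [hdv, map_zero])
  have huv := add_mem hu.1 (cDer_le_DerNil (by omega) hv.1)
  -- Since `v` is closed, the defect created by adding it starts only in degree `2k + 2`.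
  have h1 := bd_exp_sub_bd_exp hr (k := k) (DerNil_le_cFilt huv) (DerNil_le_cFilt hu.1)
    (by rw [add_sub_cancel_left]; exact cDer_le_cFilt k hv.1)
  rw [add_sub_cancel_left, ← d1_eq_cyc hs, hdv, sub_zero, hu.2.2] at h1
  exact exists_mem_Ctilde hr h4 h6 (by omega) huv
    (by rw [map_add, pull_swap_of_mem_Ctilde hr hu, hs]; abel) h1

/-- The linearized cocycle condition, obtained by comparing `exp u` with the trivial cocycle `exp
0`. -/
theorem pr_two_mem_Z1 (hr : Module.finrank ℂ F < 8) {u : Cochain n F E 𝔘 1}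
    (hu : u ∈ Ctilde n F E 𝔘) : pr n F E 𝔘 2 u ∈ Z1 n F E 𝔘 (Der n F E 2) := by
  refine ⟨pr_mem_cDer 1 hu.1, ?_⟩
  have h1 := bd_exp_sub_bd_exp hr (k := 1) (DerNil_le_cFilt hu.1) (zero_mem _)
    (by rw [sub_zero]; exact DerNil_le_cFilt hu.1)
  have h2 : bd (exp (0 : Cochain n F E 𝔘 1)) = 1 := by
    rw [exp_zero, bd, pull_one, pull_one, pull_one, one_mul, one_mul]
  rw [hu.2.2, h2, sub_self, sub_zero, zero_sub] at h1
  have h3 := pr_eq_zero_of_mem_cFilt (l := 1) (by omega) h1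
  rw [map_neg, neg_eq_zero, pr_cyc] at h3
  change d1 n F E 𝔘 (pr n F E 𝔘 2 u) = 0
  rw [d1_eq_cyc (pull_swap_pr 2 (pull_swap_of_mem_Ctilde hr hu))]
  exact h3

theorem bd_exp_sub_one_mem_cFilt_two (hr : Module.finrank ℂ F < 8) {u : Cochain n F E 𝔘 1}
    (hu : u ∈ Z1 n F E 𝔘 (Der n F E 2)) : bd (exp u) - 1 ∈ cFilt n F E 𝔘 2 2 := by
  have hdu : d1 n F E 𝔘 u = 0 := hu.2
  have hs : pull n F E 𝔘 ![1, 0] u = -u :=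
    pull_swap_of_d1 (by rw [hdu, map_zero]) (by rw [hdu, map_zero])
  have hu1 : u ∈ cFilt n F E 𝔘 1 1 := cDer_le_cFilt 1 hu.1
  have h1 := bd_exp_sub_bd_exp hr (k := 1) hu1 (zero_mem _) (by rwa [sub_zero])
  have h2 : bd (exp (0 : Cochain n F E 𝔘 1)) = 1 := by
    rw [exp_zero, bd, pull_one, pull_one, pull_one, one_mul, one_mul]
  rwa [h2, sub_zero, ← d1_eq_cyc hs, hdu, sub_zero] at h1

/-- Here the rank bound is decisive: the logarithm `x` of `φ` starts in degree 4, so `x * x` lies in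
`Filt 4 = 0` and `φ = 1 + x`. Every component of positive degree is thus one of a derivation. -/
theorem pr_mem_cDer_of_sub_one_mem (hr : Module.finrank ℂ F < 8) {φ : Cochain n F E 𝔘 p}
    (hφ : φ ∈ cochainsG n F E 𝔘 p) (h : φ - 1 ∈ cFilt n F E 𝔘 2 p) {k : ℕ} (hk : 1 ≤ k) :
    pr n F E 𝔘 (2 * k) φ ∈ cDer n F E 𝔘 k p := by
  obtain ⟨x, hx, rfl⟩ := exists_exp_eq hr hφ
  have hx1 := DerNil_le_cFilt hx
  rw [exp_sub_one_mem_cFilt hr hx1] at h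
  have h2 : x * x = 0 := eq_zero_of_mem_cFilt (k := 4) (by omega) (mul_mem_cFilt le_rfl h h)
  rw [exp_eq hr hx1, h2, zero_mul, smul_zero, smul_zero, add_zero, add_zero, map_add,
    pr_one (by omega), zero_add]
  exact pr_mem_cDer k hx

/-- In rank at most `7` the conditions on `R_4` and `R_6` hold for all cocycles. -/
theorem Ztilde_eq (hr : Module.finrank ℂ F < 8) :
    Ztilde n F E 𝔘 = {u | u ∈ Z1 n F E 𝔘 (Der n F E 2)} := by
  refine Set.ext fun u => ⟨fun h => h.1, fun hu => ⟨hu, ?_⟩⟩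
  have hD : u ∈ cDer n F E 𝔘 1 1 := hu.1
  have h1 := bd_exp_sub_one_mem_cFilt_two hr hu
  have h2 := bd_mem_cochainsG (exp_mem_cochainsG hr (cDer_le_DerNil le_rfl hD))
  rw [R, R, prLE_of_mem_cDer_one (by norm_num) hD, prLE_of_mem_cDer_one (by norm_num) hD]
  exact ⟨pr_mem_cDer_of_sub_one_mem hr h2 h1 (k := 2) (by norm_num),
    pr_mem_cDer_of_sub_one_mem hr h2 h1 (k := 3) (by norm_num)⟩

theorem exists_mem_Ctilde_pr_two_eq (hr : Module.finrank ℂ F < 8)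
    (h4 : Subsingleton (H2 n F E 𝔘 (Der n F E 4)))
    (h6 : Subsingleton (H2 n F E 𝔘 (Der n F E 6))) {v : Cochain n F E 𝔘 1}
    (hv : v ∈ Z1 n F E 𝔘 (Der n F E 2)) : ∃ u ∈ Ctilde n F E 𝔘, pr n F E 𝔘 2 u = v := by
  have hD : v ∈ cDer n F E 𝔘 1 1 := hv.1
  have hdv : d1 n F E 𝔘 v = 0 := hv.2
  obtain ⟨u, hu, h⟩ := exists_mem_Ctilde hr h4 h6 le_rfl (cDer_le_DerNil le_rfl hD)
    (pull_swap_of_d1 (by rw [hdv, map_zero]) (by rw [hdv, map_zero]))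
    (bd_exp_sub_one_mem_cFilt_two hr hv)
  have h1 := pr_eq_zero_of_mem_cFilt (l := 1) (by omega) h
  rw [map_sub, pr_of_mem_cDer hD, sub_eq_zero] at h1
  exact ⟨u, hu, h1⟩

/-- Compare the cocycle `exp u` with the exponential of the truncation of `u` below degree `2k`: the
two arguments differ by `pr_{2k}(u)` to leading order, so the defect of the truncation must cancel
its coboundary. Consequently `D_{2k}(u) + pr_{2k}(u)` is closed for any `D_{2k}` solving `d D_{2k} =
R_{2k}`. -/
theorem R_eq_neg_d1 (hr : Module.finrank ℂ F < 8) {k : ℕ} (hk : 1 ≤ k) {u : Cochain n F E 𝔘 1}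
    (hu : u ∈ Ctilde n F E 𝔘) : R k u = -d1 n F E 𝔘 (pr n F E 𝔘 (2 * k) u) := by
  obtain ⟨l, rfl⟩ := Nat.exists_eq_add_of_le' hk
  have h := sub_prLE_mem_cFilt l hu.1
  have h1 := bd_exp_sub_bd_exp hr (DerNil_le_cFilt hu.1)
    (DerNil_le_cFilt (prLE_mem_DerNil l hu.1)) h
  have h2 := pr_eq_zero_of_mem_cFilt (Nat.lt_succ_self _) h1
  rw [hu.2.2, map_sub, map_sub, pr_one (by omega), pr_cyc, map_sub,
    pr_prLE l.lt_succ_self hu.1, sub_zero, zero_sub,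
    ← d1_eq_cyc (pull_swap_pr _ (pull_swap_of_mem_Ctilde hr hu)), sub_eq_zero] at h2
  rw [R, ← h2, neg_neg, Nat.add_sub_cancel]

/-- The difference of the two trivial defects is zero and linearizes to the cyclic sum of the
leading term; antisymmetry of that term comes from the cyclic sum itself. -/
theorem d1_pr_sub_eq_zero {k : ℕ} {g h : Cochain n F E 𝔘 1} (hg : g - 1 ∈ cFilt n F E 𝔘 1 1)
    (hh : h - 1 ∈ cFilt n F E 𝔘 1 1) (hbg : bd g = 1) (hbh : bd h = 1)
    (hgh : g - h ∈ cFilt n F E 𝔘 k 1) : d1 n F E 𝔘 (pr n F E 𝔘 (2 * k) (g - h)) = 0 := by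
  have h1 := pr_eq_zero_of_mem_cFilt k.lt_succ_self (bd_sub_bd hg hh hgh)
  rw [hbg, hbh, sub_self, zero_sub, map_neg, neg_eq_zero, pr_cyc] at h1
  rw [d1_eq_cyc (pull_swap_of_cyc h1), h1]

end Completion

/-! ### Gauge action, orbits modulo the filtration, normal forms -/

section Orbits

variable {n : ℕ} {M : Type*} [TopologicalSpace M] [ChartedSpace (EuclideanSpace ℂ (Fin n)) M]
  {F : Type*} [NormedAddCommGroup F] [NormedSpace ℂ F] [FiniteDimensional ℂ F]
  {E : M → Type*} [∀ x, AddCommGroup (E x)] [∀ x, Module ℂ (E x)]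
  [∀ x, TopologicalSpace (E x)] [TopologicalSpace (TotalSpace F E)]
  [FiberBundle F E] [VectorBundle ℂ F E]
  {A ι : Type*} [Preorder A] [IsDirectedOrder A] [Nonempty A] {𝔘 : CoverSystem A ι M}
  {p q : ℕ}

/-! ### The action of `C^0(M, G_E)` -/

/-- `(h.g)_{ij} = h_i g_{ij} h_j⁻¹`. -/
def act (h : (Cochain n F E 𝔘 0)ˣ) (g : Cochain n F E 𝔘 1) : Cochain n F E 𝔘 1 :=
  pull n F E 𝔘 ![0] (h : Cochain n F E 𝔘 0) * g *
    pull n F E 𝔘 ![1] (↑h⁻¹ : Cochain n F E 𝔘 0)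

theorem act_sub (h : (Cochain n F E 𝔘 0)ˣ) (g g' : Cochain n F E 𝔘 1) :
    act h (g - g') = act h g - act h g' := by
  rw [act, mul_sub, sub_mul]
  rfl

theorem act_one (g : Cochain n F E 𝔘 1) : act 1 g = g := by
  rw [act, inv_one, Units.val_one, pull_one, pull_one, one_mul, mul_one]

theorem act_mul (h h' : (Cochain n F E 𝔘 0)ˣ) (g : Cochain n F E 𝔘 1) :
    act (h * h') g = act h (act h' g) := by
  rw [act, act, act, mul_inv_rev, Units.val_mul, Units.val_mul, pull_mul, pull_mul]
  simp only [mul_assoc]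

theorem pull_units_mul_inv (θ : Fin (p + 1) → Fin (q + 1)) (h : (Cochain n F E 𝔘 p)ˣ) :
    pull n F E 𝔘 θ (h : Cochain n F E 𝔘 p) * pull n F E 𝔘 θ (↑h⁻¹ : Cochain n F E 𝔘 p) = 1 := by
  rw [← pull_mul, Units.mul_inv, pull_one]

theorem pull_units_inv_mul (θ : Fin (p + 1) → Fin (q + 1)) (h : (Cochain n F E 𝔘 p)ˣ) :
    pull n F E 𝔘 θ (↑h⁻¹ : Cochain n F E 𝔘 p) * pull n F E 𝔘 θ (h : Cochain n F E 𝔘 p) = 1 := by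
  rw [← pull_mul, Units.inv_mul, pull_one]

theorem act_eq_iff {h : (Cochain n F E 𝔘 0)ˣ} {g g' : Cochain n F E 𝔘 1} :
    act h g = g' ↔
      g' * pull n F E 𝔘 ![1] (h : Cochain n F E 𝔘 0) =
        pull n F E 𝔘 ![0] (h : Cochain n F E 𝔘 0) * g := by
  constructor
  · rintro rfl
    rw [act, mul_assoc, pull_units_inv_mul, mul_one]
  · intro H
    rw [act, ← H, mul_assoc, pull_units_mul_inv, mul_one]

theorem bd_act {h : (Cochain n F E 𝔘 0)ˣ} {g : Cochain n F E 𝔘 1} (hg : bd g = 1) :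
    bd (act h g) = 1 := by
  have h1 (θ : Fin 2 → Fin 3) (i j : Fin 3) (hi : θ ∘ ![0] = ![i]) (hj : θ ∘ ![1] = ![j]) :
      pull n F E 𝔘 θ (act h g) = pull n F E 𝔘 ![i] (h : Cochain n F E 𝔘 0) *
        pull n F E 𝔘 θ g * pull n F E 𝔘 ![j] (↑h⁻¹ : Cochain n F E 𝔘 0) := by
    rw [act, pull_mul, pull_mul, pull_pull_of_eq hi, pull_pull_of_eq hj]
  rw [bd, h1 ![0, 1] 0 1 (by decide) (by decide), h1 ![1, 2] 1 2 (by decide) (by decide),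
    h1 ![2, 0] 2 0 (by decide) (by decide)]
  have h2 := fun i : Fin 3 => pull_units_inv_mul (![i] : Fin 1 → Fin 3) h
  have h3 : ∀ {S : Type _} [Ring S] {a a' b b' c c' x y z : S}, a * a' = 1 → b' * b = 1 →
      c' * c = 1 → x * y * z = 1 → a * x * b' * (b * y * c') * (c * z * a') = 1 := by
    intro S _ a a' b b' c c' x y z ha hb hc hx
    calc a * x * b' * (b * y * c') * (c * z * a')
        = a * (x * (b' * b) * y * (c' * c) * z) * a' := by simp only [mul_assoc]
      _ = 1 := by rw [hb, hc, mul_one, mul_one, hx, mul_one, ha]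
  exact h3 (pull_units_mul_inv _ h) (h2 1) (h2 2) hg

theorem inv_mem_cochainsG (hr : Module.finrank ℂ F < 8) {h : (Cochain n F E 𝔘 p)ˣ}
    (hh : (h : Cochain n F E 𝔘 p) ∈ cochainsG n F E 𝔘 p) :
    (↑h⁻¹ : Cochain n F E 𝔘 p) ∈ cochainsG n F E 𝔘 p := by
  obtain ⟨d, hd, h1, -⟩ := exists_inv_mem_cochainsG hr hh
  rwa [Units.inv_eq_of_mul_eq_one_right h1]

theorem exists_units_of_mem_cochainsG (hr : Module.finrank ℂ F < 8) {h : Cochain n F E 𝔘 p}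
    (hh : h ∈ cochainsG n F E 𝔘 p) : ∃ k : (Cochain n F E 𝔘 p)ˣ, ↑k = h := by
  obtain ⟨d, -, h1, h2⟩ := exists_inv_mem_cochainsG hr hh
  exact ⟨⟨h, d, h1, h2⟩, rfl⟩

theorem act_mem_cochainsG (hr : Module.finrank ℂ F < 8) {h : (Cochain n F E 𝔘 0)ˣ}
    (hh : (h : Cochain n F E 𝔘 0) ∈ cochainsG n F E 𝔘 0) {g : Cochain n F E 𝔘 1}
    (hg : g ∈ cochainsG n F E 𝔘 1) : act h g ∈ cochainsG n F E 𝔘 1 :=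
  mul_mem_cochainsG (mul_mem_cochainsG (pull_mem_cochainsG _ hh) hg)
    (pull_mem_cochainsG _ (inv_mem_cochainsG hr hh))

theorem act_sub_self_mem_cFilt (hr : Module.finrank ℂ F < 8) {h : (Cochain n F E 𝔘 0)ˣ}
    (hh : (h : Cochain n F E 𝔘 0) ∈ cochainsG n F E 𝔘 0) {k : ℕ} {x : Cochain n F E 𝔘 1}
    (hx : x ∈ cFilt n F E 𝔘 k 1) : act h x - x ∈ cFilt n F E 𝔘 (k + 1) 1 := by
  have h1 := mul_sub_mem_cFilt (sub_one_mem_cFilt (pull_mem_cochainsG ![0] hh)) hx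
  have h2 := sub_mul_mem_cFilt
    (sub_one_mem_cFilt (pull_mem_cochainsG ![1] (inv_mem_cochainsG hr hh)))
    (add_mem (cFilt_anti k.le_succ h1) hx)
  rw [sub_add_cancel] at h2
  have h3 := add_mem h2 h1
  rwa [sub_add_sub_cancel] at h3

theorem act_mem_cFilt (hr : Module.finrank ℂ F < 8) {h : (Cochain n F E 𝔘 0)ˣ}
    (hh : (h : Cochain n F E 𝔘 0) ∈ cochainsG n F E 𝔘 0) {k : ℕ} {x : Cochain n F E 𝔘 1}
    (hx : x ∈ cFilt n F E 𝔘 k 1) : act h x ∈ cFilt n F E 𝔘 k 1 := by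
  have h1 := add_mem (cFilt_anti k.le_succ (act_sub_self_mem_cFilt hr hh hx)) hx
  rwa [sub_add_cancel] at h1

theorem pr_d0 (d : ℕ) (v : Cochain n F E 𝔘 0) :
    pr n F E 𝔘 d (d0 n F E 𝔘 v) = d0 n F E 𝔘 (pr n F E 𝔘 d v) := by
  simp only [d0, LinearMap.sub_apply, pull_pr, map_sub]

/-- Linearization of the action: unipotent factors do not affect leading terms, so the change of `g`
is governed by `(h_i - 1) - (h_j - 1)`. -/
theorem act_sub_sub_d0_mem_cFilt (hr : Module.finrank ℂ F < 8) {h : (Cochain n F E 𝔘 0)ˣ}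
    (hh : (h : Cochain n F E 𝔘 0) ∈ cochainsG n F E 𝔘 0) {k : ℕ}
    (hk : (h : Cochain n F E 𝔘 0) - 1 ∈ cFilt n F E 𝔘 k 0) {g : Cochain n F E 𝔘 1}
    (hg : g - 1 ∈ cFilt n F E 𝔘 1 1) :
    act h g - g - d0 n F E 𝔘 ((h : Cochain n F E 𝔘 0) - 1) ∈ cFilt n F E 𝔘 (k + 1) 1 := by
  have key {a b b' : Cochain n F E 𝔘 1} (ha : a - 1 ∈ cFilt n F E 𝔘 k 1)
      (hb : b - 1 ∈ cFilt n F E 𝔘 k 1) (hb' : b' - 1 ∈ cFilt n F E 𝔘 1 1) (hbb : b * b' = 1) :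
      a * g * b' - g - ((a - 1) - (b - 1)) ∈ cFilt n F E 𝔘 (k + 1) 1 := by
    have h1 := sub_mul_mem_cFilt hg ha
    have h2 := mul_sub_mem_cFilt hg hb
    have h3 := add_mem (cFilt_anti k.le_succ (sub_mem h1 h2)) (sub_mem ha hb)
    have h4 := add_mem (sub_mul_mem_cFilt hb' h3) (sub_mem h1 h2)
    -- With `b * b' = 1` one has `a * g * b' - g = (a * g - g * b) * b'`, and the difference `a * g
    -- - g * b` contains no inverse.
    have h5 : (a - 1) * g - (a - 1) - (g * (b - 1) - (b - 1)) + (a - 1 - (b - 1)) =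
        a * g - g * b := by noncomm_ring
    rw [h5, sub_mul, mul_assoc g, hbb, mul_one] at h4
    convert h4 using 1
    rw [eq_sub_of_add_eq h5]
    abel
  have h1 (θ : Fin 1 → Fin 2) : pull n F E 𝔘 θ (h : Cochain n F E 𝔘 0) - 1 ∈
      cFilt n F E 𝔘 k 1 := by
    rw [← pull_one θ, ← map_sub]
    exact pull_mem_cochains θ hk
  have h2 := key (h1 ![0]) (h1 ![1])
    (sub_one_mem_cFilt (pull_mem_cochainsG ![1] (inv_mem_cochainsG hr hh)))
    (pull_units_mul_inv _ h)
  rw [d0, LinearMap.sub_apply, map_sub, map_sub, pull_one, pull_one]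
  exact h2

/-- Without global derivations, an almost stabilizing cochain is almost trivial. -/
theorem sub_one_mem_cFilt_of_act (hr : Module.finrank ℂ F < 8)
    (hH : H0 n F E 𝔘 (DerNil n F E) = ⊥) {h : (Cochain n F E 𝔘 0)ˣ}
    (hh : (h : Cochain n F E 𝔘 0) ∈ cochainsG n F E 𝔘 0) {k : ℕ} {g : Cochain n F E 𝔘 1}
    (hg : g - 1 ∈ cFilt n F E 𝔘 1 1) (hk : act h g - g ∈ cFilt n F E 𝔘 k 1) :
    (h : Cochain n F E 𝔘 0) - 1 ∈ cFilt n F E 𝔘 k 0 := by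
  have key : ∀ l, l + 1 ≤ k → (h : Cochain n F E 𝔘 0) - 1 ∈ cFilt n F E 𝔘 (l + 1) 0 := by
    intro l
    induction l with
    | zero => exact fun _ => sub_one_mem_cFilt hh
    | succ l ih =>
      intro hl
      have h1 := ih (by omega)
      rw [mem_cFilt_succ_iff h1]
      have h2 := sub_mem (cFilt_anti hl hk) (act_sub_sub_d0_mem_cFilt hr hh h1 hg)
      rw [sub_sub_cancel] at h2
      have h3 := pr_eq_zero_of_mem_cFilt (Nat.lt_succ_self _) h2
      rw [pr_d0] at h3
      -- The leading term of `h - 1` is a derivation with zero coboundary, hence a global one, and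
      -- so it vanishes.
      have h4 : pr n F E 𝔘 (2 * (l + 1)) ((h : Cochain n F E 𝔘 0) - 1) ∈
          H0 n F E 𝔘 (DerNil n F E) :=
        ⟨cDer_le_DerNil (by omega) (pr_sub_mem_cDer hh one_mem_cochainsG h1), h3⟩
      rwa [hH, Submodule.mem_bot] at h4
  cases k with
  | zero => exact cFilt_anti (by omega) (sub_one_mem_cFilt hh)
  | succ k => exact key k le_rfl

/-- If the leading difference is `d v`, acting with `exp v` removes it. No hypothesis on global
derivations is needed in this direction. -/
theorem exists_act_sub_mem_cFilt_succ (hr : Module.finrank ℂ F < 8) {k : ℕ} (hk : 1 ≤ k)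
    {g g' : Cochain n F E 𝔘 1} (hg : g - 1 ∈ cFilt n F E 𝔘 1 1)
    (hgg : g' - g ∈ cFilt n F E 𝔘 k 1)
    (hB : pr n F E 𝔘 (2 * k) (g' - g) ∈ B1 n F E 𝔘 (Der n F E (2 * k))) :
    ∃ h : (Cochain n F E 𝔘 0)ˣ, (h : Cochain n F E 𝔘 0) ∈ cochainsG n F E 𝔘 0 ∧
      act h g - g' ∈ cFilt n F E 𝔘 (k + 1) 1 := by
  obtain ⟨v, hv, hvB⟩ := hB
  have hvN := cDer_le_DerNil hk hv
  have hv1 := DerNil_le_cFilt hvN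
  have hvk : v ∈ cFilt n F E 𝔘 k 0 := cDer_le_cFilt k hv
  have hG := exp_mem_cochainsG hr hvN
  obtain ⟨h, hh⟩ := exists_units_of_mem_cochainsG hr hG
  have hk1 := (exp_sub_one_mem_cFilt hr hv1).mpr hvk
  rw [← hh] at hG hk1
  refine ⟨h, hG, ?_⟩
  have h1 := act_sub_sub_d0_mem_cFilt hr hG hk1 hg
  have h2 := exp_sub_exp hr hv1 (zero_mem _) (by rwa [sub_zero])
  rw [exp_zero, sub_zero, ← hh] at h2
  have h3 : d0 n F E 𝔘 ((h : Cochain n F E 𝔘 0) - 1 - v) ∈ cFilt n F E 𝔘 (k + 1) 1 :=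
    sub_mem (pull_mem_cochains ![0] h2) (pull_mem_cochains ![1] h2)
  have h4 := sub_mem (add_mem h1 h3) (sub_pr_mem_cFilt hgg)
  rw [map_sub (d0 n F E 𝔘) ((h : Cochain n F E 𝔘 0) - 1) v, hvB] at h4
  convert h4 using 1
  abel

/-! ### Orbits up to a given degree -/

variable (n F E 𝔘) in
/-- Two cocycles are related if they are in the same orbit of `C^0(M, G_E)` up to terms of degree
at least `2k`. -/
def OrbitRel (k : ℕ) (u u' : Ctilde n F E 𝔘) : Prop :=
  ∃ h : (Cochain n F E 𝔘 0)ˣ, (h : Cochain n F E 𝔘 0) ∈ cochainsG n F E 𝔘 0 ∧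
    act h (exp (u : Cochain n F E 𝔘 1)) - exp (u' : Cochain n F E 𝔘 1) ∈ cFilt n F E 𝔘 k 1

theorem OrbitRel.of_sub_mem (hr : Module.finrank ℂ F < 8) {k : ℕ} {u u' : Ctilde n F E 𝔘}
    (h : (u : Cochain n F E 𝔘 1) - u' ∈ cFilt n F E 𝔘 k 1) : OrbitRel n F E 𝔘 k u u' := by
  refine ⟨1, one_mem_cochainsG, ?_⟩
  rw [act_one, exp_sub_exp_mem_iff hr (DerNil_le_cFilt u.2.1) (DerNil_le_cFilt u'.2.1)]
  exact h

theorem OrbitRel.symm (hr : Module.finrank ℂ F < 8) {k : ℕ} {u u' : Ctilde n F E 𝔘}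
    (h : OrbitRel n F E 𝔘 k u u') : OrbitRel n F E 𝔘 k u' u := by
  obtain ⟨h, hh, h1⟩ := h
  have hh' := inv_mem_cochainsG hr hh
  refine ⟨h⁻¹, hh', ?_⟩
  have h2 := neg_mem (act_mem_cFilt hr hh' h1)
  rwa [act_sub, ← act_mul, inv_mul_cancel, act_one, neg_sub] at h2

theorem OrbitRel.trans (hr : Module.finrank ℂ F < 8) {k : ℕ} {u u' u'' : Ctilde n F E 𝔘}
    (h : OrbitRel n F E 𝔘 k u u') (h' : OrbitRel n F E 𝔘 k u' u'') :
    OrbitRel n F E 𝔘 k u u'' := by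
  obtain ⟨h, hh, h1⟩ := h
  obtain ⟨h', hh', h1'⟩ := h'
  refine ⟨h' * h, by rw [Units.val_mul]; exact mul_mem_cochainsG hh' hh, ?_⟩
  have h2 := add_mem (act_mem_cFilt hr hh' h1) h1'
  rwa [act_sub, ← act_mul, sub_add_sub_cancel] at h2

theorem OrbitRel.anti {k l : ℕ} (hkl : k ≤ l) {u u' : Ctilde n F E 𝔘}
    (h : OrbitRel n F E 𝔘 l u u') : OrbitRel n F E 𝔘 k u u' := by
  obtain ⟨h, hh, h1⟩ := h
  exact ⟨h, hh, cFilt_anti hkl h1⟩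

/-- Normal forms `h(u).exp(u)` of the cocycles up to terms of degree `2k`, together with a map `D`
by which the terms of degree `2k` are corrected. -/
structure NormalForm (k : ℕ) (D : Ctilde n F E 𝔘 → Cochain n F E 𝔘 1)
    (rep : Ctilde n F E 𝔘 → Ctilde n F E 𝔘) (h : Ctilde n F E 𝔘 → (Cochain n F E 𝔘 0)ˣ) :
    Prop where
  factors : ∀ u u' : Ctilde n F E 𝔘, prLE n F E 𝔘 (k - 1) (u : Cochain n F E 𝔘 1) =
    prLE n F E 𝔘 (k - 1) (u' : Cochain n F E 𝔘 1) → D u = D u'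
  rep_eq : ∀ u u', OrbitRel n F E 𝔘 k u u' → rep u = rep u'
  mem_G : ∀ u, (h u : Cochain n F E 𝔘 0) ∈ cochainsG n F E 𝔘 0
  act_sub_mem : ∀ u : Ctilde n F E 𝔘, act (h u) (exp (u : Cochain n F E 𝔘 1)) -
    exp (rep u : Cochain n F E 𝔘 1) ∈ cFilt n F E 𝔘 k 1
  add_pr : ∀ u : Ctilde n F E 𝔘, D u + pr n F E 𝔘 (2 * k) (u : Cochain n F E 𝔘 1) =
    pr n F E 𝔘 (2 * k) (act (h u) (exp (u : Cochain n F E 𝔘 1)) -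
      exp (rep u : Cochain n F E 𝔘 1))

/-- Two choices are combined. The transformation is chosen from a fixed representative `c u` of the
truncation class, so that `D u` depends on the truncation only; the target `s (c u)` is a fixed
representative of the orbit modulo `Filt k`, so that equivalent cocycles are compared with the same
one. -/
theorem exists_normalForm (hr : Module.finrank ℂ F < 8) (k : ℕ) :
    ∃ (D : Ctilde n F E 𝔘 → Cochain n F E 𝔘 1) (rep : Ctilde n F E 𝔘 → Ctilde n F E 𝔘)
      (h : Ctilde n F E 𝔘 → (Cochain n F E 𝔘 0)ˣ), NormalForm k D rep h := by
  let S : Setoid (Ctilde n F E 𝔘) :=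
    ⟨OrbitRel n F E 𝔘 k, fun u => .of_sub_mem hr (by rw [sub_self]; exact zero_mem _),
      fun h => h.symm hr, fun h h' => h.trans hr h'⟩
  let T : Setoid (Ctilde n F E 𝔘) :=
    Setoid.ker fun u : Ctilde n F E 𝔘 => prLE n F E 𝔘 (k - 1) (u : Cochain n F E 𝔘 1)
  let s : Ctilde n F E 𝔘 → Ctilde n F E 𝔘 := fun u => (Quotient.mk S u).out
  let c : Ctilde n F E 𝔘 → Ctilde n F E 𝔘 := fun u => (Quotient.mk T u).out
  have hs (u) : OrbitRel n F E 𝔘 k u (s u) := S.symm (Quotient.mk_out (s := S) u)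
  have hc (u : Ctilde n F E 𝔘) :
      (u : Cochain n F E 𝔘 1) - (c u : Cochain n F E 𝔘 1) ∈ cFilt n F E 𝔘 k 1 := by
    have h1 : prLE n F E 𝔘 (k - 1) (u : Cochain n F E 𝔘 1) =
      prLE n F E 𝔘 (k - 1) (c u : Cochain n F E 𝔘 1) := T.symm (Quotient.mk_out (s := T) u)
    -- This yields `Filt (k - 1 + 1)`; for `k = 0` the truncated subtraction gives `Filt 1`, which
    -- is still enough.
    rw [prLE_eq_iff _ u.2.1 (c u).2.1] at h1
    exact cFilt_anti (by omega) h1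
  choose h hG hmem using hs
  -- One transformation acts on both `exp u` and `exp (c u)`. Their difference keeps its leading
  -- term `u - c u`, which explains the subtraction of `pr_{2k}(c u)` in the definition of `D`.
  have hdiff (u : Ctilde n F E 𝔘) :
      act (h (c u)) (exp (u : Cochain n F E 𝔘 1)) - act (h (c u)) (exp (c u : Cochain n F E 𝔘 1)) -
        ((u : Cochain n F E 𝔘 1) - c u) ∈ cFilt n F E 𝔘 (k + 1) 1 := by
    have hu1 := DerNil_le_cFilt u.2.1
    have hcu := DerNil_le_cFilt (c u).2.1
    have h1 := act_sub_self_mem_cFilt hr (hG (c u)) ((exp_sub_exp_mem_iff hr hu1 hcu).mpr (hc u))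
    have h2 := add_mem h1 (exp_sub_exp hr hu1 hcu (hc u))
    rwa [sub_add_sub_cancel, act_sub] at h2
  refine ⟨fun u => pr n F E 𝔘 (2 * k) (act (h (c u)) (exp (c u : Cochain n F E 𝔘 1)) -
    exp (s (c u) : Cochain n F E 𝔘 1)) - pr n F E 𝔘 (2 * k) (c u : Cochain n F E 𝔘 1),
    fun u => s (c u), fun u => h (c u), fun u u' huu => ?_, fun u u' huu => ?_,
    fun u => hG _, fun u => ?_, fun u => ?_⟩
  · have h1 : c u = c u' := congrArg Quotient.out (Quotient.sound (s := T) huu)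
    simp only [h1]
  · refine congrArg Quotient.out (Quotient.sound (s := S) ?_)
    exact ((OrbitRel.of_sub_mem hr (hc u)).symm hr).trans hr
      (huu.trans hr (.of_sub_mem hr (hc u')))
  · have h1 := add_mem (add_mem (cFilt_anti k.le_succ (hdiff u)) (hc u)) (hmem (c u))
    rwa [sub_add_cancel, sub_add_sub_cancel] at h1
  · have h1 := pr_eq_zero_of_mem_cFilt k.lt_succ_self (hdiff u)
    simp only [map_sub] at h1 ⊢
    rw [← sub_eq_zero, ← neg_eq_zero, ← h1]
    abel

namespace NormalForm

variable {k : ℕ} {D : Ctilde n F E 𝔘 → Cochain n F E 𝔘 1}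
  {rep : Ctilde n F E 𝔘 → Ctilde n F E 𝔘} {h : Ctilde n F E 𝔘 → (Cochain n F E 𝔘 0)ˣ}

theorem act_mem_G (H : NormalForm k D rep h) (hr : Module.finrank ℂ F < 8) (u : Ctilde n F E 𝔘) :
    act (h u) (exp (u : Cochain n F E 𝔘 1)) ∈ cochainsG n F E 𝔘 1 :=
  act_mem_cochainsG hr (H.mem_G u) u.2.2.1

theorem add_pr_mem_Z1 (H : NormalForm k D rep h) (hr : Module.finrank ℂ F < 8)
    (u : Ctilde n F E 𝔘) : D u + pr n F E 𝔘 (2 * k) (u : Cochain n F E 𝔘 1) ∈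
      Z1 n F E 𝔘 (Der n F E (2 * k)) := by
  rw [H.add_pr]
  exact ⟨pr_sub_mem_cDer (H.act_mem_G hr u) (rep u).2.2.1 (H.act_sub_mem u),
    d1_pr_sub_eq_zero (sub_one_mem_cFilt (H.act_mem_G hr u)) (sub_one_mem_cFilt (rep u).2.2.1)
      (bd_act u.2.2.2) (rep u).2.2.2 (H.act_sub_mem u)⟩

theorem mem (H : NormalForm k D rep h) (hr : Module.finrank ℂ F < 8) (u : Ctilde n F E 𝔘) :
    D u ∈ cDer n F E 𝔘 k 1 := by
  have h1 := sub_mem (H.add_pr_mem_Z1 hr u).1 (pr_mem_cDer k u.2.1)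
  rwa [add_sub_cancel_right] at h1

theorem d_eq (H : NormalForm k D rep h) (hr : Module.finrank ℂ F < 8) (hk : 1 ≤ k)
    (u : Ctilde n F E 𝔘) : d1 n F E 𝔘 (D u) = R k (u : Cochain n F E 𝔘 1) := by
  have h1 : d1 n F E 𝔘 (D u + pr n F E 𝔘 (2 * k) (u : Cochain n F E 𝔘 1)) = 0 :=
    (H.add_pr_mem_Z1 hr u).2
  rw [map_add] at h1
  rw [R_eq_neg_d1 hr hk u.2]
  exact eq_neg_of_add_eq_zero_left h1

theorem act_sub_act_mem (H : NormalForm k D rep h) {u u' : Ctilde n F E 𝔘}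
    (huu : OrbitRel n F E 𝔘 k u u') :
    act (h u') (exp (u' : Cochain n F E 𝔘 1)) - act (h u) (exp (u : Cochain n F E 𝔘 1)) ∈
      cFilt n F E 𝔘 k 1 := by
  have h1 := sub_mem (H.act_sub_mem u') (H.act_sub_mem u)
  rwa [H.rep_eq u u' huu, sub_sub_sub_cancel_right] at h1

theorem sub_eq_pr (H : NormalForm k D rep h) {u u' : Ctilde n F E 𝔘}
    (huu : OrbitRel n F E 𝔘 k u u') :
    (D u' + pr n F E 𝔘 (2 * k) (u' : Cochain n F E 𝔘 1)) -
      (D u + pr n F E 𝔘 (2 * k) (u : Cochain n F E 𝔘 1)) =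
    pr n F E 𝔘 (2 * k) (act (h u') (exp (u' : Cochain n F E 𝔘 1)) -
      act (h u) (exp (u : Cochain n F E 𝔘 1))) := by
  rw [H.add_pr, H.add_pr, ← map_sub, H.rep_eq u u' huu, sub_sub_sub_cancel_right]

/-- Let `x` and `x'` be the normalized forms of `exp u` and `exp u'`. They agree modulo `Filt k`, so
a transformation taking `x` to `x'` modulo `Filt (k + 1)` fixes `x` modulo `Filt k`. By `hH` it is
then trivial modulo `Filt k`, and its leading term is a derivation bounding the leading term of `x'
- x`. -/
theorem orbitRel_succ_iff (H : NormalForm k D rep h) (hr : Module.finrank ℂ F < 8) (hk : 1 ≤ k)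
    (hH : H0 n F E 𝔘 (DerNil n F E) = ⊥) (u u' : Ctilde n F E 𝔘) :
    OrbitRel n F E 𝔘 (k + 1) u u' ↔ OrbitRel n F E 𝔘 k u u' ∧
      (D u' + pr n F E 𝔘 (2 * k) (u' : Cochain n F E 𝔘 1)) -
        (D u + pr n F E 𝔘 (2 * k) (u : Cochain n F E 𝔘 1)) ∈
      B1 n F E 𝔘 (Der n F E (2 * k)) := by
  constructor
  · intro huu
    have huu' := huu.anti k.le_succ
    refine ⟨huu', ?_⟩
    rw [H.sub_eq_pr huu']
    have h1 := H.act_sub_act_mem huu'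
    obtain ⟨m, hm, h2⟩ := huu
    -- The given transformation `m`, conjugated to act between the normalized cocycles.
    have hm' : (↑(h u' * m * (h u)⁻¹) : Cochain n F E 𝔘 0) ∈ cochainsG n F E 𝔘 0 := by
      rw [Units.val_mul, Units.val_mul]
      exact mul_mem_cochainsG (mul_mem_cochainsG (H.mem_G u') hm) (inv_mem_cochainsG hr (H.mem_G u))
    have h3 := act_mem_cFilt hr (H.mem_G u') h2
    have h4 : act (h u') (act m (exp (u : Cochain n F E 𝔘 1))) =
        act (h u' * m * (h u)⁻¹) (act (h u) (exp (u : Cochain n F E 𝔘 1))) := by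
      rw [← act_mul, ← act_mul, inv_mul_cancel_right]
    rw [act_sub, h4] at h3
    have h5 := add_mem (cFilt_anti k.le_succ h3) h1
    rw [sub_add_sub_cancel] at h5
    have hx := sub_one_mem_cFilt (H.act_mem_G hr u)
    have h6 := sub_one_mem_cFilt_of_act hr hH hm' hx h5
    have h7 := sub_mem (act_sub_sub_d0_mem_cFilt hr hm' h6 hx) h3
    rw [sub_right_comm, sub_sub_sub_cancel_left] at h7
    have h8 := pr_eq_zero_of_mem_cFilt k.lt_succ_self h7
    rw [map_sub, pr_d0, sub_eq_zero] at h8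
    rw [h8]
    exact Submodule.mem_map_of_mem (pr_sub_mem_cDer hm' one_mem_cochainsG h6)
  · rintro ⟨huu, hB⟩
    rw [H.sub_eq_pr huu] at hB
    obtain ⟨m, hm, h1⟩ := exists_act_sub_mem_cFilt_succ hr hk
      (sub_one_mem_cFilt (H.act_mem_G hr u)) (H.act_sub_act_mem huu) hB
    have hi := inv_mem_cochainsG hr (H.mem_G u')
    refine ⟨(h u')⁻¹ * m * h u, ?_, ?_⟩
    · rw [Units.val_mul, Units.val_mul]
      exact mul_mem_cochainsG (mul_mem_cochainsG hi hm) (H.mem_G u)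
    · have h2 := act_mem_cFilt hr hi h1
      rwa [act_sub, ← act_mul, ← act_mul, ← act_mul, inv_mul_cancel, act_one] at h2

end NormalForm

end Orbits

/-! ### The choice of `D` and the classifying map -/

section Sigma

variable {n : ℕ} {M : Type*} [TopologicalSpace M] [ChartedSpace (EuclideanSpace ℂ (Fin n)) M]
  {F : Type*} [NormedAddCommGroup F] [NormedSpace ℂ F] [FiniteDimensional ℂ F]
  {E : M → Type*} [∀ x, AddCommGroup (E x)] [∀ x, Module ℂ (E x)]
  [∀ x, TopologicalSpace (E x)] [TopologicalSpace (TotalSpace F E)]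
  [FiberBundle F E] [VectorBundle ℂ F E]
  {A ι : Type*} [Preorder A] [IsDirectedOrder A] [Nonempty A] {𝔘 : CoverSystem A ι M}
  {p q : ℕ}

/-! ### The map `σ` -/

theorem orbitRel_one (u u' : Ctilde n F E 𝔘) (hr : Module.finrank ℂ F < 8) :
    OrbitRel n F E 𝔘 1 u u' :=
  .of_sub_mem hr (sub_mem (DerNil_le_cFilt u.2.1) (DerNil_le_cFilt u'.2.1))

theorem orbitRel_four_iff (hr : Module.finrank ℂ F < 8) (u u' : Ctilde n F E 𝔘) :
    OrbitRel n F E 𝔘 4 u u' ↔ ∃ h ∈ cochainsG n F E 𝔘 0,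
      exp (u' : Cochain n F E 𝔘 1) * pull n F E 𝔘 ![1] h =
        pull n F E 𝔘 ![0] h * exp (u : Cochain n F E 𝔘 1) := by
  constructor
  · rintro ⟨h, hh, h1⟩
    exact ⟨h, hh, act_eq_iff.mp (sub_eq_zero.mp (eq_zero_of_mem_cFilt (by omega) h1))⟩
  · rintro ⟨h, hh, h1⟩
    obtain ⟨k, rfl⟩ := exists_units_of_mem_cochainsG hr hh
    refine ⟨k, hh, ?_⟩
    rw [act_eq_iff.mpr h1, sub_self]
    exact zero_mem _

theorem orbitRel_two_iff (hr : Module.finrank ℂ F < 8)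
    (hH : H0 n F E 𝔘 (DerNil n F E) = ⊥) (u u' : Ctilde n F E 𝔘) :
    OrbitRel n F E 𝔘 2 u u' ↔ pr n F E 𝔘 2 (u' : Cochain n F E 𝔘 1) -
      pr n F E 𝔘 2 (u : Cochain n F E 𝔘 1) ∈ B1 n F E 𝔘 (Der n F E 2) := by
  obtain ⟨D, rep, h, H⟩ := exists_normalForm (n := n) (F := F) (E := E) (𝔘 := 𝔘) hr 1
  have h1 := H.orbitRel_succ_iff hr le_rfl hH u u'
  -- For `k = 1` the map `D` depends on the empty truncation, so it is constant and cancels.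
  rw [H.factors u u' (by rw [prLE_zero, prLE_zero]), add_sub_add_left_eq_sub] at h1
  exact h1.trans (and_iff_right (orbitRel_one u u' hr))

theorem ZtildeModB.mk_eq_iff {u u' : Cochain n F E 𝔘 1} (hu : u ∈ Ztilde n F E 𝔘)
    (hu' : u' ∈ Ztilde n F E 𝔘) :
    ZtildeModB.mk u hu = ZtildeModB.mk u' hu' ↔ u - u' ∈ B1 n F E 𝔘 (Der n F E 2) :=
  Quotient.eq.trans (Submodule.quotientRel_def _)

theorem H1.mk_eq_iff {𝓕 : Coeff n F E} {u u' : Cochain n F E 𝔘 1} (hu : u ∈ Z1 n F E 𝔘 𝓕)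
    (hu' : u' ∈ Z1 n F E 𝔘 𝓕) : H1.mk u hu = H1.mk u' hu' ↔ u - u' ∈ B1 n F E 𝔘 𝓕 :=
  Submodule.Quotient.eq _

/-- The difference between `a` and the present value is closed and can be added to `u` in degree
`2k`. Neither this nor the completion in higher degrees alters the truncation on which `D k`
depends, so the value becomes exactly `a`. -/
theorem exists_Ctilde_add_pr_eq (hr : Module.finrank ℂ F < 8)
    (h4 : Subsingleton (H2 n F E 𝔘 (Der n F E 4)))
    (h6 : Subsingleton (H2 n F E 𝔘 (Der n F E 6)))
    {D : ℕ → Ctilde n F E 𝔘 → Cochain n F E 𝔘 1} (hD : IsChoice D) {k : ℕ} (hk : 2 ≤ k)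
    (u : Ctilde n F E 𝔘) {a : Cochain n F E 𝔘 1} (ha : a ∈ Z1 n F E 𝔘 (Der n F E (2 * k))) :
    ∃ u' : Ctilde n F E 𝔘, (u' : Cochain n F E 𝔘 1) - u ∈ cFilt n F E 𝔘 k 1 ∧
      D k u' + pr n F E 𝔘 (2 * k) (u' : Cochain n F E 𝔘 1) = a := by
  have hv : a - (D k u + pr n F E 𝔘 (2 * k) (u : Cochain n F E 𝔘 1)) ∈
      Z1 n F E 𝔘 (Der n F E (2 * k)) := by
    refine sub_mem ha ⟨add_mem (hD.mem k hk u) (pr_mem_cDer k u.2.1), ?_⟩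
    change d1 n F E 𝔘 _ = 0
    rw [map_add, hD.d_eq k hk, R_eq_neg_d1 hr (by omega) u.2, neg_add_cancel]
  obtain ⟨u', hu', h1⟩ := exists_mem_Ctilde_add hr h4 h6 hk u.2 hv
  have h2 : u' - u ∈ cFilt n F E 𝔘 k 1 := by
    have h3 := add_mem (cFilt_anti k.le_succ h1) (cDer_le_cFilt k hv.1)
    rwa [← sub_sub, sub_add_cancel] at h3
  refine ⟨⟨u', hu'⟩, h2, ?_⟩
  have h3 : D k ⟨u', hu'⟩ = D k u := by
    refine hD.factors k hk _ _ ?_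
    rw [prLE_eq_iff _ hu'.1 u.2.1, Nat.sub_add_cancel (by omega)]
    exact h2
  have h5 := pr_eq_zero_of_mem_cFilt k.lt_succ_self h1
  rw [map_sub, map_add, pr_of_mem_cDer hv.1, sub_eq_zero] at h5
  rw [h3]
  change _ + pr n F E 𝔘 (2 * k) u' = a
  rw [h5]
  abel

theorem IsChoice.congr {D : ℕ → Ctilde n F E 𝔘 → Cochain n F E 𝔘 1} (hD : IsChoice D) {k : ℕ}
    (hk : 2 ≤ k) {u u' : Ctilde n F E 𝔘}
    (h : (u : Cochain n F E 𝔘 1) - u' ∈ cFilt n F E 𝔘 k 1) : D k u = D k u' := by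
  refine hD.factors k hk _ _ ?_
  rwa [prLE_eq_iff _ u.2.1 u'.2.1, Nat.sub_add_cancel (by omega)]

theorem pr_sum_of_mem_cDer {I : Finset ℕ} {f : ℕ → Cochain n F E 𝔘 p}
    (hf : ∀ q ∈ I, f q ∈ cDer n F E 𝔘 q p) (k : ℕ) :
    pr n F E 𝔘 (2 * k) (∑ q ∈ I, f q) = if k ∈ I then f k else 0 := by
  rw [map_sum, ← Finset.sum_ite_eq' I k f]
  refine Finset.sum_congr rfl fun q hq => ?_
  split_ifs with h
  · subst h
    exact pr_of_mem_cDer (hf _ hq)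
  · exact pr_of_mem_cDer_ne h (hf q hq)

theorem pr_sigmaCochain {D : ℕ → Ctilde n F E 𝔘 → Cochain n F E 𝔘 1} (hD : IsChoice D)
    (u : Ctilde n F E 𝔘) (k : ℕ) :
    pr n F E 𝔘 (2 * k) (sigmaCochain D u) =
      (if k ∈ Finset.Icc 2 (Module.finrank ℂ F) then D k u else 0) +
        pr n F E 𝔘 (2 * k) (u : Cochain n F E 𝔘 1) := by
  rw [sigmaCochain, map_add, pr_sum_of_mem_cDer]
  exact fun q hq => hD.mem q (Finset.mem_Icc.mp hq).1 u

theorem exists_isChoice (hr : Module.finrank ℂ F < 8) (hH : H0 n F E 𝔘 (DerNil n F E) = ⊥) :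
    ∃ D : ℕ → Ctilde n F E 𝔘 → Cochain n F E 𝔘 1, IsChoice D ∧ ∀ k, 2 ≤ k → ∀ u u',
      (OrbitRel n F E 𝔘 (k + 1) u u' ↔ OrbitRel n F E 𝔘 k u u' ∧
        (D k u' + pr n F E 𝔘 (2 * k) (u' : Cochain n F E 𝔘 1)) -
          (D k u + pr n F E 𝔘 (2 * k) (u : Cochain n F E 𝔘 1)) ∈
        B1 n F E 𝔘 (Der n F E (2 * k))) := by
  choose D rep h H using exists_normalForm (n := n) (F := F) (E := E) (𝔘 := 𝔘) hr
  exact ⟨D, ⟨fun k _ => (H k).mem hr, fun k _ => (H k).factors,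
    fun k hk => (H k).d_eq hr (by omega)⟩,
    fun k hk => (H k).orbitRel_succ_iff hr (by omega) hH⟩

/-- Every cocycle has a unique logarithm, and as `Filt 4 = 0` equivalence modulo `Filt 4` is the
genuine orbit relation. So `Φ` of the logarithm descends to orbits and is injective there. -/
theorem exists_bijective_of_forall_iff (hr : Module.finrank ℂ F < 8) {T : Type*}
    (Φ : Ctilde n F E 𝔘 → T) (hΦ : ∀ u u', Φ u = Φ u' ↔ OrbitRel n F E 𝔘 4 u u')
    (hsurj : Function.Surjective Φ) :
    ∃ σ : H1G n F E 𝔘 → T,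
      (∀ u : Ctilde n F E 𝔘, σ (H1G.mk (exp (u : Cochain n F E 𝔘 1)) u.2.2) = Φ u) ∧
        Function.Bijective σ := by
  have hlog (g : Z1G n F E 𝔘) :
      ∃ u : Ctilde n F E 𝔘, exp (u : Cochain n F E 𝔘 1) = (g : Cochain n F E 𝔘 1) := by
    obtain ⟨u, hu, hug⟩ := exists_exp_eq hr g.2.1
    exact ⟨⟨u, hu, hug ▸ g.2⟩, hug⟩
  choose log hlog using hlog
  have hrel (g g' : Z1G n F E 𝔘) : Φ (log g) = Φ (log g') ↔ ∃ h ∈ cochainsG n F E 𝔘 0,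
      (g' : Cochain n F E 𝔘 1) * pull n F E 𝔘 ![1] h =
        pull n F E 𝔘 ![0] h * (g : Cochain n F E 𝔘 1) := by
    rw [hΦ, orbitRel_four_iff hr, hlog, hlog]
  let σ : H1G n F E 𝔘 → T := Quot.lift (fun g => Φ (log g)) fun g g' h => (hrel g g').mpr h
  have hσ (u : Ctilde n F E 𝔘) : σ (H1G.mk (exp (u : Cochain n F E 𝔘 1)) u.2.2) = Φ u := by
    refine congrArg Φ (Subtype.ext ?_)
    exact exp_injOn hr (DerNil_le_cFilt (log _).2.1) (DerNil_le_cFilt u.2.1) (hlog _)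
  refine ⟨σ, hσ, ?_, fun t => ?_⟩
  · rintro ⟨g⟩ ⟨g'⟩ h
    exact Quot.sound ((hrel g g').mp h)
  · obtain ⟨u, rfl⟩ := hsurj t
    exact ⟨H1G.mk (exp (u : Cochain n F E 𝔘 1)) u.2.2, hσ u⟩

end Sigma

end SuperCech

end

/-! ### The theorem in ranks 6 and 7 -/

theorem mainTheorem4 {n : ℕ} {M : Type*} [TopologicalSpace M]
    [ChartedSpace (EuclideanSpace ℂ (Fin n)) M] [IsManifold 𝓘(ℂ, EuclideanSpace ℂ (Fin n)) ω M]
    {F : Type*} [NormedAddCommGroup F] [NormedSpace ℂ F] [FiniteDimensional ℂ F]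
    {E : M → Type*} [∀ x, AddCommGroup (E x)] [∀ x, Module ℂ (E x)]
    [∀ x, TopologicalSpace (E x)] [TopologicalSpace (Bundle.TotalSpace F E)]
    [FiberBundle F E] [VectorBundle ℂ F E]
    [ContMDiffVectorBundle ω F E 𝓘(ℂ, EuclideanSpace ℂ (Fin n))]
    (hrank : Module.finrank ℂ F = 6 ∨ Module.finrank ℂ F = 7)
    {A ι : Type*} [Preorder A] [IsDirectedOrder A] [Nonempty A] (𝔘 : CoverSystem A ι M)
    (h4 : Subsingleton (H2 n F E 𝔘 (Der n F E 4)))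
    (h6 : Subsingleton (H2 n F E 𝔘 (Der n F E 6))) :
    (∀ u₂ ∈ cochains n F E 𝔘 (Der n F E 2) 1,
      (∃ u ∈ Ctilde n F E 𝔘, pr n F E 𝔘 2 u = u₂) ↔ u₂ ∈ Ztilde n F E 𝔘) ∧
    (H0 n F E 𝔘 (DerNil n F E) = ⊥ →
      ∃ D : ℕ → Ctilde n F E 𝔘 → Cochain n F E 𝔘 1, IsChoice D ∧
        ∃ σ : H1G n F E 𝔘 →
            ZtildeModB n F E 𝔘 × H1 n F E 𝔘 (Der n F E 4) × H1 n F E 𝔘 (Der n F E 6),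
          (∀ u : Ctilde n F E 𝔘,
            ∃ (hu₂ : pr n F E 𝔘 2 (sigmaCochain D u) ∈ Ztilde n F E 𝔘)
              (hu₄ : pr n F E 𝔘 4 (sigmaCochain D u) ∈ Z1 n F E 𝔘 (Der n F E 4))
              (hu₆ : pr n F E 𝔘 6 (sigmaCochain D u) ∈ Z1 n F E 𝔘 (Der n F E 6)),
              σ (H1G.mk (exp (u : Cochain n F E 𝔘 1)) u.2.2) =
                (ZtildeModB.mk _ hu₂, H1.mk _ hu₄, H1.mk _ hu₆)) ∧
          Function.Bijective σ) := by
  have hr : Module.finrank ℂ F < 8 := by omega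
  refine ⟨fun u₂ _ => ⟨?_, fun h => ?_⟩, fun hH => ?_⟩
  · rintro ⟨u, hu, rfl⟩
    rw [Ztilde_eq hr]
    exact pr_two_mem_Z1 hr hu
  · rw [Ztilde_eq hr] at h
    exact exists_mem_Ctilde_pr_two_eq hr h4 h6 h
  obtain ⟨D, hD, hrel⟩ := exists_isChoice (n := n) (F := F) (E := E) (𝔘 := 𝔘) hr hH
  have hp₂ (u) : pr n F E 𝔘 2 (sigmaCochain D u) = pr n F E 𝔘 2 (u : Cochain n F E 𝔘 1) := by
    have h := pr_sigmaCochain hD u 1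
    -- The corrections start with `q = 2`, so degree 2 is left unchanged.
    rwa [if_neg (by simp), zero_add] at h
  have hp₄ (u) : pr n F E 𝔘 4 (sigmaCochain D u) =
      D 2 u + pr n F E 𝔘 4 (u : Cochain n F E 𝔘 1) := by
    have h := pr_sigmaCochain hD u 2
    rwa [if_pos (by rw [Finset.mem_Icc]; omega)] at h
  have hp₆ (u) : pr n F E 𝔘 6 (sigmaCochain D u) =
      D 3 u + pr n F E 𝔘 6 (u : Cochain n F E 𝔘 1) := by
    have h := pr_sigmaCochain hD u 3
    -- The summand `q = 3` is present because the rank is at least 3.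
    rwa [if_pos (by rw [Finset.mem_Icc]; omega)] at h
  have hZ (k : ℕ) (hk : 2 ≤ k) (u : Ctilde n F E 𝔘) :
      D k u + pr n F E 𝔘 (2 * k) (u : Cochain n F E 𝔘 1) ∈ Z1 n F E 𝔘 (Der n F E (2 * k)) := by
    refine ⟨add_mem (hD.mem k hk u) (pr_mem_cDer k u.2.1), ?_⟩
    change d1 n F E 𝔘 _ = 0
    rw [map_add, hD.d_eq k hk, R_eq_neg_d1 hr (by omega) u.2, neg_add_cancel]
  have hu₂ (u) : pr n F E 𝔘 2 (sigmaCochain D u) ∈ Ztilde n F E 𝔘 := by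
    rw [hp₂, Ztilde_eq hr]
    exact pr_two_mem_Z1 hr u.2
  have hu₄ (u) : pr n F E 𝔘 4 (sigmaCochain D u) ∈ Z1 n F E 𝔘 (Der n F E 4) :=
    hp₄ u ▸ hZ 2 le_rfl u
  have hu₆ (u) : pr n F E 𝔘 6 (sigmaCochain D u) ∈ Z1 n F E 𝔘 (Der n F E 6) :=
    hp₆ u ▸ hZ 3 (by norm_num) u
  let Φ : Ctilde n F E 𝔘 →
      ZtildeModB n F E 𝔘 × H1 n F E 𝔘 (Der n F E 4) × H1 n F E 𝔘 (Der n F E 6) :=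
    fun u => (ZtildeModB.mk _ (hu₂ u), H1.mk _ (hu₄ u), H1.mk _ (hu₆ u))
  have hΦ (u u') : Φ u = Φ u' ↔ OrbitRel n F E 𝔘 4 u u' := by
    have h2 := orbitRel_two_iff hr hH u' u
    have h3 := hrel 2 le_rfl u' u
    have h4 := hrel 3 (by norm_num) u' u
    rw [← hp₂, ← hp₂] at h2
    simp only [Nat.reduceMul, Nat.reduceAdd, ← hp₄, ← hp₆] at h3 h4
    have h5 : OrbitRel n F E 𝔘 4 u u' ↔ OrbitRel n F E 𝔘 4 u' u :=
      ⟨OrbitRel.symm hr, OrbitRel.symm hr⟩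
    rw [Prod.mk.injEq, Prod.mk.injEq, ZtildeModB.mk_eq_iff, H1.mk_eq_iff, H1.mk_eq_iff, h5, h4, h3,
      h2, and_assoc]
  have hsurj : Function.Surjective Φ := by
    rintro ⟨t₂, t₄, t₆⟩
    obtain ⟨⟨a₂, ha₂⟩, rfl⟩ := Quotient.exists_rep t₂
    obtain ⟨⟨a₄, ha₄⟩, rfl⟩ := Submodule.Quotient.mk_surjective _ t₄
    obtain ⟨⟨a₆, ha₆⟩, rfl⟩ := Submodule.Quotient.mk_surjective _ t₆
    -- The three components are prescribed in increasing degree; each later adjustment lies deeper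
    -- in the filtration and preserves the values already reached.
    obtain ⟨u, hu, hua⟩ := exists_mem_Ctilde_pr_two_eq hr h4 h6 ha₂.1
    obtain ⟨u', h1, h1'⟩ := exists_Ctilde_add_pr_eq hr h4 h6 hD (k := 2) le_rfl ⟨u, hu⟩ ha₄
    obtain ⟨u'', h2, h2'⟩ := exists_Ctilde_add_pr_eq hr h4 h6 hD (k := 3) (by norm_num) u' ha₆
    have e₂ : pr n F E 𝔘 2 (sigmaCochain D u'') = a₂ := by
      have h3 := pr_eq_zero_of_mem_cFilt (l := 1) (by norm_num) h2
      have h3' := pr_eq_zero_of_mem_cFilt (l := 1) (by norm_num) h1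
      rw [map_sub, sub_eq_zero] at h3 h3'
      rw [hp₂, ← hua]
      exact h3.trans h3'
    have e₄ : pr n F E 𝔘 4 (sigmaCochain D u'') = a₄ := by
      have h3 := pr_eq_zero_of_mem_cFilt (l := 2) (by norm_num) h2
      rw [map_sub, sub_eq_zero] at h3
      rw [hp₄, hD.congr le_rfl (cFilt_anti (by norm_num) h2), ← h1']
      exact congrArg _ h3
    have e₆ : pr n F E 𝔘 6 (sigmaCochain D u'') = a₆ := (hp₆ u'').trans h2'
    refine ⟨u'', Prod.ext ?_ (Prod.ext ?_ ?_)⟩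
    · refine (ZtildeModB.mk_eq_iff (hu₂ u'') ha₂).mpr ?_
      rw [e₂, sub_self]
      exact zero_mem _
    · refine (H1.mk_eq_iff (hu₄ u'') ha₄).mpr ?_
      rw [e₄, sub_self]
      exact zero_mem _
    · refine (H1.mk_eq_iff (hu₆ u'') ha₆).mpr ?_
      rw [e₆, sub_self]
      exact zero_mem _
  obtain ⟨σ, hσ, hbij⟩ := exists_bijective_of_forall_iff hr Φ hΦ hsurj
  exact ⟨D, hD, σ, fun u => ⟨hu₂ u, hu₄ u, hu₆ u, hσ u⟩, hbij⟩
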